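/- **Theorem 5.1.** Let $k_1,k_2\ge 0$ and $r\ge 1$ be integers, $n=k_1+k_2$, let $\alpha\in\mathbb R$, $\alpha\neq 0$, and let $A=\operatorname{diag}(\alpha,\dots,\alpha,0,\dots,0)$ be the $n\times n$ diagonal matrix with $k_1$ entries $\alpha$ and $k_2$ entries $0$. Let $-\infty\le b_1<b_2<\dots<b_{2r}\le+\infty$ and $E=\mathbb R\cap\bigcup_{i=1}^r[b_{2i-1},b_{2i}]$. Consider the probability $$\mathbb P_n(\alpha;E)=\frac1{Z_n}\int_{\mathcal H_n(E)}e^{-\operatorname{Tr}(\frac12M^2-AM)}\,dM ,$$ where $\mathcal H_n(E)$ is the set of Hermitian $n\times n$ matrices with all eigenvalues in $E$, $dM$ is Lebesgue measure on the real vector space of Hermitian $n\times n$ matrices, and $Z_n=Z_n(\alpha)$ is the same integral over all Hermitian matrices. For $k\ge -1$ put $$\mathcal B_k=\sum_{i:\ b_i\ \mathrm{finite}}b_i^{k+1}\frac{\partial}{\partial b_i},$$ and for a derivation $\delta$ put $\{f,g\}_\delta=(\delta f)\,g-f\,(\delta g)$. Define $$F^+=\mathcal B_{-1}\tfrac{\partial}{\partial\alpha}\log\mathbb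 P_n-k_1,\qquad F^-=-\mathcal B_{-1}\bigl(\mathcal B_{-1}+\tfrac{\partial}{\partial\alpha}\bigr)\log\mathbb P_n-k_2,$$ $$H_1^+=4\tfrac{\partial}{\partial\alpha}\log\mathbb P_n+4\alpha k_1+\tfrac{4k_1k_2}{\alpha},\qquad H_1^-=-2\bigl(\mathcal B_0-\alpha\tfrac{\partial}{\partial\alpha}+1\bigr)\tfrac{\partial}{\partial\alpha}\log\mathbb P_n-\tfrac{4k_1k_2}{\alpha},$$ $$H_2^+=2\bigl(\mathcal B_0-\alpha\tfrac{\partial}{\partial\alpha}-1-2\alpha\mathcal B_{-1}\bigr)\tfrac{\partial}{\partial\alpha}\log\mathbb P_n,\qquad H_2^-=-2\bigl(\mathcal B_0-\alpha\tfrac{\partial}{\partial\alpha}-1\bigr)\bigl(\mathcal B_{-1}+\tfrac{\partial}{\partial\alpha}\bigr)\log\mathbb P_n,$$ $$2G^{\pm}=\{H_1^\pm,F^\pm\}_{\mathcal B_{-1}}\mp\{H_2^\pm,F^\pm\}_{\partial/\partial\alpha}.$$ Then $\mathbb P_n(\alpha;E)>0$, the function $\log\mathbb P_n(\alpha;E)$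 is $C^\infty$ in $\alpha$ and the finite endpoints of $E$ jointly, and it satisfies the partial differential equation (of order four, and quartic in the functions $F^\pm$, $G^\pm$ and their $\mathcal B_{-1}$-derivatives) $$\bigl(F^+\mathcal B_{-1}G^-+F^-\mathcal B_{-1}G^+\bigr)\bigl(F^+\mathcal B_{-1}F^--F^-\mathcal B_{-1}F^+\bigr)-\bigl(F^+G^-+F^-G^+\bigr)\bigl(F^+\mathcal B_{-1}^2F^--F^-\mathcal B_{-1}^2F^+\bigr)=0,$$ or, what is the same, $$\det\begin{pmatrix}G^+&\mathcal B_{-1}F^+&-F^+&0\\-G^-&\mathcal B_{-1}F^-&-F^-&0\\\mathcal B_{-1}G^+&\mathcal B_{-1}^2F^+&0&-F^+\\-\mathcal B_{-1}G^-&\mathcal B_{-1}^2F^-&0&-F^-\end{pmatrix}=0 .$$ -/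

import Mathlib

open scoped ContDiff

noncomputable section

namespace ExternalSource

/-! ### The Gaussian Hermitian ensemble with external source -/

/-- The real coordinates of an `n × n` Hermitian matrix: the diagonal entries (real) and the
strictly upper triangular entries (complex).  The measure `volume` on this type is the product of
the Lebesgue measures, i.e. the measure `dM` on the space of Hermitian matrices. -/
abbrev HermCoord (n : ℕ) : Type :=
  (Fin n → ℝ) × ({p : Fin n × Fin n // p.1 < p.2} → ℂ)

/-- The Hermitian matrix with the given coordinates. -/
def hermMatrix {n : ℕ} (c : HermCoord n) : Matrix (Fin n) (Fin n) ℂ :=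
  Matrix.of fun i j =>
    if h : i < j then c.2 ⟨(i, j), h⟩
    else if h : j < i then star (c.2 ⟨(j, i), h⟩)
    else (c.1 i : ℂ)

theorem hermMatrix_isHermitian {n : ℕ} (c : HermCoord n) : (hermMatrix c).IsHermitian := by
  ext i j
  rcases lt_trichotomy i j with h | h | h
  · simp [hermMatrix, h, h.not_gt]
  · subst h
    simp [hermMatrix]
  · simp [hermMatrix, h, h.not_gt]

theorem exists_hermMatrix_eq {n : ℕ} (M : Matrix (Fin n) (Fin n) ℂ) (hM : M.IsHermitian) :
    ∃ c : HermCoord n, hermMatrix c = M := by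
  refine ⟨⟨fun i => (M i i).re, fun p => M p.1.1 p.1.2⟩, ?_⟩
  ext i j
  rcases lt_trichotomy i j with h | h | h
  · simp [hermMatrix, h]
  · subst h
    simpa [hermMatrix] using Complex.conj_eq_iff_re.mp (hM.apply i i)
  · simpa [hermMatrix, h, h.not_gt] using hM.apply i j

/-- The external source `diag(α, …, α, 0, …, 0)` with `k₁` entries `α` and `k₂` entries `0`. -/
def source (k₁ k₂ : ℕ) (α : ℝ) : Matrix (Fin (k₁ + k₂)) (Fin (k₁ + k₂)) ℂ :=
  Matrix.diagonal fun i => if (i : ℕ) < k₁ then (α : ℂ) else 0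

/-- The unnormalized density `exp (-Tr (M² / 2 - A M))` (the trace is a real number). -/
def weight (k₁ k₂ : ℕ) (α : ℝ) (M : Matrix (Fin (k₁ + k₂)) (Fin (k₁ + k₂)) ℂ) : ℝ :=
  Real.exp (-(Matrix.trace ((1 / 2 : ℂ) • (M * M) - source k₁ k₂ α * M)).re)

/-- The probability that all eigenvalues of the random matrix lie in `S`; the denominator is the
normalization constant `Z`. -/
def prob (k₁ k₂ : ℕ) (α : ℝ) (S : Set ℝ) : ℝ :=
  (∫ c in {c : HermCoord (k₁ + k₂) | spectrum ℝ (hermMatrix c) ⊆ S},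
      weight k₁ k₂ α (hermMatrix c)) /
    ∫ c : HermCoord (k₁ + k₂), weight k₁ k₂ α (hermMatrix c)

/-! ### Unions of intervals, and the boundary operators -/

/-- The union of the `r` intervals `[b₁, b₂], [b₃, b₄], …, [b_{2r-1}, b_{2r}]`, as a subset of `ℝ`
(numbered from `0` in the code).  An endpoint may be `-∞` or `+∞`. -/
def intervals {r : ℕ} (b : Fin (2 * r) → EReal) : Set ℝ :=
  {x : ℝ | ∃ j : Fin r, b ⟨2 * (j : ℕ), by omega⟩ ≤ (x : EReal) ∧
    (x : EReal) ≤ b ⟨2 * (j : ℕ) + 1, by omega⟩}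

/-- Real-valued functions of `α` and of the endpoints. -/
abbrev Fn (r : ℕ) : Type := ℝ → (Fin (2 * r) → EReal) → ℝ

/-- `∂ / ∂α`. -/
def dAlpha {r : ℕ} (Φ : Fn r) : Fn r := fun α b => deriv (fun a => Φ a b) α

/-- `∂ / ∂bᵢ`, for a finite endpoint `bᵢ`. -/
def dEnd {r : ℕ} (i : Fin (2 * r)) (Φ : Fn r) : Fn r := fun α b =>
  deriv (fun x : ℝ => Φ α (Function.update b i (x : EReal))) (b i).toReal

/-- The operator `𝓑ₖ = ∑ᵢ bᵢ ^ (k + 1) ∂ / ∂bᵢ`, the sum over the finite endpoints. -/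
def bdry {r : ℕ} (k : ℤ) (Φ : Fn r) : Fn r := fun α b =>
  ∑ i with b i ≠ ⊥ ∧ b i ≠ ⊤, (b i).toReal ^ (k + 1) * dEnd i Φ α b

/-- Replaces the finite endpoints in `b` by the real numbers `x i`. -/
def moveEnds {r : ℕ} (b : Fin (2 * r) → EReal) (x : Fin (2 * r) → ℝ) : Fin (2 * r) → EReal :=
  fun i => if b i = ⊥ ∨ b i = ⊤ then b i else (x i : EReal)

/-- The Wronskian `{f, g}_δ = δ f * g - f * δ g` with respect to the derivation `δ`. -/
def wronskian {r : ℕ} (δ : Fn r → Fn r) (f g : Fn r) : Fn r := fun α b =>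
  δ f α b * g α b - f α b * δ g α b

/-- The logarithm of the probability that all eigenvalues lie in the union of the intervals. -/
def logProb (k₁ k₂ r : ℕ) : Fn r := fun α b => Real.log (prob k₁ k₂ α (intervals b))

/-! ### The functions entering the equation, for a given function `L` -/

def Fplus (k₁ : ℕ) {r : ℕ} (L : Fn r) : Fn r := fun α b =>
  bdry (-1) (dAlpha L) α b - k₁

def Fminus (k₂ : ℕ) {r : ℕ} (L : Fn r) : Fn r := fun α b =>
  -bdry (-1) (bdry (-1) L + dAlpha L) α b - k₂

def H1plus (k₁ k₂ : ℕ) {r : ℕ} (L : Fn r) : Fn r := fun α b =>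
  4 * dAlpha L α b + 4 * α * k₁ + 4 * k₁ * k₂ / α

def H1minus (k₁ k₂ : ℕ) {r : ℕ} (L : Fn r) : Fn r := fun α b =>
  -2 * (bdry 0 (dAlpha L) α b - α * dAlpha (dAlpha L) α b + dAlpha L α b) - 4 * k₁ * k₂ / α

def H2plus {r : ℕ} (L : Fn r) : Fn r := fun α b =>
  2 * (bdry 0 (dAlpha L) α b - α * dAlpha (dAlpha L) α b - dAlpha L α b
    - 2 * α * bdry (-1) (dAlpha L) α b)

def H2minus {r : ℕ} (L : Fn r) : Fn r := fun α b =>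
  -2 * (bdry 0 (bdry (-1) L + dAlpha L) α b - α * dAlpha (bdry (-1) L + dAlpha L) α b
    - (bdry (-1) L + dAlpha L) α b)

def Gplus (k₁ k₂ : ℕ) {r : ℕ} (L : Fn r) : Fn r := fun α b =>
  (wronskian (bdry (-1)) (H1plus k₁ k₂ L) (Fplus k₁ L) α b
    - wronskian dAlpha (H2plus L) (Fplus k₁ L) α b) / 2

def Gminus (k₁ k₂ : ℕ) {r : ℕ} (L : Fn r) : Fn r := fun α b =>
  (wronskian (bdry (-1)) (H1minus k₁ k₂ L) (Fminus k₂ L) α b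
    + wronskian dAlpha (H2minus L) (Fminus k₂ L) α b) / 2

end ExternalSource

end

/-! The proof has an analytic half, which turns the probability into a determinant of Gaussian
moments, and an algebraic half, which derives the equation from the linear differential relations
between these moments.

Analytic half. The eigenvalue density is found by adding one row and column at a time. If a corner
has eigenvalues `μ`, then the squared moduli of the entries of the new column in the eigenbasis of
the corner, together with the new diagonal entry, are explicit functions (`secular`) of the
eigenvalues `l` of the larger matrix. The change of variables has Jacobian `|Δ(l)| / |Δ(μ)|` on the
set where `l` interlaces `μ`. As the source vanishes in the last `k₂` places, the weight depends
only on the corner of size `k₁`. So each of the last `k₂` borderings integrates the density factor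
over interlacing configurations (`HasEigDensity.of_border`), and it stays the determinant of the
functions `z^i exp (α z)`, `i < k₁`, and of the powers of `z` below the number of added rows.
Pairing it with the Vandermonde determinant gives (`exists_prob_eq`) the probability as a constant
times `|α|^(-k₁k₂) exp (-k₁α²/2) |det H|`, where `H` is the matrix of moments over `E` of the
weights `exp (α z - z²/2)` and `exp (-z²/2)`.

Algebraic half. Put `A = ∂/∂α`, `D = 𝓑₋₁`, `D₀ = 𝓑₀`. Differentiation under the integral and
integration by parts show how `A`, `D`, `D₀` act on the moments; each derivative of `H` is a
combination of shifts of rows and columns up to a matrix of rank at most two. Let `h` be the Schur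
complement obtained by adding to `H` the next row of one weight and the next column, and `g` the
entry of `H⁻¹` at the last column and the last row of that weight. For the weights `α` and `0`
respectively one gets `F^± = -g h`. The shifts with one more or one less row or column give
quantities `Z` and `Y` for each weight. In terms of `u = log (h / g)` these are logarithmic
derivatives: with parameter `α`, `Z = gh · Au` and `Y = gh · (2α - Du)`; with parameter `0`, `Z =
-gh · (A + D)u` and `Y = -gh · Du`. Since `A` and `D` commute, `u` can be eliminated (`D_Z_true`,
`D_Z_false`). Computing the moments of raised index by rows and by columns gives `Z⁺ + Z⁻ = Y⁺ + Y⁻`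
(`sum_Z_eq_sum_Y`).

Consequently one function `Ξ` satisfies both `{Ξ, F⁺}_D = G⁺` and `{Ξ, F⁻}_D = -G⁻`
(`exists_wr_eq`). These two equations and their `D`-derivatives are linear and homogeneous in `(1,
Ξ, DΞ, D²Ξ)`, and the determinant of the system is the one in the theorem (`pde_of_wr`,
`det_equation`). The algebra takes place in an abstract commutative differential ring and is then
applied to the smooth functions of `α` and the finite endpoints, where `det H` is invertible because
the probability is positive. -/

noncomputable section

namespace ExternalSource

open Polynomial MeasureTheory Matrix

/-! ### Ordered eigenvalues -/

/-- The eigenvalues of the Hermitian matrix with given coordinates, in decreasing order. -/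
def eig {n : ℕ} (c : HermCoord n) (i : Fin n) : ℝ :=
  (hermMatrix_isHermitian c).eigenvalues₀ (Fin.cast (Fintype.card_fin n).symm i)

theorem eig_antitone {n : ℕ} (c : HermCoord n) : Antitone (eig c) := fun _ _ h =>
  (hermMatrix_isHermitian c).eigenvalues₀_antitone (by simpa using h)

theorem exists_eigenvalues_eq_eig {n : ℕ} (c : HermCoord n) :
    ∃ e : Fin n ≃ Fin n, ∀ i, (hermMatrix_isHermitian c).eigenvalues i = eig c (e i) :=
  ⟨(Fintype.equivOfCardEq (Fintype.card_fin _)).symm.trans (finCongr (Fintype.card_fin n)),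
    fun _ => rfl⟩

theorem charpoly_hermMatrix {n : ℕ} (c : HermCoord n) :
    (hermMatrix c).charpoly = ∏ i, (X - C (eig c i : ℂ)) := by
  obtain ⟨e, he⟩ := exists_eigenvalues_eq_eig c
  rw [(hermMatrix_isHermitian c).charpoly_eq]
  simp only [he]
  exact Equiv.prod_comp e fun i => (X - C (eig c i : ℂ))

theorem eq_of_antitone_of_prod_eq {n : ℕ} {a b : Fin n → ℝ} (ha : Antitone a) (hb : Antitone b)
    (h : ∏ i, (X - C (a i : ℂ)) = ∏ i, (X - C (b i : ℂ))) : a = b := by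
  have key : ∀ f : Fin n → ℝ, (∏ i, (X - C (f i : ℂ))).roots
      = (List.ofFn f : Multiset ℝ).map ((↑) : ℝ → ℂ) := by
    intro f
    have : ∏ i, (X - C (f i : ℂ)) = (Multiset.map (fun z : ℂ => X - C z)
        ((List.ofFn f : Multiset ℝ).map ((↑) : ℝ → ℂ))).prod := by
      rw [← Fin.univ_val_map, Multiset.map_map, Multiset.map_map]; rfl
    rw [this, roots_multiset_prod_X_sub_C]
  have h2 := congrArg roots h
  rw [key, key] at h2
  have h3 := Multiset.map_injective Complex.ofReal_injective h2
  have h4 : (List.ofFn a).Perm (List.ofFn b) := Multiset.coe_eq_coe.mp h3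
  have h5 := h4.eq_of_pairwise' (r := (· ≥ ·))
    (by rw [List.pairwise_ofFn]; exact fun i j hij => ha hij.le)
    (by rw [List.pairwise_ofFn]; exact fun i j hij => hb hij.le)
  exact List.ofFn_injective h5

theorem continuous_hermMatrix {n : ℕ} : Continuous (hermMatrix (n := n)) := by
  refine continuous_matrix fun i j => ?_
  unfold hermMatrix
  simp only [Matrix.of_apply]
  split_ifs <;> fun_prop

theorem continuous_charpoly_coeff {n : ℕ} {Y : Type*} [TopologicalSpace Y]
    (M : Y → Matrix (Fin n) (Fin n) ℂ) (hM : Continuous M) (k : ℕ) :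
    Continuous fun y => (M y).charpoly.coeff k := by
  have : ∀ y, (M y).charpoly.coeff k = MvPolynomial.eval₂ (RingHom.id ℂ) (fun p => M y p.1 p.2)
      ((Matrix.charpoly.univ ℂ (Fin n)).coeff k) := fun y =>
    (Matrix.charpoly.univ_coeff_eval₂Hom (Fin n) (RingHom.id ℂ) (fun p => M y p.1 p.2) k).symm
  simp only [this, MvPolynomial.eval₂_id]
  exact (MvPolynomial.continuous_eval _).comp
    (continuous_pi fun p => hM.matrix_elem p.1 p.2)

/-- The coefficients of the characteristic polynomial are continuous in the matrix, and on the
closed cone of decreasing vectors they are a continuous injective function of the roots. By the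
Lusin–Souslin theorem this function is a measurable embedding, so measurability passes from the
coefficients to the roots without any continuity of eigenvalues. -/
theorem measurable_eig {n : ℕ} : Measurable (eig (n := n)) := by
  let Ch : Set (Fin n → ℝ) := {a | Antitone a}
  have hCh : IsClosed Ch := by
    have : Ch = ⋂ (i) (j) (_ : i ≤ j), {a : Fin n → ℝ | a j ≤ a i} := by
      ext a; simp [Ch, Antitone]
    rw [this]
    exact isClosed_iInter fun i => isClosed_iInter fun j => isClosed_iInter fun _ =>
      isClosed_le (continuous_apply j) (continuous_apply i)
  let co : Ch → (ℕ → ℂ) := fun a k => (∏ i, (X - C (a.1 i : ℂ))).coeff k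
  have hco : Continuous co := by
    refine continuous_pi fun k => ?_
    have : ∀ a : Ch, (∏ i, (X - C (a.1 i : ℂ))) = (Matrix.diagonal fun i => (a.1 i : ℂ)).charpoly := by
      intro a; rw [Matrix.charpoly_diagonal]
    simp only [co, this]
    refine continuous_charpoly_coeff _ (Continuous.matrix_diagonal (continuous_pi fun i =>
      Complex.continuous_ofReal.comp ((continuous_apply i).comp continuous_subtype_val))) k
  have hinj : Function.Injective co := fun a b h =>
    Subtype.ext (eq_of_antitone_of_prod_eq a.2 b.2 (Polynomial.ext fun k => congrFun h k))
  have : PolishSpace Ch := hCh.polishSpace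
  have hemb : MeasurableEmbedding co := hco.measurableEmbedding hinj
  have : Measurable fun c : HermCoord n => (⟨eig c, eig_antitone c⟩ : Ch) := by
    rw [← hemb.measurable_comp_iff]
    refine Continuous.measurable (continuous_pi fun k => ?_)
    simp only [Function.comp_apply, co, ← charpoly_hermMatrix]
    exact continuous_charpoly_coeff _ continuous_hermMatrix k
  exact measurable_subtype_coe.comp this

theorem spectrum_hermMatrix {n : ℕ} (c : HermCoord n) :
    spectrum ℝ (hermMatrix c) = Set.range (eig c) := by
  obtain ⟨e, he⟩ := exists_eigenvalues_eq_eig c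
  rw [(hermMatrix_isHermitian c).spectrum_real_eq_range_eigenvalues, funext he]
  exact e.surjective.range_comp (eig c)

theorem sum_diag_eq_sum_eig {n : ℕ} (c : HermCoord n) : ∑ i, c.1 i = ∑ i, eig c i := by
  obtain ⟨e, he⟩ := exists_eigenvalues_eq_eig c
  have := (hermMatrix_isHermitian c).trace_eq_sum_eigenvalues
  have h2 : (hermMatrix c).trace = ∑ i, (c.1 i : ℂ) :=
    Finset.sum_congr rfl fun i _ => by simp [hermMatrix]
  rw [h2] at this
  simp only [he] at this
  exact_mod_cast this.trans (Equiv.sum_comp e fun i => ((eig c i : ℝ) : ℂ))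

theorem trace_sq_hermMatrix {n : ℕ} (c : HermCoord n) :
    (hermMatrix c * hermMatrix c).trace = ((∑ i, eig c i ^ 2 : ℝ) : ℂ) := by
  obtain ⟨e, he⟩ := exists_eigenvalues_eq_eig c
  have h := (hermMatrix_isHermitian c).spectral_theorem
  set U := (hermMatrix_isHermitian c).eigenvectorUnitary
  rw [h, ← map_mul, Unitary.conjStarAlgAut_apply, Matrix.trace_mul_comm, ← mul_assoc]
  simp only [Unitary.coe_star_mul_self, one_mul, Matrix.diagonal_mul_diagonal, Matrix.trace_diagonal, Function.comp_apply, he]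
  refine (Equiv.sum_comp e fun i => ((eig c i : ℝ) : ℂ) * ((eig c i : ℝ) : ℂ)).trans ?_
  push_cast
  simp [sq]

/-! ### Bordering a Hermitian matrix by a column and a corner entry -/

/-- Strictly upper triangular positions of size `n + 1`: those of size `n` and the last column. -/
def upperPairsSucc (n : ℕ) : {p : Fin n × Fin n // p.1 < p.2} ⊕ Fin n ≃
    {p : Fin (n + 1) × Fin (n + 1) // p.1 < p.2} :=
  Equiv.ofBijective
    (Sum.elim (fun p => ⟨(p.1.1.castSucc, p.1.2.castSucc), by simpa using p.2⟩)
      fun i => ⟨(i.castSucc, Fin.last n), Fin.castSucc_lt_last i⟩) (by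
    constructor
    · rintro (⟨⟨a, b⟩, h⟩ | i) (⟨⟨a', b'⟩, h'⟩ | i') h
      · simpa using h
      · simp [Fin.ext_iff] at h; omega
      · simp [Fin.ext_iff] at h; omega
      · simpa using h
    · rintro ⟨⟨a, b⟩, h⟩
      have hab : a < b := h
      have ha : a ≠ Fin.last n := (lt_of_lt_of_le hab (Fin.le_last b)).ne
      by_cases hb : b = Fin.last n
      · exact ⟨Sum.inr (a.castPred ha), by simp [hb]⟩
      · exact ⟨Sum.inl ⟨(a.castPred ha, b.castPred hb), by simpa using hab⟩, by simp⟩)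

/-- The coordinates of the matrix `c` bordered by the column `v` and the corner `x`. -/
def border {n : ℕ} (c : HermCoord n) (v : Fin n → ℂ) (x : ℝ) : HermCoord (n + 1) :=
  (Fin.snoc c.1 x, fun p => Sum.elim c.2 v ((upperPairsSucc n).symm p))

theorem lintegral_border {n : ℕ} (G : HermCoord (n + 1) → ENNReal) (hG : Measurable G) :
    ∫⁻ c, G c = ∫⁻ c : HermCoord n, ∫⁻ v : Fin n → ℂ, ∫⁻ x : ℝ, G (border c v x) := by
  have e1 := (volume_preserving_piFinSuccAbove (fun _ : Fin (n + 1) => ℝ) (Fin.last n)).symm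
  have e2 := (volume_measurePreserving_piCongrLeft
      (fun _ : {p : Fin (n + 1) × Fin (n + 1) // p.1 < p.2} => ℂ) (upperPairsSucc n)).comp
    (volume_measurePreserving_sumPiEquivProdPi_symm
      (fun _ : {p : Fin n × Fin n // p.1 < p.2} ⊕ Fin n => ℂ))
  have e3 := e1.prod e2
  have e : ∀ (x : ℝ) (d : Fin n → ℝ) (u : {p : Fin n × Fin n // p.1 < p.2} → ℂ) (v : Fin n → ℂ),
      ((MeasurableEquiv.piFinSuccAbove (fun _ : Fin (n + 1) => ℝ) (Fin.last n)).symm (x, d),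
        (MeasurableEquiv.piCongrLeft
      (fun _ : {p : Fin (n + 1) × Fin (n + 1) // p.1 < p.2} => ℂ) (upperPairsSucc n))
        ((MeasurableEquiv.sumPiEquivProdPi
      (fun _ : {p : Fin n × Fin n // p.1 < p.2} ⊕ Fin n => ℂ)).symm (u, v)))
        = border (d, u) v x := by
    intro x d u v
    refine Prod.ext ?_ (funext fun p => ?_)
    · simp only [border, MeasurableEquiv.piFinSuccAbove_symm_apply, Fin.insertNthEquiv_last]
      rfl
    · obtain ⟨q, rfl⟩ := (upperPairsSucc n).surjective p
      simp only [MeasurableEquiv.coe_piCongrLeft, border, Equiv.symm_apply_apply]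
      erw [Equiv.piCongrLeft_apply_apply]
      rcases q with q | q <;> rfl
  have h0 := e3.lintegral_comp hG
  have hm : Measurable fun q : (ℝ × (Fin n → ℝ)) × ({p : Fin n × Fin n // p.1 < p.2} → ℂ) × (Fin n → ℂ) => G (border (q.1.2, q.2.1) q.2.2 q.1.1) := by
    have := hG.comp e3.measurable
    convert this using 2 with q
    exact congrArg G (e q.1.1 q.1.2 q.2.1 q.2.2).symm
  have h1 : ∫⁻ c, G c = ∫⁻ q : (ℝ × (Fin n → ℝ)) × ({p : Fin n × Fin n // p.1 < p.2} → ℂ) × (Fin n → ℂ),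
      G (border (q.1.2, q.2.1) q.2.2 q.1.1) := by
    refine h0.symm.trans (lintegral_congr fun q => ?_)
    exact congrArg G (e q.1.1 q.1.2 q.2.1 q.2.2)
  have hm2 : ∀ d : Fin n → ℝ, Measurable fun q : (({p : Fin n × Fin n // p.1 < p.2} → ℂ) ×
      (Fin n → ℂ)) × ℝ => G (border (d, q.1.1) q.1.2 q.2) := fun d =>
    hm.comp (f := fun q : (({p : Fin n × Fin n // p.1 < p.2} → ℂ) × (Fin n → ℂ)) × ℝ =>
      ((q.2, d), q.1)) (by fun_prop)
  have hm3 : Measurable fun q : (HermCoord n × (Fin n → ℂ)) × ℝ => G (border q.1.1 q.1.2 q.2) :=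
    hm.comp (f := fun q : (HermCoord n × (Fin n → ℂ)) × ℝ =>
      ((q.2, q.1.1.1), (q.1.1.2, q.1.2))) (by fun_prop)
  rw [h1, Measure.volume_eq_prod, lintegral_prod _ hm.aemeasurable, Measure.volume_eq_prod,
    lintegral_prod_symm' _ hm.lintegral_prod_right', Measure.volume_eq_prod (Fin n → ℝ),
    lintegral_prod _ hm3.lintegral_prod_right'.lintegral_prod_right'.aemeasurable]
  refine lintegral_congr fun d => ?_
  refine (lintegral_lintegral_swap (f := fun x (y : ({p : Fin n × Fin n // p.1 < p.2} → ℂ) ×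
    (Fin n → ℂ)) => G (border (d, y.1) y.2 x)) ((hm2 d).comp measurable_swap).aemeasurable).trans ?_
  rw [Measure.volume_eq_prod, lintegral_prod _ (hm2 d).lintegral_prod_right'.aemeasurable]

theorem hermMatrix_border {n : ℕ} (c : HermCoord n) (v : Fin n → ℂ) (x : ℝ) :
    hermMatrix (border c v x) = Matrix.reindex finSumFinEquiv finSumFinEquiv
      (Matrix.fromBlocks (hermMatrix c) (Matrix.replicateCol (Fin 1) v)
        (Matrix.replicateRow (Fin 1) (star v)) (Matrix.of fun _ _ => (x : ℂ))) := by
  have hA : ∀ (i j : Fin n) (h : i < j), (upperPairsSucc n).symm ⟨(i.castSucc, j.castSucc), by simpa using h⟩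
      = Sum.inl ⟨(i, j), h⟩ := fun i j h => (Equiv.symm_apply_eq _).2 rfl
  have hB : ∀ (i : Fin n), (upperPairsSucc n).symm ⟨(i.castSucc, Fin.last n), Fin.castSucc_lt_last i⟩
      = Sum.inr i := fun i => (Equiv.symm_apply_eq _).2 rfl
  have hc : ∀ i : Fin n, finSumFinEquiv.symm i.castSucc = (Sum.inl i : Fin n ⊕ Fin 1) := fun i => (Equiv.symm_apply_eq _).2 rfl
  have hl : finSumFinEquiv.symm (Fin.last n) = (Sum.inr 0 : Fin n ⊕ Fin 1) := (Equiv.symm_apply_eq _).2 rfl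
  ext i j
  rw [Matrix.reindex_apply, Matrix.submatrix_apply]
  induction i using Fin.lastCases with
  | last =>
    induction j using Fin.lastCases with
    | last => simp [hl, hermMatrix, border]
    | cast j => simp [hl, hc, hermMatrix, border, hB, (Fin.castSucc_lt_last j).not_gt, Fin.castSucc_lt_last]
  | cast i =>
    induction j using Fin.lastCases with
    | last => simp [hl, hc, hermMatrix, border, hB,  Fin.castSucc_lt_last]
    | cast j =>
      rw [hc, hc, Matrix.fromBlocks_apply₁₁]
      rcases lt_trichotomy i j with h | h | h
      · simp [hermMatrix, h, border, hA _ _ h]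
      · subst h; simp [hermMatrix, border]
      · simp [hermMatrix, h, h.not_gt, border, hA _ _ h]

/-- The spectral theorem with the eigenvectors relabelled, so that the diagonal is decreasing. -/
theorem exists_unitary_hermMatrix {n : ℕ} (c : HermCoord n) :
    ∃ U : Matrix (Fin n) (Fin n) ℂ, star U * U = 1 ∧ U * star U = 1 ∧
      hermMatrix c = U * Matrix.diagonal (fun i => (eig c i : ℂ)) * star U := by
  obtain ⟨e, he⟩ := exists_eigenvalues_eq_eig c
  have h := (hermMatrix_isHermitian c).spectral_theorem
  set V := (hermMatrix_isHermitian c).eigenvectorUnitary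
  rw [Unitary.conjStarAlgAut_apply] at h
  have hV1 : star (V : Matrix (Fin n) (Fin n) ℂ) * V = 1 := Unitary.coe_star_mul_self V
  have hV2 : (V : Matrix (Fin n) (Fin n) ℂ) * star (V : Matrix (Fin n) (Fin n) ℂ) = 1 :=
    Unitary.coe_mul_star_self V
  have hd : Matrix.diagonal (fun i => (eig c i : ℂ)) = (Matrix.diagonal
      (RCLike.ofReal ∘ (hermMatrix_isHermitian c).eigenvalues)).submatrix e.symm e.symm := by
    rw [Matrix.submatrix_diagonal_equiv]
    congr 1; ext i; simp [he]
  have hs : star ((V : Matrix (Fin n) (Fin n) ℂ).submatrix id e.symm)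
      = (star (V : Matrix (Fin n) (Fin n) ℂ)).submatrix e.symm id := rfl
  refine ⟨(V : Matrix (Fin n) (Fin n) ℂ).submatrix id e.symm, ?_, ?_, ?_⟩
  · rw [hs, ← Matrix.submatrix_mul _ _ _ _ _ Function.bijective_id, hV1,
      Matrix.submatrix_one_equiv]
  · rw [hs, ← Matrix.submatrix_mul _ _ _ _ _ e.symm.bijective, hV2, Matrix.submatrix_id_id]
  · rw [hs, hd, ← Matrix.submatrix_mul _ _ _ _ _ e.symm.bijective, ← Matrix.submatrix_mul _ _ _ _ _ e.symm.bijective, Matrix.submatrix_id_id]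
    exact h

/-! ### Interlacing and the secular equation -/

/-- The vectors strictly interlacing `μ` (both in decreasing order). -/
def interlace {n : ℕ} (μ : Fin n → ℝ) : Set (Fin (n + 1) → ℝ) :=
  {l | ∀ i : Fin n, μ i < l i.castSucc ∧ l i.succ < μ i}

/-- The squared moduli of the border column and the corner entry, for a matrix with eigenvalues `l`
obtained by bordering the diagonal matrix `μ`. -/
def secular {n : ℕ} (μ : Fin n → ℝ) (l : Fin (n + 1) → ℝ) : Fin (n + 1) → ℝ :=
  Fin.snoc (α := fun _ => ℝ) (fun i => -(∏ j, (μ i - l j)) / ∏ j ∈ Finset.univ.erase i, (μ i - μ j))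
    (∑ j, l j - ∑ i, μ i)

/-- At a point `z` that is no `μ i`, the block `z - M` is invertible and the Schur complement
formula gives the value; infinitely many such points determine the polynomial. -/
theorem charpoly_border {n : ℕ} (c : HermCoord n) (v : Fin n → ℂ) (x : ℝ)
    (U : Matrix (Fin n) (Fin n) ℂ) (μ : Fin n → ℝ) (hU : star U * U = 1)
    (hc : hermMatrix c = U * Matrix.diagonal (fun i => (μ i : ℂ)) * star U) :
    (hermMatrix (border c v x)).charpoly = (∏ i, (X - C (μ i : ℂ))) * (X - C (x : ℂ)) -
      ∑ i, C ((Complex.normSq ((star U).mulVec v i) : ℝ) : ℂ) *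
        ∏ j ∈ Finset.univ.erase i, (X - C (μ j : ℂ)) := by
  have hU' : U * star U = 1 := mul_eq_one_comm.mp hU
  refine Polynomial.eq_of_infinite_eval_eq _ _ ?_
  refine Set.Infinite.mono (s := (Set.range fun i => (μ i : ℂ))ᶜ) ?_
    (Set.finite_range _).infinite_compl
  intro z hz
  have hz' : ∀ i, z - μ i ≠ 0 := fun i h => hz ⟨i, (sub_eq_zero.mp h).symm⟩
  set w := (star U).mulVec v with hw
  have hinv : (Matrix.scalar (Fin n) z - hermMatrix c) *
      (U * Matrix.diagonal (fun i => (z - μ i)⁻¹) * star U) = 1 := by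
    have : Matrix.scalar (Fin n) z - hermMatrix c
        = U * Matrix.diagonal (fun i => z - (μ i : ℂ)) * star U := by
      have h1 : Matrix.diagonal (fun i => z - (μ i : ℂ))
          = z • (1 : Matrix (Fin n) (Fin n) ℂ) - Matrix.diagonal (fun i => (μ i : ℂ)) := by
        rw [← Matrix.diagonal_one, ← Matrix.diagonal_smul, Matrix.diagonal_sub]
        congr 1; ext i; simp
      rw [hc, h1, Matrix.mul_sub, Matrix.sub_mul, Matrix.mul_smul, Matrix.smul_mul, Matrix.mul_one, hU']
      simp [Matrix.scalar_apply, Matrix.smul_one_eq_diagonal]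
    rw [this]
    have h2 : U * Matrix.diagonal (fun i => z - (μ i : ℂ)) * star U *
        (U * Matrix.diagonal (fun i => (z - μ i)⁻¹) * star U) =
        U * (Matrix.diagonal (fun i => z - (μ i : ℂ)) * (star U * U) *
          Matrix.diagonal (fun i => (z - μ i)⁻¹)) * star U := by
      simp only [Matrix.mul_assoc]
    rw [h2, hU, Matrix.mul_one, Matrix.diagonal_mul_diagonal]
    simp [hz', hU']
  let : Invertible (Matrix.scalar (Fin n) z - hermMatrix c) :=
    ⟨_, mul_eq_one_comm.mp hinv, hinv⟩
  have hinv' : ⅟(Matrix.scalar (Fin n) z - hermMatrix c)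
      = U * Matrix.diagonal (fun i => (z - μ i)⁻¹) * star U := invOf_eq_right_inv hinv
  have hdet : (Matrix.scalar (Fin n) z - hermMatrix c).det = ∏ i, (z - μ i) := by
    rw [← Matrix.eval_charpoly, hc, Matrix.charpoly_mul_comm, ← Matrix.mul_assoc, hU,
      Matrix.one_mul, Matrix.charpoly_diagonal]
    simp [eval_prod]
  have hblock : Matrix.scalar (Fin (n + 1)) z - hermMatrix (border c v x) =
      Matrix.reindex finSumFinEquiv finSumFinEquiv
      (Matrix.fromBlocks (Matrix.scalar (Fin n) z - hermMatrix c) (-Matrix.replicateCol (Fin 1) v)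
        (-Matrix.replicateRow (Fin 1) (star v)) (Matrix.of fun _ _ => z - (x : ℂ))) := by
    have h1 : Matrix.scalar (Fin (n + 1)) z = Matrix.reindex finSumFinEquiv finSumFinEquiv
        (Matrix.scalar (Fin n ⊕ Fin 1) z) := by
      simp [Matrix.scalar_apply, Matrix.submatrix_diagonal_equiv, Function.comp_def]
    rw [h1, hermMatrix_border]
    ext i j
    obtain ⟨i, rfl⟩ := finSumFinEquiv.surjective i
    obtain ⟨j, rfl⟩ := finSumFinEquiv.surjective j
    rcases i with i | i <;> rcases j with j | j <;>
      simp [Matrix.diagonal_apply, Fin.fin_one_eq_zero] <;>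
      (intro h; simp [Fin.ext_iff] at h; omega)
  have hquad : ∀ d : Fin n → ℂ, (Matrix.replicateRow (Fin 1) (star v) * (U * Matrix.diagonal d * star U) *
      Matrix.replicateCol (Fin 1) v) 0 0 = ∑ i, d i * (Complex.normSq (w i) : ℝ) := by
    intro d
    have h1 : (Matrix.replicateRow (Fin 1) (star v) * (U * Matrix.diagonal d * star U) *
      Matrix.replicateCol (Fin 1) v) = (Matrix.replicateRow (Fin 1) (Matrix.vecMul (star v) U)) *
        (Matrix.diagonal d * Matrix.replicateCol (Fin 1) w) := by
      rw [hw, Matrix.replicateRow_vecMul, Matrix.replicateCol_mulVec]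
      simp only [Matrix.mul_assoc]
    have h2 : ∀ i, Matrix.vecMul (star v) U i = star (w i) := by
      intro i
      rw [hw, ← Pi.star_apply, Matrix.star_mulVec]
      simp [Matrix.star_eq_conjTranspose]
    rw [h1, Matrix.mul_apply]
    refine Finset.sum_congr rfl fun i _ => ?_
    rw [Matrix.diagonal_mul]
    simp only [Matrix.replicateRow_apply, h2, Matrix.replicateCol_apply, Complex.normSq_eq_conj_mul_self]
    simp only [Complex.star_def]; ring
  change eval z _ = eval z _
  rw [Matrix.eval_charpoly, hblock, Matrix.det_reindex_self, Matrix.det_fromBlocks₁₁, hdet, hinv',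
    Matrix.det_unique]
  simp only [Matrix.neg_mul, Matrix.mul_neg, neg_neg, Matrix.sub_apply, Fin.default_eq_zero, hquad, eval_sub, eval_mul, eval_prod, eval_X, eval_C, eval_finsetSum, Matrix.of_apply]
  rw [mul_sub, Finset.mul_sum]
  congr 1
  refine Finset.sum_congr rfl fun i _ => ?_
  rw [← Finset.mul_prod_erase Finset.univ _ (Finset.mem_univ i)]
  have := hz' i
  field_simp

theorem strictAnti_of_mem_interlace {n : ℕ} {μ : Fin n → ℝ} {l : Fin (n + 1) → ℝ}
    (h : l ∈ interlace μ) : StrictAnti l :=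
  Fin.strictAnti_iff_succ_lt.2 fun i => (h i).2.trans (h i).1

theorem neg_one_pow_card_mul_prod {ι : Type*} (s : Finset ι) (f : ι → ℝ) (hf : ∀ i ∈ s, f i ≠ 0) :
    0 < (-1 : ℝ) ^ (s.filter fun i => f i < 0).card * ∏ i ∈ s, f i := by
  classical
  induction s using Finset.induction_on with
  | empty => simp
  | insert a s ha ih =>
    have ih' := ih fun i hi => hf i (Finset.mem_insert_of_mem hi)
    rw [Finset.prod_insert ha, Finset.filter_insert]
    rcases (hf a (Finset.mem_insert_self a s)).lt_or_gt with h | h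
    · rw [if_pos h, Finset.card_insert_of_notMem (by simp [ha]), pow_succ]
      nlinarith [mul_pos ih' (neg_pos.2 h)]
    · rw [if_neg h.not_gt]
      nlinarith [mul_pos ih' h]

/-- Sign counting. Let `N i` be the number of `l j` above `μ i`. The left side has sign `(-1)^(N
i)`, the right side `-(-1)^i`, so `N i + i` is odd. As `N` is monotone with alternating parity, it
increases strictly, and the bound `N ≤ n + 1` leaves only `N i = i + 1`, which is interlacing. -/
theorem mem_interlace_of_prod_eq {n : ℕ} {μ : Fin n → ℝ} (hμ : StrictAnti μ) {l : Fin (n + 1) → ℝ}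
    (hl : Antitone l) (y : Fin n → ℝ) (hy : ∀ i, 0 < y i)
    (h : ∀ i, ∏ j, (μ i - l j) = -(y i * ∏ j ∈ Finset.univ.erase i, (μ i - μ j))) :
    l ∈ interlace μ := by
  have hne : ∀ i j, j ∈ Finset.univ.erase i → μ i - μ j ≠ 0 := fun i j hj =>
    sub_ne_zero.2 (hμ.injective.ne (Finset.ne_of_mem_erase hj).symm)
  have hp : ∀ i, ∏ j, (μ i - l j) ≠ 0 := fun i => by
    rw [h, neg_ne_zero]
    exact mul_ne_zero (hy i).ne' (Finset.prod_ne_zero_iff.2 (hne i))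
  have hp' : ∀ i j, μ i - l j ≠ 0 := fun i j => Finset.prod_ne_zero_iff.1 (hp i) j (Finset.mem_univ j)
  let N : Fin n → ℕ := fun i => (Finset.univ.filter fun j => μ i - l j < 0).card
  have hodd : ∀ i, Odd (N i + (i : ℕ)) := by
    intro i
    have h1 := neg_one_pow_card_mul_prod Finset.univ (fun j => μ i - l j) fun j _ => hp' i j
    have h2 := neg_one_pow_card_mul_prod (Finset.univ.erase i) (fun j => μ i - μ j) (hne i)
    have hc : ((Finset.univ.erase i).filter fun j => μ i - μ j < 0).card = i := by
      have : ((Finset.univ.erase i).filter fun j => μ i - μ j < 0) = Finset.Iio i := by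
        ext j
        simp only [Finset.mem_filter, Finset.mem_erase, Finset.mem_univ, and_true, Finset.mem_Iio, sub_neg, hμ.lt_iff_gt]
        exact ⟨fun h => h.2, fun h => ⟨h.ne, h⟩⟩
      rw [this, Fin.card_Iio]
    rw [hc] at h2
    rw [h] at h1
    rcases Nat.even_or_odd (N i + i) with he | ho
    · exfalso
      have h3 := mul_pos (mul_pos h1 h2) (hy i)
      have h4 : (-1 : ℝ) ^ N i * (-1) ^ (i : ℕ) = 1 := by rw [← pow_add, he.neg_one_pow]
      have h5 : ((-1 : ℝ) ^ N i * (-1) ^ (i : ℕ)) * (-(y i * ∏ j ∈ Finset.univ.erase i, (μ i - μ j)) *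
        (∏ j ∈ Finset.univ.erase i, (μ i - μ j)) * y i) > 0 := by
        refine lt_of_lt_of_eq h3 ?_
        simp only [N]; ring
      rw [h4] at h5
      nlinarith [sq_nonneg (y i * ∏ j ∈ Finset.univ.erase i, (μ i - μ j))]
    · exact ho
  have hmono : ∀ i j : Fin n, i ≤ j → N i ≤ N j := fun i j hij =>
    Finset.card_le_card fun k hk => by
      simp only [Finset.mem_filter, Finset.mem_univ, true_and, sub_neg] at hk ⊢
      exact (hμ.antitone hij).trans_lt hk
  have hstep : ∀ (k : ℕ) (i j : Fin n), (j : ℕ) = i + k → N i + k ≤ N j := by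
    intro k
    induction k with
    | zero => intro i j hij; exact hmono i j (by simp [Fin.le_def, hij])
    | succ k ih =>
      intro i j hij
      have hj : (j : ℕ) - 1 < n := by omega
      have h1 := ih i ⟨j - 1, hj⟩ (by simp; omega)
      have h2 := hmono ⟨j - 1, hj⟩ j (by simp [Fin.le_def])
      obtain ⟨a, ha⟩ := hodd ⟨j - 1, hj⟩
      obtain ⟨b, hb⟩ := hodd j
      simp only at ha
      omega
  have hN : ∀ i : Fin n, N i = i + 1 := by
    intro i
    have hi := i.2
    have h1 := hstep i ⟨0, by omega⟩ i (by simp)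
    have h2 := hstep (n - 1 - i) i ⟨n - 1, by omega⟩ (by simp; omega)
    -- The value `n + 1` itself is then excluded by parity.
    have h3 : N ⟨n - 1, by omega⟩ ≤ n + 1 := (Finset.card_le_univ _).trans (by simp)
    obtain ⟨a, ha⟩ := hodd ⟨0, by omega⟩
    obtain ⟨b, hb⟩ := hodd ⟨n - 1, by omega⟩
    simp only at ha hb
    omega
  intro i
  constructor
  · by_contra hcon
    have : (Finset.univ.filter fun j => μ i - l j < 0) ⊆ Finset.Iio i.castSucc := by
      intro j hj
      simp only [Finset.mem_filter, Finset.mem_univ, true_and, sub_neg, Finset.mem_Iio] at hj ⊢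
      by_contra hij
      exact hcon (hj.trans_le (hl (not_lt.1 hij)))
    have := Finset.card_le_card this
    rw [Fin.card_Iio] at this
    have h2 := hN i
    simp only [N] at h2
    simp only [Fin.val_castSucc] at this
    omega
  · by_contra hcon
    have hlt : μ i < l i.succ := lt_of_le_of_ne (not_lt.1 hcon) (sub_ne_zero.1 (hp' i i.succ))
    have : Finset.Iic i.succ ⊆ (Finset.univ.filter fun j => μ i - l j < 0) := by
      intro j hj
      simp only [Finset.mem_filter, Finset.mem_univ, true_and, sub_neg, Finset.mem_Iic] at hj ⊢
      exact hlt.trans_le (hl hj)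
    have := Finset.card_le_card this
    rw [Fin.card_Iic] at this
    have h2 := hN i
    simp only [N] at h2
    simp only [Fin.val_succ] at this
    omega

/-- At `μ i` only the `i`-th summand of `charpoly_border` survives, and it gives the squared modulus
of the `i`-th coordinate of the border column in the eigenbasis. The corner entry is the difference
of the traces. -/
theorem eig_border {n : ℕ} (c : HermCoord n) (v : Fin n → ℂ) (x : ℝ)
    (U : Matrix (Fin n) (Fin n) ℂ) {μ : Fin n → ℝ} (hμ : StrictAnti μ) (hU : star U * U = 1)
    (hc : hermMatrix c = U * Matrix.diagonal (fun i => (μ i : ℂ)) * star U)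
    (hv : ∀ i, (star U).mulVec v i ≠ 0) :
    eig (border c v x) ∈ interlace μ ∧ secular μ (eig (border c v x)) =
      Fin.snoc (α := fun _ => ℝ) (fun i => Complex.normSq ((star U).mulVec v i)) x := by
  have hp := charpoly_border c v x U μ hU hc
  rw [charpoly_hermMatrix] at hp
  have hprod : ∀ i, ∏ j, (μ i - eig (border c v x) j) = -(Complex.normSq ((star U).mulVec v i) *
      ∏ j ∈ Finset.univ.erase i, (μ i - μ j)) := by
    intro i
    have h1 := congrArg (eval (μ i : ℂ)) hp
    simp only [eval_sub, eval_mul, eval_prod, eval_X, eval_C, eval_finsetSum] at h1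
    rw [Finset.prod_eq_zero (Finset.mem_univ i) (sub_self (μ i : ℂ)), zero_mul, zero_sub,
      Finset.sum_eq_single i] at h1
    · exact_mod_cast h1
    · intro b _ hb
      rw [Finset.prod_eq_zero (Finset.mem_erase.2 ⟨hb.symm, Finset.mem_univ i⟩) (sub_self (μ i : ℂ)), mul_zero]
    · simp
  refine ⟨mem_interlace_of_prod_eq hμ (eig_antitone _) _ (fun i => Complex.normSq_pos.2 (hv i)) hprod, ?_⟩
  have htr : ∑ i, μ i = ∑ i, c.1 i := by
    have h1 : (hermMatrix c).trace = ∑ i, (c.1 i : ℂ) :=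
      Finset.sum_congr rfl fun i _ => by simp [hermMatrix]
    rw [hc, Matrix.trace_mul_comm, ← Matrix.mul_assoc, hU, Matrix.one_mul, Matrix.trace_diagonal] at h1
    exact_mod_cast h1
  refine funext fun i => ?_
  induction i using Fin.lastCases with
  | last =>
    simp only [secular, Fin.snoc_last, htr]
    rw [← sum_diag_eq_sum_eig, Fin.sum_univ_castSucc]
    simp [border]
  | cast i =>
    simp only [secular, Fin.snoc_castSucc, hprod]
    rw [neg_neg, mul_div_assoc, div_self, mul_one]
    exact Finset.prod_ne_zero_iff.2 fun j hj =>
      sub_ne_zero.2 (hμ.injective.ne (Finset.ne_of_mem_erase hj).symm)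

/-- Two monic polynomials of degree `n + 1` with the same sum of roots differ by a polynomial of
degree below `n`; if they agree at the `n` distinct points `μ i`, they are equal. -/
theorem secular_injOn {n : ℕ} {μ : Fin n → ℝ} (hμ : StrictAnti μ) :
    Set.InjOn (secular μ) (interlace μ) := by
  intro l hl l' hl' h
  refine eq_of_antitone_of_prod_eq (strictAnti_of_mem_interlace hl).antitone
    (strictAnti_of_mem_interlace hl').antitone ?_
  have hsum : ∑ j, l j = ∑ j, l' j := by
    have := congrFun h (Fin.last n)
    simpa [secular] using this
  have hprod : ∀ i, ∏ j, (μ i - l j) = ∏ j, (μ i - l' j) := by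
    intro i
    have := congrFun h i.castSucc
    simp only [secular, Fin.snoc_castSucc] at this
    rw [div_left_inj'] at this
    · exact neg_injective this
    · exact Finset.prod_ne_zero_iff.2 fun j hj =>
        sub_ne_zero.2 (hμ.injective.ne (Finset.ne_of_mem_erase hj).symm)
  have hdeg : ∀ l : Fin (n + 1) → ℝ, (∏ i, (X - C (l i))).natDegree = n + 1 := fun l => by
    rw [natDegree_finsetProd_X_sub_C_eq_card]; simp
  have key : ∏ i, (X - C (l i)) = ∏ i, (X - C (l' i)) := by
    refine Polynomial.eq_of_degree_sub_lt_of_eval_finset_eq (Finset.univ.image μ) ?_ ?_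
    · rw [Finset.card_image_of_injective _ hμ.injective, Finset.card_univ, Fintype.card_fin,
        degree_lt_iff_coeff_zero]
      intro m hm
      rw [coeff_sub, sub_eq_zero]
      rcases hm.lt_or_eq with hm | rfl
      · rcases (Nat.succ_le_of_lt hm).lt_or_eq with hm | rfl
        · rw [coeff_eq_zero_of_natDegree_lt (by rw [hdeg]; exact hm),
            coeff_eq_zero_of_natDegree_lt (by rw [hdeg]; exact hm)]
        · have h1 := (monic_prod_X_sub_C l Finset.univ).coeff_natDegree
          have h2 := (monic_prod_X_sub_C l' Finset.univ).coeff_natDegree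
          rw [hdeg] at h1 h2
          exact h1.trans h2.symm
      · have h1 := prod_X_sub_C_nextCoeff (s := Finset.univ) l
        have h2 := prod_X_sub_C_nextCoeff (s := Finset.univ) l'
        rw [nextCoeff_of_natDegree_pos (by rw [hdeg]; omega), hdeg] at h1 h2
        simp only [Nat.add_sub_cancel] at h1 h2
        rw [h1, h2, hsum]
    · intro x hx
      obtain ⟨i, -, rfl⟩ := Finset.mem_image.1 hx
      simpa [eval_prod] using hprod i
  have := congrArg (Polynomial.map Complex.ofRealHom) key
  simpa [Polynomial.map_prod] using this

/-- The Jacobian matrix of `secular μ`. -/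
def secularJacobian {n : ℕ} (μ : Fin n → ℝ) (l : Fin (n + 1) → ℝ) :
    Matrix (Fin (n + 1)) (Fin (n + 1)) ℝ := Matrix.of
  (Fin.snoc (α := fun _ => Fin (n + 1) → ℝ) (fun i k => (∏ j ∈ Finset.univ.erase k, (μ i - l j)) /
    ∏ j ∈ Finset.univ.erase i, (μ i - μ j)) fun _ => 1)

theorem hasFDerivAt_secular {n : ℕ} (μ : Fin n → ℝ) (l : Fin (n + 1) → ℝ) :
    HasFDerivAt (secular μ) (LinearMap.toContinuousLinearMap (toLin' (secularJacobian μ l))) l := by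
  rw [hasFDerivAt_pi']
  intro i
  induction i using Fin.lastCases with
  | last =>
    have h : HasFDerivAt (fun l : Fin (n + 1) → ℝ => ∑ j, l j - ∑ i, μ i)
        (∑ j : Fin (n + 1), ContinuousLinearMap.proj (R := ℝ) (φ := fun _ => ℝ) j) l :=
      (HasFDerivAt.fun_sum fun j _ => hasFDerivAt_apply j l).sub_const _
    simp only [secular, Fin.snoc_last]
    refine h.congr_fderiv (ContinuousLinearMap.ext fun w => ?_)
    simp [secularJacobian, Matrix.mulVec, dotProduct, _root_.sum_apply]
  | cast i =>
    have h0 : ∀ j ∈ Finset.univ, HasFDerivAt (fun l : Fin (n + 1) → ℝ => μ i - l j)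
        (-ContinuousLinearMap.proj (R := ℝ) (φ := fun _ => ℝ) j) l :=
      fun j _ => HasFDerivAt.const_sub (hasFDerivAt_apply (𝕜 := ℝ) j l) (μ i)
    have h := (HasFDerivAt.finsetProd h0).neg.mul_const (∏ j ∈ Finset.univ.erase i, (μ i - μ j))⁻¹
    simp only [secular, Fin.snoc_castSucc, div_eq_mul_inv]
    refine h.congr_fderiv (ContinuousLinearMap.ext fun w => ?_)
    simp only [secularJacobian, Matrix.mulVec, dotProduct, ContinuousLinearMap.comp_apply, LinearMap.coe_toContinuousLinearMap', toLin'_apply, ContinuousLinearMap.proj_apply, of_apply, Fin.snoc_castSucc, _root_.smul_apply, _root_.neg_apply, _root_.sum_apply, smul_eq_mul]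
    rw [← Finset.sum_neg_distrib, Finset.mul_sum]
    refine Finset.sum_congr rfl fun k _ => ?_
    ring

theorem abs_prod_prod_erase {n : ℕ} (l : Fin n → ℝ) :
    |∏ k, ∏ j ∈ Finset.univ.erase k, (l k - l j)| = (vandermonde l).det ^ 2 := by
  have h : ∀ k : Fin n, Finset.univ.erase k = Finset.Ioi k ∪ Finset.Iio k := by
    intro k; ext j
    simp only [Finset.mem_erase, Finset.mem_univ, and_true, Finset.mem_union, Finset.mem_Ioi, Finset.mem_Iio]
    rw [ne_iff_lt_or_gt, or_comm]
  have hd : ∀ k : Fin n, Disjoint (Finset.Ioi k) (Finset.Iio k) := fun k =>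
    Finset.disjoint_left.2 fun j hj hj' => by
      simp only [Finset.mem_Ioi, Finset.mem_Iio] at hj hj'
      exact absurd hj hj'.not_gt
  have hs : ∏ k : Fin n, ∏ j ∈ Finset.Iio k, |l k - l j| = ∏ k : Fin n, ∏ j ∈ Finset.Ioi k, |l j - l k| :=
    Finset.prod_comm' (by simp)
  simp only [h, Finset.prod_union (hd _), Finset.prod_mul_distrib]
  rw [abs_mul, ← sq_abs, det_vandermonde]
  simp only [Finset.abs_prod]
  rw [hs]
  rw [sq]
  congr 1
  exact Finset.prod_congr rfl fun k _ => Finset.prod_congr rfl fun j _ => abs_sub_comm _ _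

/-- The entries are, up to the denominators, values at `μ i` of the polynomials `∏_{j ≠ k} (X - l
j)`. So the Jacobian matrix factors as an evaluation matrix times a coefficient matrix, and both
determinants reduce to Vandermonde determinants. -/
theorem abs_det_secularJacobian {n : ℕ} {μ : Fin n → ℝ} (hμ : StrictAnti μ)
    {l : Fin (n + 1) → ℝ} (hl : StrictAnti l) :
    |(secularJacobian μ l).det| = |(vandermonde l).det| / |(vandermonde μ).det| := by
  let q : Fin (n + 1) → ℝ[X] := fun k => ∏ j ∈ Finset.univ.erase k, (X - C (l j))
  have hq : ∀ k, (q k).natDegree = n := fun k => by simp [q, natDegree_finsetProd_X_sub_C_eq_card]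
  have hev : ∀ k z, eval z (q k) = ∑ m : Fin (n + 1), z ^ (m : ℕ) * (q k).coeff m := by
    intro k z
    rw [eval_eq_sum_range' (n := n + 1) (by rw [hq]; omega), Finset.sum_range]
    exact Finset.sum_congr rfl fun m _ => mul_comm _ _
  let Cf : Matrix (Fin (n + 1)) (Fin (n + 1)) ℝ := Matrix.of fun m k => (q k).coeff m
  -- The last row extracts the leading coefficient, which is 1 for every `q k` and matches the row
  -- of ones from the trace coordinate.
  let V : Matrix (Fin (n + 1)) (Fin (n + 1)) ℝ := Matrix.of
    (Fin.snoc (α := fun _ => Fin (n + 1) → ℝ) (fun i m => μ i ^ (m : ℕ)) (Pi.single (Fin.last n) 1))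
  let P : Fin n → ℝ := fun i => ∏ j ∈ Finset.univ.erase i, (μ i - μ j)
  have hP : ∀ i, P i ≠ 0 := fun i => Finset.prod_ne_zero_iff.2 fun j hj =>
      sub_ne_zero.2 (hμ.injective.ne (Finset.ne_of_mem_erase hj).symm)
  have hJ : diagonal (Fin.snoc (α := fun _ => ℝ) P 1) * secularJacobian μ l = V * Cf := by
    ext i k
    rw [diagonal_mul, Matrix.mul_apply]
    induction i using Fin.lastCases with
    | last =>
      have h1 := (monic_prod_X_sub_C l (Finset.univ.erase k)).coeff_natDegree
      change (q k).coeff (q k).natDegree = 1 at h1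
      rw [hq] at h1
      simp [secularJacobian, V, Cf, Pi.single_apply, h1]
    | cast i =>
      simp only [secularJacobian, V, Cf, of_apply, Fin.snoc_castSucc, P, ← hev]
      rw [mul_div_cancel₀ _ (hP i)]
      simp [q, eval_prod]
  have hVdet : V.det = (vandermonde μ).det := by
    rw [det_succ_row _ (Fin.last n), Finset.sum_eq_single (Fin.last n)]
    · have : V.submatrix (Fin.last n).succAbove (Fin.last n).succAbove = vandermonde μ := by
        ext i j
        simp [V, vandermonde_apply]
      rw [this]
      simp [V, ← two_mul]
    · intro j _ hj
      simp [V, hj]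
    · simp
  have hC : |Cf.det| = |(vandermonde l).det| := by
    -- Evaluation of `q k` at the points `l i` is diagonal, with determinant `±Δ(l)²`; one factor
    -- `Δ(l)` cancels.
    have h1 : vandermonde l * Cf = diagonal fun k => ∏ j ∈ Finset.univ.erase k, (l k - l j) := by
      ext i k
      rw [Matrix.mul_apply]
      simp only [vandermonde_apply, Cf, of_apply, ← hev]
      rcases eq_or_ne i k with rfl | hik
      · simp [q, eval_prod]
      · rw [diagonal_apply_ne _ hik]
        simp only [q, eval_prod]
        exact Finset.prod_eq_zero (Finset.mem_erase.2 ⟨hik, Finset.mem_univ i⟩) (by simp)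
    have h2 := congrArg (fun M => |M.det|) h1
    simp only [det_mul, det_diagonal, abs_mul, abs_prod_prod_erase] at h2
    have h3 : |(vandermonde l).det| ≠ 0 := abs_ne_zero.2 (det_vandermonde_ne_zero_iff.2 hl.injective)
    rw [← sq_abs, sq] at h2
    exact mul_left_cancel₀ h3 h2
  have h2 := congrArg (fun M => |M.det|) hJ
  simp only [det_mul, det_diagonal, abs_mul, hVdet, hC, Fin.prod_univ_castSucc, Fin.snoc_castSucc, Fin.snoc_last, mul_one] at h2
  rw [abs_prod_prod_erase] at h2
  have h3 : |(vandermonde μ).det| ≠ 0 := abs_ne_zero.2 (det_vandermonde_ne_zero_iff.2 hμ.injective)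
  rw [← sq_abs, sq, mul_assoc] at h2
  rw [eq_div_iff h3, mul_comm]
  exact mul_left_cancel₀ h3 h2

/-! ### The law of the eigenvalues of a bordered matrix -/

theorem lintegral_snoc {n : ℕ} (f : (Fin (n + 1) → ℝ) → ENNReal) (hf : Measurable f) :
    ∫⁻ p, f p = ∫⁻ y : Fin n → ℝ, ∫⁻ x : ℝ, f (Fin.snoc (α := fun _ => ℝ) y x) := by
  have e1 := (volume_preserving_piFinSuccAbove (fun _ : Fin (n + 1) => ℝ) (Fin.last n)).symm
  have h : ∀ q : ℝ × (Fin n → ℝ), (MeasurableEquiv.piFinSuccAbove (fun _ : Fin (n + 1) => ℝ)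
      (Fin.last n)).symm q = Fin.snoc (α := fun _ => ℝ) q.2 q.1 := by
    intro q
    simp only [MeasurableEquiv.piFinSuccAbove_symm_apply, Fin.insertNthEquiv_last]
    rfl
  have hm := hf.comp e1.measurable
  simp only [Function.comp_def, h] at hm
  rw [← e1.lintegral_comp hf, Measure.volume_eq_prod]
  simp only [h]
  rw [lintegral_prod_symm' _ hm]

/-- The disc `|z|² ≤ t` has area `π t`. -/
theorem map_normSq_volume : Measure.map Complex.normSq volume
    = NNReal.pi • (volume : Measure ℝ).restrict (Set.Ioi 0) := by
  symm
  refine Measure.ext_of_Ioc _ _ fun a b hab => ?_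
  rw [Measure.map_apply Complex.continuous_normSq.measurable measurableSet_Ioc, Measure.smul_apply,
    Measure.restrict_apply measurableSet_Ioc]
  have hball : ∀ t : ℝ, 0 ≤ t → volume (Complex.normSq ⁻¹' Set.Iic t) = ENNReal.ofReal t * NNReal.pi := by
    intro t ht
    have : Complex.normSq ⁻¹' Set.Iic t = Metric.closedBall 0 (Real.sqrt t) := by
      ext z
      simp [Complex.normSq_eq_norm_sq, Real.le_sqrt (norm_nonneg z) ht]
    rw [this, Complex.volume_closedBall, ← ENNReal.ofReal_pow (Real.sqrt_nonneg t), Real.sq_sqrt ht]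
  rcases lt_or_ge b 0 with hb | hb
  · have h1 : Complex.normSq ⁻¹' Set.Ioc a b = ∅ := by
      ext z; simp only [Set.mem_preimage, Set.mem_Ioc, Set.mem_empty_iff_false, iff_false]
      intro h; linarith [Complex.normSq_nonneg z, h.2]
    have h2 : Set.Ioc a b ∩ Set.Ioi 0 = ∅ := by
      ext z; simp only [Set.mem_inter_iff, Set.mem_Ioc, Set.mem_Ioi, Set.mem_empty_iff_false, iff_false]
      intro h; linarith [h.2, h.1.2]
    simp [h1, h2]
  rcases lt_or_ge a 0 with ha | ha
  · have h1 : Complex.normSq ⁻¹' Set.Ioc a b = Complex.normSq ⁻¹' Set.Iic b := by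
      ext z; simp only [Set.mem_preimage, Set.mem_Ioc, Set.mem_Iic, and_iff_right_iff_imp]
      intro h; linarith [Complex.normSq_nonneg z]
    have h2 : Set.Ioc a b ∩ Set.Ioi 0 = Set.Ioc 0 b := by
      ext z; simp only [Set.mem_inter_iff, Set.mem_Ioc, Set.mem_Ioi]
      constructor
      · intro h; exact ⟨h.2, h.1.2⟩
      · intro h; exact ⟨⟨ha.trans h.1, h.2⟩, h.1⟩
    rw [h1, h2, hball b hb, Real.volume_Ioc, sub_zero, mul_comm]; rfl
  · have h1 : Complex.normSq ⁻¹' Set.Ioc a b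
        = Complex.normSq ⁻¹' Set.Iic b \ Complex.normSq ⁻¹' Set.Iic a := by
      rw [← Set.preimage_sdiff]
      congr 1
      ext z; simp [and_comm]
    have h2 : Set.Ioc a b ∩ Set.Ioi 0 = Set.Ioc a b := by
      ext z; simp only [Set.mem_inter_iff, Set.mem_Ioc, Set.mem_Ioi, and_iff_left_iff_imp]
      intro h; linarith [h.1]
    rw [h1, h2, measure_sdiff, hball b hb, hball a ha, Real.volume_Ioc,
      ENNReal.ofReal_sub _ ha, ← ENNReal.sub_mul (by simp), mul_comm]
    · rfl
    · exact Set.preimage_mono (Set.Iic_subset_Iic.2 hab.le)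
    · exact (Complex.continuous_normSq.measurable measurableSet_Iic).nullMeasurableSet
    · rw [hball a ha]; exact ENNReal.mul_ne_top (by simp) (by simp)

theorem map_normSq_pi_volume (n : ℕ) : Measure.map (fun (v : Fin n → ℂ) i => Complex.normSq (v i)) volume
    = (NNReal.pi : ENNReal) ^ n • (volume : Measure (Fin n → ℝ)).restrict (Set.univ.pi fun _ => Set.Ioi 0) := by
  have : SigmaFinite (Measure.map Complex.normSq volume) := by
    rw [map_normSq_volume]; infer_instance
  rw [volume_pi, Measure.pi_map_pi fun _ => Complex.continuous_normSq.measurable.aemeasurable]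
  refine Measure.pi_eq fun s hs => ?_
  rw [map_normSq_volume, Measure.smul_apply, Measure.restrict_apply (MeasurableSet.univ_pi hs),
    ← Set.pi_inter_distrib, volume_pi, Measure.pi_pi]
  simp only [Measure.smul_apply, Measure.restrict_apply (hs _)]
  have : ∀ i, NNReal.pi • volume (s i ∩ Set.Ioi 0)
      = (NNReal.pi : ENNReal) * volume (s i ∩ Set.Ioi 0) := fun _ => rfl
  simp only [this, Finset.prod_mul_distrib, Finset.prod_const, Finset.card_fin, smul_eq_mul]

/-- The real determinant of a complex linear map is the squared modulus of the complex one, here 1.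
-/
theorem measurePreserving_unitary_mulVec {n : ℕ} (U : Matrix (Fin n) (Fin n) ℂ)
    (hU : star U * U = 1) : MeasurePreserving fun v : Fin n → ℂ => U *ᵥ v := by
  let f : (Fin n → ℂ) →ₗ[ℝ] (Fin n → ℂ) := (toLin' U).restrictScalars ℝ
  have hdet : LinearMap.det f = 1 := by
    rw [LinearMap.det_restrictScalars, LinearMap.det_toLin', Algebra.norm_complex_apply]
    have h := congrArg det hU
    rw [det_mul, star_eq_conjTranspose, det_conjTranspose, det_one] at h
    rw [← Complex.ofReal_inj, Complex.normSq_eq_conj_mul_self]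
    exact h
  have h := Measure.map_linearMap_addHaar_eq_smul_addHaar (volume : Measure (Fin n → ℂ)) (f := f)
    (by simp [hdet])
  rw [hdet] at h
  simp only [inv_one, abs_one, ENNReal.ofReal_one, one_smul] at h
  exact ⟨(LinearMap.continuous_of_finiteDimensional f).measurable, h⟩

theorem measurable_border {n : ℕ} :
    Measurable fun q : (HermCoord n × (Fin n → ℂ)) × ℝ => border q.1.1 q.1.2 q.2 := by
  unfold border
  refine Measurable.prodMk (measurable_pi_lambda _ fun i => ?_) (measurable_pi_lambda _ fun p => ?_)
  · induction i using Fin.lastCases with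
    | last => simp only [Fin.snoc_last]; fun_prop
    | cast i => simp only [Fin.snoc_castSucc]; fun_prop
  · rcases (upperPairsSucc n).symm p with q | q
    · simp only [Sum.elim_inl]; fun_prop
    · simp only [Sum.elim_inr]; fun_prop

theorem hermMatrix_diagonal {n : ℕ} (μ : Fin n → ℝ) : hermMatrix (μ, 0) =
    (1 : Matrix (Fin n) (Fin n) ℂ) * diagonal (fun i => (μ i : ℂ)) * star 1 := by
  rw [star_one, Matrix.mul_one, Matrix.one_mul]
  ext i j
  rcases lt_trichotomy i j with h | h | h
  · simp [hermMatrix, h, h.ne]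
  · subst h; simp [hermMatrix]
  · simp [hermMatrix, h, h.not_gt, h.ne']

theorem measurableSet_interlace {n : ℕ} (μ : Fin n → ℝ) : MeasurableSet (interlace μ) := by
  have : interlace μ = ⋂ i : Fin n, {l | μ i < l i.castSucc} ∩ {l | l i.succ < μ i} := by
    ext l; simp [interlace]
  rw [this]
  exact MeasurableSet.iInter fun i => (measurableSet_lt measurable_const (measurable_pi_apply _)).inter
    (measurableSet_lt (measurable_pi_apply _) measurable_const)

theorem secular_pos_of_mem_interlace {n : ℕ} {μ : Fin n → ℝ} (hμ : StrictAnti μ)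
    {l : Fin (n + 1) → ℝ} (hl : l ∈ interlace μ) (i : Fin n) : 0 < secular μ l i.castSucc := by
  have hanti := (strictAnti_of_mem_interlace hl).antitone
  have hlow : ∀ j, j ≤ i.castSucc → μ i < l j := fun j hj => (hl i).1.trans_le (hanti hj)
  have hhigh : ∀ j, ¬ j ≤ i.castSucc → l j < μ i := fun j hj =>
    (hanti (Fin.castSucc_lt_iff_succ_le.1 (not_le.1 hj))).trans_lt (hl i).2
  have h1 := neg_one_pow_card_mul_prod Finset.univ (fun j => μ i - l j) fun j _ => by
    by_cases hj : j ≤ i.castSucc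
    · exact (sub_neg.2 (hlow j hj)).ne
    · exact (sub_pos.2 (hhigh j hj)).ne'
  have h2 := neg_one_pow_card_mul_prod (Finset.univ.erase i) (fun j => μ i - μ j) fun j hj =>
    sub_ne_zero.2 (hμ.injective.ne (Finset.ne_of_mem_erase hj).symm)
  have e1 : (Finset.univ.filter fun j => μ i - l j < 0) = Finset.Iic i.castSucc := by
    ext j
    simp only [Finset.mem_filter, Finset.mem_univ, true_and, sub_neg, Finset.mem_Iic]
    refine ⟨fun h => ?_, hlow j⟩
    by_contra hj
    exact absurd h (hhigh j hj).not_gt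
  have e2 : ((Finset.univ.erase i).filter fun j => μ i - μ j < 0) = Finset.Iio i := by
    ext j
    simp only [Finset.mem_filter, Finset.mem_erase, Finset.mem_univ, and_true, Finset.mem_Iio,
      sub_neg, hμ.lt_iff_gt]
    exact ⟨fun h => h.2, fun h => ⟨h.ne, h⟩⟩
  rw [e1, Fin.card_Iic, Fin.val_castSucc, pow_succ] at h1
  rw [e2, Fin.card_Iio] at h2
  simp only [secular, Fin.snoc_castSucc]
  rw [neg_div, neg_pos]
  rcases neg_one_pow_eq_or ℝ (i : ℕ) with h | h <;> rw [h] at h1 h2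
  · exact div_neg_of_neg_of_pos (by linarith) (by linarith)
  · exact div_neg_of_pos_of_neg (by linarith) (by linarith)

/-- By unitary invariance the corner may be taken diagonal, and then the eigenvalues depend only on
the squared moduli of the column and on the corner entry. The former push Lebesgue measure forward
to `π^n` times Lebesgue measure on the positive orthant, and `secular` maps the interlacing vectors
bijectively onto the resulting parameter set. -/
theorem lintegral_eig_border {n : ℕ} (c : HermCoord n) (hμ : StrictAnti (eig c))
    (g : (Fin (n + 1) → ℝ) → ENNReal) (hg : Measurable g) :
    ∫⁻ v, ∫⁻ x, g (eig (border c v x)) = (NNReal.pi : ENNReal) ^ n *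
      ∫⁻ l in interlace (eig c), ENNReal.ofReal
        (|(vandermonde l).det| / |(vandermonde (eig c)).det|) * g l := by
  obtain ⟨U, hU1, hU2, hc⟩ := exists_unitary_hermMatrix c
  set μ := eig c with hμdef
  -- The test function in the coordinates of `secular`, through the model with diagonal corner and
  -- column entries `√(p i)`.
  let h : (Fin (n + 1) → ℝ) → ENNReal := fun p =>
    g (eig (border (μ, 0) (fun i => (√(p i.castSucc) : ℂ)) (p (Fin.last n))))
  have hm : Measurable h := by
    have : Measurable fun p : Fin (n + 1) → ℝ =>
        ((((μ, 0) : HermCoord n), fun i : Fin n => (√(p i.castSucc) : ℂ)), p (Fin.last n)) := by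
      fun_prop
    exact hg.comp (measurable_eig.comp (measurable_border.comp this))
  have hdiag : ∀ p : Fin (n + 1) → ℝ, (∀ i : Fin n, 0 < p i.castSucc) →
      eig (border (μ, 0) (fun i => (√(p i.castSucc) : ℂ)) (p (Fin.last n))) ∈ interlace μ ∧
      secular μ (eig (border (μ, 0) (fun i => (√(p i.castSucc) : ℂ)) (p (Fin.last n)))) = p := by
    intro p hp
    have := eig_border (μ, 0) (fun i => (√(p i.castSucc) : ℂ)) (p (Fin.last n)) 1 hμ (by simp)
      (hermMatrix_diagonal μ) (fun i => by simpa using (Real.sqrt_pos.2 (hp i)).ne')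
    refine ⟨this.1, this.2.trans (funext fun i => ?_)⟩
    induction i using Fin.lastCases with
    | last => simp
    | cast i => simp [Complex.normSq_ofReal, Real.mul_self_sqrt (hp i).le]
  have hsec : ∀ l ∈ interlace μ, h (secular μ l) = g l := by
    intro l hl
    have := hdiag (secular μ l) (secular_pos_of_mem_interlace hμ hl)
    exact congrArg g (secular_injOn hμ this.1 hl this.2)
  have himage : secular μ '' interlace μ = {p | ∀ i : Fin n, 0 < p i.castSucc} := by
    ext p
    constructor
    · rintro ⟨l, hl, rfl⟩
      exact secular_pos_of_mem_interlace hμ hl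
    · exact fun hp => ⟨_, (hdiag p hp).1, (hdiag p hp).2⟩
  have hbord : ∀ v x, (∀ i, (star U *ᵥ v) i ≠ 0) → g (eig (border c v x)) =
      h (Fin.snoc (α := fun _ => ℝ) (fun i => Complex.normSq ((star U *ᵥ v) i)) x) := by
    intro v x hv
    have h1 := eig_border c v x U hμ hU1 hc hv
    rw [← hsec _ h1.1, h1.2]
  have hU3 : star (star U) * star U = 1 := by rw [star_star, hU2]
  have hmp := measurePreserving_unitary_mulVec (star U) hU3
  -- A vanishing coordinate would make an eigenvalue of the corner an eigenvalue of the bordered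
  -- matrix; such columns are negligible.
  have hae : ∀ᵐ w : Fin n → ℂ, ∀ i, w i ≠ 0 := by
    rw [ae_all_iff]
    intro i
    rw [ae_iff]
    simp only [ne_eq, not_not]
    exact Measure.pi_hyperplane (fun _ : Fin n => (volume : Measure ℂ)) i 0
  have hF : Measurable fun y : Fin n → ℝ => ∫⁻ x : ℝ, h (Fin.snoc (α := fun _ => ℝ) y x) := by
    refine Measurable.lintegral_prod_right' (f := fun q : (Fin n → ℝ) × ℝ =>
      h (Fin.snoc (α := fun _ => ℝ) q.1 q.2)) (hm.comp (measurable_pi_lambda _ fun i => ?_))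
    induction i using Fin.lastCases with
    | last => simp only [Fin.snoc_last]; fun_prop
    | cast i => simp only [Fin.snoc_castSucc]; fun_prop
  have hns : Measurable fun (v : Fin n → ℂ) i => Complex.normSq (v i) :=
    measurable_pi_lambda _ fun i => Complex.continuous_normSq.measurable.comp (measurable_pi_apply i)
  have hset : MeasurableSet {p : Fin (n + 1) → ℝ | ∀ i : Fin n, 0 < p i.castSucc} := by
    simp only [Set.ofPred_forall]
    exact MeasurableSet.iInter fun i => measurableSet_lt measurable_const (measurable_pi_apply _)
  calc ∫⁻ v, ∫⁻ x, g (eig (border c v x))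
      = ∫⁻ v, ∫⁻ x, h (Fin.snoc (α := fun _ => ℝ) (fun i => Complex.normSq ((star U *ᵥ v) i)) x) := by
        refine lintegral_congr_ae ?_
        filter_upwards [hmp.quasiMeasurePreserving.ae hae] with v hv
        exact lintegral_congr fun x => hbord v x hv
    _ = ∫⁻ w : Fin n → ℂ, ∫⁻ x, h (Fin.snoc (α := fun _ => ℝ) (fun i => Complex.normSq (w i)) x) :=
        hmp.lintegral_comp (hF.comp hns)
    _ = ∫⁻ y, ∫⁻ x, h (Fin.snoc (α := fun _ => ℝ) y x) ∂(volume : Measure ℝ)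
          ∂(Measure.map (fun (v : Fin n → ℂ) i => Complex.normSq (v i)) volume) :=
        (lintegral_map hF hns).symm
    _ = (NNReal.pi : ENNReal) ^ n *
          ∫⁻ y in Set.univ.pi fun _ : Fin n => Set.Ioi (0 : ℝ), ∫⁻ x, h (Fin.snoc (α := fun _ => ℝ) y x) := by
        rw [map_normSq_pi_volume, lintegral_smul_measure, smul_eq_mul]
    _ = (NNReal.pi : ENNReal) ^ n * ∫⁻ p in {p | ∀ i : Fin n, 0 < p i.castSucc}, h p := by
        rw [← lintegral_indicator hset, lintegral_snoc _ (hm.indicator hset),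
          ← lintegral_indicator (MeasurableSet.univ_pi fun _ => measurableSet_Ioi)]
        congr 1
        refine lintegral_congr fun y => ?_
        by_cases hy : y ∈ Set.univ.pi fun _ : Fin n => Set.Ioi (0 : ℝ)
        · rw [Set.indicator_of_mem hy]
          refine lintegral_congr fun x => ?_
          rw [Set.indicator_of_mem]
          intro i
          simpa using hy i (Set.mem_univ i)
        · rw [Set.indicator_of_notMem hy]
          symm
          rw [← lintegral_zero (α := ℝ) (μ := volume)]
          refine lintegral_congr fun x => ?_
          rw [Set.indicator_of_notMem]
          intro hp
          refine hy fun i _ => ?_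
          simpa using hp i
    _ = _ := by
        rw [← himage, lintegral_image_eq_lintegral_abs_det_fderiv_mul volume (measurableSet_interlace μ)
          (fun l _ => (hasFDerivAt_secular μ l).hasFDerivWithinAt) (secular_injOn hμ)]
        congr 1
        refine setLIntegral_congr_fun (measurableSet_interlace μ) fun l hl => ?_
        simp only [ContinuousLinearMap.det, LinearMap.coe_toContinuousLinearMap, LinearMap.det_toLin']
        rw [abs_det_secularJacobian hμ (strictAnti_of_mem_interlace hl), hsec l hl]

/-! ### The recursion for the eigenvalue density -/

theorem measurableSet_strictAnti (n : ℕ) : MeasurableSet {l : Fin n → ℝ | StrictAnti l} := by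
  have : {l : Fin n → ℝ | StrictAnti l} = ⋂ (i) (j) (_ : i < j), {l | l j < l i} := by
    ext l; simp [StrictAnti]
  rw [this]
  exact MeasurableSet.iInter fun i => MeasurableSet.iInter fun j => MeasurableSet.iInter fun _ =>
    measurableSet_lt (measurable_pi_apply _) (measurable_pi_apply _)

/-- With the weight `W`, the ordered eigenvalues have the density `|Δ| κ`. -/
def HasEigDensity {n : ℕ} (W : HermCoord n → ENNReal) (κ : (Fin n → ℝ) → ENNReal) : Prop :=
  ∀ g : (Fin n → ℝ) → ENNReal, Measurable g → ∫⁻ c, W c * g (eig c) =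
    ∫⁻ l in {l | StrictAnti l}, ENNReal.ofReal |(vandermonde l).det| * κ l * g l

theorem continuous_det_vandermonde (n : ℕ) :
    Continuous fun l : Fin n → ℝ => (vandermonde l).det := by
  refine Continuous.matrix_det (continuous_matrix fun i j => ?_)
  simp only [vandermonde_apply]; fun_prop

theorem measurableSet_interlace_prod (n : ℕ) :
    MeasurableSet {q : (Fin n → ℝ) × (Fin (n + 1) → ℝ) | q.2 ∈ interlace q.1} := by
  have : {q : (Fin n → ℝ) × (Fin (n + 1) → ℝ) | q.2 ∈ interlace q.1} =
      ⋂ i : Fin n, {q | q.1 i < q.2 i.castSucc} ∩ {q | q.2 i.succ < q.1 i} := by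
    ext l; simp [interlace]
  rw [this]
  refine MeasurableSet.iInter fun i => MeasurableSet.inter (measurableSet_lt ?_ ?_)
    (measurableSet_lt ?_ ?_) <;> fun_prop

theorem strictAnti_of_interlaced {n : ℕ} {μ : Fin n → ℝ} {l : Fin (n + 1) → ℝ}
    (h : l ∈ interlace μ) : StrictAnti μ := by
  intro i j hij
  have h1 := (strictAnti_of_mem_interlace h).antitone (Fin.castSucc_lt_iff_succ_le.1 (Fin.castSucc_lt_castSucc_iff.2 hij))
  exact (h j).1.trans_le (h1.trans (h i).2.le)

/-- The factor `|Δ(μ)|` of the density of the corner cancels the denominator of the Jacobian in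
`lintegral_eig_border`. By Tonelli what remains is `|Δ(l)|` times the integral of `κ` over the `μ`
that `l` interlaces. -/
theorem HasEigDensity.of_border {n : ℕ} {W : HermCoord n → ENNReal} {κ : (Fin n → ℝ) → ENNReal}
    (hWκ : HasEigDensity W κ) (hW : Measurable W) (hκ : Measurable κ) {W' : HermCoord (n + 1) → ENNReal}
    (hW' : Measurable W') (hb : ∀ c v x, W' (border c v x) = W c) :
    HasEigDensity W' fun l => (NNReal.pi : ENNReal) ^ n * ∫⁻ μ in {μ | l ∈ interlace μ}, κ μ := by
  intro g hg
  have hV : ∀ m, Measurable fun l : Fin m → ℝ => ENNReal.ofReal |(vandermonde l).det| := fun m =>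
    (continuous_det_vandermonde m).abs.measurable.ennreal_ofReal
  let Γ : (Fin n → ℝ) → ENNReal := fun μ => (NNReal.pi : ENNReal) ^ n *
      ∫⁻ l in interlace μ, ENNReal.ofReal
        (|(vandermonde l).det| / |(vandermonde μ).det|) * g l
  have hΓ : Measurable Γ := by
    refine Measurable.const_mul ?_ _
    have : ∀ μ : Fin n → ℝ, ∫⁻ l in interlace μ, ENNReal.ofReal
        (|(vandermonde l).det| / |(vandermonde μ).det|) * g l = ∫⁻ l, Set.indicator
          {q : (Fin n → ℝ) × (Fin (n + 1) → ℝ) | q.2 ∈ interlace q.1} (fun q => ENNReal.ofReal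
        (|(vandermonde q.2).det| / |(vandermonde q.1).det|) * g q.2) (μ, l) := fun μ => by
      rw [← lintegral_indicator (measurableSet_interlace μ)]
      rfl
    simp only [this]
    refine Measurable.lintegral_prod_right' (Measurable.indicator ?_ (measurableSet_interlace_prod n))
    refine Measurable.mul (Measurable.ennreal_ofReal (Measurable.div ?_ ?_)) (hg.comp measurable_snd)
    · exact (continuous_det_vandermonde _).abs.measurable.comp measurable_snd
    · exact (continuous_det_vandermonde _).abs.measurable.comp measurable_fst
  -- The density lives on strictly decreasing vectors; testing it on the complement shows that
  -- corners with a repeated eigenvalue carry no weight.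
  have hae : ∀ᵐ c, W c ≠ 0 → StrictAnti (eig c) := by
    have hm : Measurable fun c => W c * {l : Fin n → ℝ | StrictAnti l}ᶜ.indicator 1 (eig c) :=
      hW.mul ((measurable_one.indicator (measurableSet_strictAnti n).compl).comp measurable_eig)
    have h := hWκ ({l | StrictAnti l}ᶜ.indicator 1) (measurable_one.indicator (measurableSet_strictAnti n).compl)
    rw [setLIntegral_congr_fun (g := fun _ => 0) (measurableSet_strictAnti n) (fun l hl => by
      rw [Set.indicator_of_notMem (by simpa using hl), mul_zero]), lintegral_zero,
      lintegral_eq_zero_iff hm] at h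
    filter_upwards [h] with c hc hWc
    by_contra hcon
    rw [Set.indicator_of_mem (by simpa using hcon)] at hc
    simp [hWc] at hc
  have hb2 : Measurable fun q : (HermCoord n × (Fin n → ℂ)) × ℝ => g (eig (border q.1.1 q.1.2 q.2)) :=
    hg.comp (measurable_eig.comp measurable_border)
  have hb1 : Measurable fun q : HermCoord n × (Fin n → ℂ) => ∫⁻ x, g (eig (border q.1 q.2 x)) :=
    hb2.lintegral_prod_right'
  have hWg : Measurable fun c => W' c * g (eig c) := hW'.mul (hg.comp measurable_eig)
  calc ∫⁻ c, W' c * g (eig c)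
      = ∫⁻ c, ∫⁻ v, ∫⁻ x, W c * g (eig (border c v x)) := by
        rw [lintegral_border _ hWg]
        simp only [hb]
    _ = ∫⁻ c, W c * ∫⁻ v, ∫⁻ x, g (eig (border c v x)) := by
        refine lintegral_congr fun c => ?_
        have h1 : Measurable fun v => ∫⁻ x, g (eig (border c v x)) :=
          hb1.comp (f := fun v : Fin n → ℂ => (c, v)) (by fun_prop)
        rw [← lintegral_const_mul _ h1]
        refine lintegral_congr fun v => ?_
        rw [lintegral_const_mul]
        exact hb2.comp (f := fun x : ℝ => ((c, v), x)) (by fun_prop)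
    _ = ∫⁻ c, W c * Γ (eig c) := by
        refine lintegral_congr_ae ?_
        filter_upwards [hae] with c hc
        by_cases h0 : W c = 0
        · simp [h0]
        · simp only [Γ]; rw [lintegral_eig_border c (hc h0) g hg]
    _ = ∫⁻ μ in {l | StrictAnti l}, ENNReal.ofReal |(vandermonde μ).det| * κ μ * Γ μ := hWκ Γ hΓ
    _ = ∫⁻ μ : Fin n → ℝ, ∫⁻ l : Fin (n + 1) → ℝ, Set.indicator
          {q : (Fin n → ℝ) × (Fin (n + 1) → ℝ) | q.2 ∈ interlace q.1} (fun q =>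
            (NNReal.pi : ENNReal) ^ n * (ENNReal.ofReal |(vandermonde q.2).det| * κ q.1 * g q.2)) (μ, l) := by
        rw [← lintegral_indicator (measurableSet_strictAnti n)]
        refine lintegral_congr fun μ => ?_
        by_cases hμ : StrictAnti μ
        · rw [Set.indicator_of_mem (by exact hμ)]
          have hne : |(vandermonde μ).det| ≠ 0 :=
            abs_ne_zero.2 (det_vandermonde_ne_zero_iff.2 hμ.injective)
          have hpos : 0 < |(vandermonde μ).det| := abs_pos.2 (abs_ne_zero.1 hne)
          have hm1 : Measurable fun l : Fin (n + 1) → ℝ => ENNReal.ofReal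
              (|(vandermonde l).det| / |(vandermonde μ).det|) * g l :=
            ((continuous_det_vandermonde _).abs.measurable.div_const _).ennreal_ofReal.mul hg
          simp only [Γ]
          rw [← mul_assoc, ← lintegral_const_mul _ hm1,
            ← lintegral_indicator (measurableSet_interlace μ)]
          refine lintegral_congr fun l => ?_
          by_cases hl : l ∈ interlace μ
          · rw [Set.indicator_of_mem hl, Set.indicator_of_mem (by exact hl),
              ENNReal.ofReal_div_of_pos hpos]
            have h1 : ENNReal.ofReal |(vandermonde μ).det| ≠ 0 := by simpa using hne
            calc ENNReal.ofReal |(vandermonde μ).det| * κ μ * (NNReal.pi : ENNReal) ^ n *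
                  (ENNReal.ofReal |(vandermonde l).det| / ENNReal.ofReal |(vandermonde μ).det| * g l)
                = (ENNReal.ofReal |(vandermonde l).det| / ENNReal.ofReal |(vandermonde μ).det| *
                    ENNReal.ofReal |(vandermonde μ).det|) * κ μ * (NNReal.pi : ENNReal) ^ n * g l := by
                  ring
              _ = _ := by rw [ENNReal.div_mul_cancel h1 ENNReal.ofReal_ne_top]; ring
          · rw [Set.indicator_of_notMem hl, Set.indicator_of_notMem (by exact hl)]
        · rw [Set.indicator_of_notMem (by exact hμ)]
          symm
          rw [← lintegral_zero (α := Fin (n + 1) → ℝ) (μ := volume)]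
          refine lintegral_congr fun l => Set.indicator_of_notMem ?_ _
          exact fun hl => hμ (strictAnti_of_interlaced hl)
    _ = ∫⁻ l : Fin (n + 1) → ℝ, ∫⁻ μ : Fin n → ℝ, Set.indicator
          {q : (Fin n → ℝ) × (Fin (n + 1) → ℝ) | q.2 ∈ interlace q.1} (fun q =>
            (NNReal.pi : ENNReal) ^ n * (ENNReal.ofReal |(vandermonde q.2).det| * κ q.1 * g q.2)) (μ, l) := by
        refine lintegral_lintegral_swap (f := fun μ l => Set.indicator
          {q : (Fin n → ℝ) × (Fin (n + 1) → ℝ) | q.2 ∈ interlace q.1} (fun q =>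
            (NNReal.pi : ENNReal) ^ n * (ENNReal.ofReal |(vandermonde q.2).det| * κ q.1 * g q.2)) (μ, l)) ?_
        refine Measurable.aemeasurable (Measurable.indicator ?_ (measurableSet_interlace_prod n))
        exact (((hV _).comp measurable_snd |>.mul (hκ.comp measurable_fst)).mul (hg.comp measurable_snd)).const_mul _
    _ = _ := by
        rw [← lintegral_indicator (measurableSet_strictAnti (n + 1))]
        refine lintegral_congr fun l => ?_
        have hs : MeasurableSet {μ : Fin n → ℝ | l ∈ interlace μ} :=
          measurable_prodMk_right (y := l) (measurableSet_interlace_prod n)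
        by_cases hl : StrictAnti l
        · rw [Set.indicator_of_mem (by exact hl)]
          beta_reduce
          rw [← lintegral_indicator hs, mul_comm _ (g l), ← mul_assoc, ← mul_assoc, ← lintegral_const_mul _ (hκ.indicator hs)]
          refine lintegral_congr fun μ => ?_
          by_cases hμ : l ∈ interlace μ
          · rw [Set.indicator_of_mem (by exact hμ), Set.indicator_of_mem (by exact hμ)]; ring
          · rw [Set.indicator_of_notMem (by exact hμ), Set.indicator_of_notMem (by exact hμ), mul_zero]
        · rw [Set.indicator_of_notMem (by exact hl)]
          rw [← lintegral_zero (α := Fin n → ℝ) (μ := volume)]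
          refine lintegral_congr fun μ => Set.indicator_of_notMem ?_ _
          exact fun h => hl (strictAnti_of_mem_interlace h)

/-! ### Solving the recursion by determinants -/

theorem det_snoc_one {n : ℕ} (Ψ : Fin n → ℝ → ℝ) (l : Fin (n + 1) → ℝ) :
    (Matrix.of (Fin.snoc (α := fun _ => Fin (n + 1) → ℝ) (fun a j => Ψ a (l j)) fun _ => 1)).det =
      (Matrix.of fun a j => Ψ a (l j.castSucc) - Ψ a (l j.succ) : Matrix (Fin n) (Fin n) ℝ).det := by
  set A := Matrix.of (Fin.snoc (α := fun _ => Fin (n + 1) → ℝ) (fun a j => Ψ a (l j)) fun _ => 1) with hA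
  let B : Matrix (Fin (n + 1)) (Fin (n + 1)) ℝ := Matrix.of fun i =>
    Fin.cons (α := fun _ => ℝ) (A i 0) fun j => A i j.succ - A i j.castSucc
  have hAB : A.det = B.det := det_eq_of_forall_col_eq_smul_add_pred (fun _ => 1) (by simp [B])
    (by intro i j; simp [B])
  rw [hAB, det_succ_row _ (Fin.last n), Finset.sum_eq_single 0]
  · have : B.submatrix (Fin.last n).succAbove (Fin.succAbove 0) =
        -(Matrix.of fun a j => Ψ a (l j.castSucc) - Ψ a (l j.succ) : Matrix (Fin n) (Fin n) ℝ) := by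
      ext a j
      simp [B, hA]
    rw [this, det_neg]
    have h1 : B (Fin.last n) 0 = 1 := by simp [B, hA]
    rw [h1, mul_one, ← mul_assoc, Fintype.card_fin]
    simp [← mul_pow]
  · intro j _ hj
    obtain ⟨j, rfl⟩ := Fin.exists_succ_eq_of_ne_zero hj
    simp [B, hA]
  · simp

theorem setOf_mem_interlace {n : ℕ} (l : Fin (n + 1) → ℝ) :
    {μ | l ∈ interlace μ} = Set.univ.pi fun i : Fin n => Set.Ioo (l i.succ) (l i.castSucc) := by
  ext μ
  simp only [interlace, Set.mem_ofPred_eq, Set.mem_pi, Set.mem_univ, true_imp_iff, Set.mem_Ioo]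
  exact forall_congr' fun i => and_comm

theorem integral_pi_det {n : ℕ} (φ : Fin n → Fin n → ℝ → ℝ) (ν : Fin n → Measure ℝ)
    [∀ j, SigmaFinite (ν j)] (hφ : ∀ i j, Integrable (φ i j) (ν j)) :
    Integrable (fun μ : Fin n → ℝ => (Matrix.of fun i j => φ i j (μ j)).det) (Measure.pi ν) ∧
    ∫ μ, (Matrix.of fun i j => φ i j (μ j)).det ∂(Measure.pi ν) =
      (Matrix.of fun i j => ∫ z, φ i j z ∂(ν j)).det := by
  have hint : ∀ σ : Equiv.Perm (Fin n), Integrable (fun μ : Fin n → ℝ =>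
      ((Equiv.Perm.sign σ : ℤ) : ℝ) * ∏ j, φ (σ j) j (μ j)) (Measure.pi ν) := fun σ =>
    (Integrable.fintype_prod (f := fun j z => φ (σ j) j z) fun j => hφ (σ j) j).const_mul _
  simp only [det_apply', of_apply]
  refine ⟨integrable_finsetSum _ fun σ _ => hint σ, ?_⟩
  rw [integral_finsetSum _ fun σ _ => hint σ]
  refine Finset.sum_congr rfl fun σ _ => ?_
  rw [integral_const_mul, integral_fintype_prod_eq_prod (fun j z => φ (σ j) j z)]

/-- The `μ` interlaced by `l` fill a box, so the determinant is integrated column by column and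
yields differences of antiderivatives at consecutive `l j`. By `det_snoc_one` this is the
determinant of the antiderivatives with a row of ones appended. -/
theorem lintegral_interlaced_det {n : ℕ} (φ Ψ : Fin n → ℝ → ℝ)
    (hΨ : ∀ i z, HasDerivAt (Ψ i) (φ i z) z) (hφ : ∀ i, Continuous (φ i)) (C : ℝ)
    (hpos : ∀ μ : Fin n → ℝ, StrictAnti μ → 0 ≤ C * (Matrix.of fun i j => φ i (μ j)).det)
    {l : Fin (n + 1) → ℝ} (hl : StrictAnti l) :
    0 ≤ C * (Matrix.of
      (Fin.snoc (α := fun _ => Fin (n + 1) → ℝ) (fun a j => Ψ a (l j)) fun _ => 1)).det ∧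
    ∫⁻ μ in {μ | l ∈ interlace μ}, ENNReal.ofReal (C * (Matrix.of fun i j => φ i (μ j)).det) =
      ENNReal.ofReal (C * (Matrix.of
        (Fin.snoc (α := fun _ => Fin (n + 1) → ℝ) (fun a j => Ψ a (l j)) fun _ => 1)).det) := by
  have hlt : ∀ j : Fin n, l j.succ ≤ l j.castSucc := fun j => (hl (Fin.castSucc_lt_succ)).le
  have hI : ∀ i j : Fin n, Integrable (φ i) (volume.restrict (Set.Ioo (l j.succ) (l j.castSucc))) := fun i j =>
    ((hφ i).integrableOn_Icc (a := l j.succ) (b := l j.castSucc)).mono_set Set.Ioo_subset_Icc_self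
  obtain ⟨h1, h2⟩ := integral_pi_det (fun i _ => φ i)
    (fun j : Fin n => volume.restrict (Set.Ioo (l j.succ) (l j.castSucc))) hI
  have hms : MeasurableSet (Set.univ.pi fun i : Fin n => Set.Ioo (l i.succ) (l i.castSucc)) :=
    MeasurableSet.univ_pi fun _ => measurableSet_Ioo
  rw [← Measure.restrict_pi_pi] at h1 h2
  have h3 : ∀ i j : Fin n, ∫ z in Set.Ioo (l j.succ) (l j.castSucc), φ i z = Ψ i (l j.castSucc) - Ψ i (l j.succ) := by
    intro i j
    rw [← integral_Ioc_eq_integral_Ioo, ← intervalIntegral.integral_of_le (hlt j)]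
    exact intervalIntegral.integral_eq_sub_of_hasDerivAt (fun z _ => hΨ i z)
      ((hφ i).intervalIntegrable _ _)
  simp only [h3] at h2
  rw [← det_snoc_one] at h2
  have hnn : ∀ᵐ μ ∂((volume : Measure (Fin n → ℝ)).restrict
      (Set.univ.pi fun i : Fin n => Set.Ioo (l i.succ) (l i.castSucc))),
      0 ≤ C * (Matrix.of fun i j => φ i (μ j)).det := by
    refine (ae_restrict_iff' hms).2 (Filter.Eventually.of_forall fun μ hμ => hpos μ ?_)
    rw [← setOf_mem_interlace] at hμ
    exact strictAnti_of_interlaced hμ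
  rw [← h2, setOf_mem_interlace, ← integral_const_mul]
  exact ⟨integral_nonneg_of_ae hnn, (ofReal_integral_eq_lintegral_ofReal (h1.const_mul C) hnn).symm⟩

/-- The functions spanning the solutions of the interlacing recursion. -/
def rowFn (k₁ k₂ : ℕ) (α : ℝ) (i : Fin (k₁ + k₂)) (z : ℝ) : ℝ :=
  -- The powers are listed downwards, so that the row of ones created by a bordering is the new last
  -- row.
  if (i : ℕ) < k₁ then z ^ (i : ℕ) * Real.exp (α * z) else z ^ (k₁ + k₂ - 1 - i)

/-- The determinant of the functions `rowFn` at the points `l`. -/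
def kernelDet (k₁ k₂ : ℕ) (α : ℝ) (l : Fin (k₁ + k₂) → ℝ) : ℝ :=
  (Matrix.of fun i j => rowFn k₁ k₂ α i (l j)).det

theorem continuous_rowFn (k₁ k₂ : ℕ) (α : ℝ) (i : Fin (k₁ + k₂)) : Continuous (rowFn k₁ k₂ α i) := by
  unfold rowFn
  split_ifs <;> fun_prop

theorem continuous_kernelDet (k₁ k₂ : ℕ) (α : ℝ) : Continuous (kernelDet k₁ k₂ α) :=
  Continuous.matrix_det (continuous_matrix fun i j =>
    (continuous_rowFn k₁ k₂ α i).comp (continuous_apply j))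

/-- An antiderivative of `z ^ i * exp (α z)`. -/
def expPrim (α : ℝ) : ℕ → ℝ → ℝ
  | 0, z => Real.exp (α * z) / α
  | i + 1, z => (z ^ (i + 1) * Real.exp (α * z) - (i + 1) * expPrim α i z) / α

theorem hasDerivAt_expPrim {α : ℝ} (hα : α ≠ 0) (i : ℕ) (z : ℝ) :
    HasDerivAt (expPrim α i) (z ^ i * Real.exp (α * z)) z := by
  have he : HasDerivAt (fun z => Real.exp (α * z)) (Real.exp (α * z) * α) z := by
    simpa using ((hasDerivAt_id z).const_mul α).exp
  induction i with
  | zero =>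
    refine (he.div_const α).congr_deriv ?_
    field_simp
  | succ i ih =>
    refine ((((hasDerivAt_pow (i + 1) z).mul he).sub (ih.const_mul ((i : ℝ) + 1))).div_const α).congr_deriv ?_
    push_cast
    field_simp
    ring

/-- Antiderivatives of the functions `rowFn`. -/
def rowPrim (k₁ k₂ : ℕ) (α : ℝ) (i : Fin (k₁ + k₂)) (z : ℝ) : ℝ :=
  if (i : ℕ) < k₁ then expPrim α i z else z ^ (k₁ + k₂ - i) / (k₁ + k₂ - i : ℕ)

theorem hasDerivAt_rowPrim (k₁ k₂ : ℕ) {α : ℝ} (hα : α ≠ 0 ∨ k₁ = 0) (i : Fin (k₁ + k₂)) (z : ℝ) :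
    HasDerivAt (rowPrim k₁ k₂ α i) (rowFn k₁ k₂ α i z) z := by
  unfold rowPrim rowFn
  split_ifs with h
  · exact hasDerivAt_expPrim (hα.resolve_right (by omega)) _ _
  · refine ((hasDerivAt_pow (k₁ + k₂ - i) z).div_const _).congr_deriv ?_
    have : ((k₁ + k₂ - i : ℕ) : ℝ) ≠ 0 := Nat.cast_ne_zero.2 (by have := i.2; omega)
    rw [show k₁ + k₂ - (i : ℕ) - 1 = k₁ + k₂ - 1 - i by omega]
    field_simp

/-- The rows for `k₂ + 1` are a triangular combination of the antiderivatives of the rows for `k₂`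
and of the constant 1. Each of the `k₁` exponential rows contributes a factor `α` to the
determinant. -/
theorem kernelDet_succ (k₁ k₂ : ℕ) : ∃ s : ℝ, s ≠ 0 ∧ ∀ α : ℝ, (α ≠ 0 ∨ k₁ = 0) →
    ∀ l : Fin (k₁ + k₂ + 1) → ℝ, kernelDet k₁ (k₂ + 1) α l = s * α ^ k₁ * (Matrix.of
      (Fin.snoc (α := fun _ => Fin (k₁ + k₂ + 1) → ℝ) (fun a j => rowPrim k₁ k₂ α a (l j)) fun _ => 1)).det := by
  refine ⟨∏ j : Fin k₂, ((k₂ : ℝ) - j), Finset.prod_ne_zero_iff.2 fun j _ => ?_, fun α hα l => ?_⟩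
  · have : (j : ℝ) < k₂ := by exact_mod_cast j.2
    exact (sub_pos.2 this).ne'
  -- With `P i` the antiderivative `expPrim α i`, one has `z^i exp (α z) = α P i + i P (i-1)`; the
  -- other rows are only rescaled. The determinant is `α^k₁ k₂!`.
  let T : Matrix (Fin (k₁ + k₂ + 1)) (Fin (k₁ + k₂ + 1)) ℝ := Matrix.of fun a b =>
    if a = b then (if (a : ℕ) < k₁ then α else if (a : ℕ) < k₁ + k₂ then (k₁ + k₂ - a : ℕ) else 1)
    else if (a : ℕ) < k₁ ∧ (b : ℕ) + 1 = a then (a : ℝ) else 0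
  have hT : T.det = (∏ j : Fin k₂, ((k₂ : ℝ) - j)) * α ^ k₁ := by
    rw [det_of_isLowerTriangular]
    · simp only [T, of_apply, if_true]
      rw [Fin.prod_univ_castSucc, Fin.prod_univ_add]
      simp only [Fin.val_castSucc, Fin.val_castAdd, Fin.is_lt, if_true, Fin.val_natAdd, Fin.val_last]
      simp
      rw [mul_comm]
    · intro i j hij
      have h : i < j := hij
      have h1 : i ≠ j := h.ne
      have h2 : ¬ (j : ℕ) + 1 = i := by have : (i : ℕ) < j := h; omega
      simp [T, h1, h2]
  suffices key : ∀ a j : Fin (k₁ + k₂ + 1), rowFn k₁ (k₂ + 1) α a (l j) = ∑ b, T a b *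
      Fin.snoc (α := fun _ => Fin (k₁ + k₂ + 1) → ℝ) (fun a j => rowPrim k₁ k₂ α a (l j))
        (fun _ => 1) b j by
    rw [← hT, ← det_mul]
    refine congrArg det (Matrix.ext fun a j => ?_)
    rw [Matrix.mul_apply]
    exact key a j
  intro a j
  by_cases ha : (a : ℕ) < k₁ ∧ 0 < (a : ℕ)
  · have hb : (a : ℕ) - 1 < k₁ + k₂ + 1 := by omega
    have hab : a ≠ ⟨a - 1, hb⟩ := by simp only [ne_eq, Fin.ext_iff]; omega
    rw [Finset.sum_eq_add a ⟨a - 1, hb⟩ hab ?_ (by simp) (by simp)]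
    · have e : ∀ (i : ℕ) (h : i < k₁ + k₂) (h' : i < k₁ + k₂ + 1),
          Fin.snoc (α := fun _ => Fin (k₁ + k₂ + 1) → ℝ) (fun a j => rowPrim k₁ k₂ α a (l j))
            (fun _ => 1) ⟨i, h'⟩ j = rowPrim k₁ k₂ α ⟨i, h⟩ (l j) := fun i h _ =>
        congrFun (Fin.snoc_castSucc (α := fun _ => Fin (k₁ + k₂ + 1) → ℝ) (fun _ => 1)
          (fun a j => rowPrim k₁ k₂ α a (l j)) ⟨i, h⟩) j
      have e1 : Fin.snoc (α := fun _ => Fin (k₁ + k₂ + 1) → ℝ) (fun a j => rowPrim k₁ k₂ α a (l j))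
            (fun _ => 1) a j = rowPrim k₁ k₂ α ⟨a, by omega⟩ (l j) := e a _ a.2
      have hT1 : T a a = α := by simp [T, ha.1]
      have hT2 : T a ⟨a - 1, hb⟩ = (a : ℝ) := by
        simp only [T, of_apply, if_neg hab]
        exact if_pos ⟨ha.1, by omega⟩
      rw [hT1, hT2, e1, e _ (by omega) hb]
      obtain ⟨i, hi⟩ : ∃ i, (a : ℕ) = i + 1 := ⟨a - 1, by omega⟩
      have hα0 : α ≠ 0 := hα.resolve_right (by omega)
      have hi1 : i + 1 < k₁ := by omega
      have hi2 : i < k₁ := by omega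
      simp only [rowFn, rowPrim, hi, Nat.add_sub_cancel, hi1, hi2, if_true, expPrim]
      push_cast
      field_simp
      ring
    · intro b _ hb'
      have h1 : a ≠ b := hb'.1.symm
      have h2 : ¬ (b : ℕ) + 1 = a := fun h => hb'.2 (Fin.ext (by simp; omega))
      simp [T, h1, h2]
  · rw [Finset.sum_eq_single a ?_ (by simp)]
    · induction a using Fin.lastCases with
      | last =>
        simp [T, rowFn]
      | cast a =>
        rw [Fin.snoc_castSucc]
        simp only [T, of_apply, if_true, Fin.val_castSucc, Fin.is_lt]
        simp only [Fin.val_castSucc] at ha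
        by_cases h : (a : ℕ) < k₁
        · have h0 : (a : ℕ) = 0 := by omega
          have hk : 0 < k₁ := by omega
          have hα0 : α ≠ 0 := hα.resolve_right (by omega)
          simp only [rowFn, rowPrim, Fin.val_castSucc, h0, hk, if_true, expPrim]
          field_simp
        · have h3 : ((k₁ + k₂ - a : ℕ) : ℝ) ≠ 0 := Nat.cast_ne_zero.2 (by have := a.2; omega)
          simp only [rowFn, rowPrim, h, if_false, Fin.val_castSucc]
          rw [show k₁ + (k₂ + 1) - 1 - (a : ℕ) = k₁ + k₂ - a by omega]
          field_simp
    · intro b _ hb'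
      have h2 : ¬ ((a : ℕ) < k₁ ∧ (b : ℕ) + 1 = a) := fun h => ha ⟨h.1, by omega⟩
      simp [T, hb'.symm, h2]

/-- The weight `exp (Tr A M)` for the source `A`. -/
def sourceWeight (k₁ : ℕ) {n : ℕ} (α : ℝ) (c : HermCoord n) : ENNReal :=
  ENNReal.ofReal (Real.exp (α * ∑ i : Fin n, if (i : ℕ) < k₁ then c.1 i else 0))

theorem measurable_sourceWeight (k₁ : ℕ) {n : ℕ} (α : ℝ) :
    Measurable (sourceWeight k₁ (n := n) α) := by
  refine Measurable.ennreal_ofReal (Continuous.measurable ?_)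
  refine Real.continuous_exp.comp (continuous_const.mul (continuous_finsetSum _ fun i _ => ?_))
  split_ifs <;> fun_prop

theorem HasEigDensity.congr {n : ℕ} {W : HermCoord n → ENNReal} {κ κ' : (Fin n → ℝ) → ENNReal}
    (h : HasEigDensity W κ) (hκ : ∀ l, StrictAnti l → κ l = κ' l) : HasEigDensity W κ' := by
  intro g hg
  rw [h g hg]
  exact setLIntegral_congr_fun (measurableSet_strictAnti n) fun l hl => by rw [hκ l hl]

theorem hasEigDensity_zero : HasEigDensity (n := 0) (fun _ => 1) fun _ => 1 := by
  intro g _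
  have h1 : (volume : Measure (HermCoord 0)) Set.univ = 1 := by
    rw [Measure.volume_eq_prod, ← Set.univ_prod_univ, Measure.prod_prod]
    simp [volume_pi]
  have h2 : {l : Fin 0 → ℝ | StrictAnti l} = Set.univ :=
    Set.eq_univ_of_forall fun l i => i.elim0
  have h3 : (volume : Measure (Fin 0 → ℝ)) Set.univ = 1 := by
    simp [volume_pi]
  have h4 : ∀ l : Fin 0 → ℝ, g l = g default := fun l => congrArg g (Subsingleton.elim _ _)
  simp only [h4, h2, Measure.restrict_univ]
  simp [h1, h3]

theorem pow_mul_lintegral_interlaced (k₁ k₂ : ℕ) : ∃ s : ℝ, s ≠ 0 ∧ ∀ α : ℝ, (α ≠ 0 ∨ k₁ = 0) →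
    ∀ C : ℝ, (∀ μ : Fin (k₁ + k₂) → ℝ, StrictAnti μ → 0 ≤ C * kernelDet k₁ k₂ α μ) →
    ∀ l : Fin (k₁ + k₂ + 1) → ℝ, StrictAnti l →
    0 ≤ s * C * (α ^ k₁)⁻¹ * kernelDet k₁ (k₂ + 1) α l ∧
    (NNReal.pi : ENNReal) ^ (k₁ + k₂) *
      ∫⁻ μ in {μ | l ∈ interlace μ}, ENNReal.ofReal (C * kernelDet k₁ k₂ α μ) =
      ENNReal.ofReal (s * C * (α ^ k₁)⁻¹ * kernelDet k₁ (k₂ + 1) α l) := by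
  obtain ⟨s, hs, h⟩ := kernelDet_succ k₁ k₂
  refine ⟨Real.pi ^ (k₁ + k₂) * s⁻¹, mul_ne_zero (pow_ne_zero _ Real.pi_ne_zero) (inv_ne_zero hs),
    fun α hα C hC l hl => ?_⟩
  have hαk : α ^ k₁ ≠ 0 := by
    rcases hα with h | h
    · exact pow_ne_zero _ h
    · simp [h]
  obtain ⟨h1, h2⟩ := lintegral_interlaced_det (rowFn k₁ k₂ α) (rowPrim k₁ k₂ α)
    (hasDerivAt_rowPrim k₁ k₂ hα) (continuous_rowFn k₁ k₂ α) C hC hl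
  have hpi : (NNReal.pi : ENNReal) = ENNReal.ofReal Real.pi := by
    rw [← NNReal.coe_real_pi, ENNReal.ofReal_coe_nnreal]
  have h4 : ∀ D E : ℝ, D = s * α ^ k₁ * E →
      Real.pi ^ (k₁ + k₂) * s⁻¹ * C * (α ^ k₁)⁻¹ * D = Real.pi ^ (k₁ + k₂) * (C * E) := by
    rintro _ E rfl
    field_simp
  have h5 := h4 _ _ (h α hα l)
  unfold kernelDet at h5 ⊢
  refine ⟨h5 ▸ mul_nonneg (by positivity) h1, ?_⟩
  rw [h2, hpi, ← ENNReal.ofReal_pow Real.pi_pos.le, ← ENNReal.ofReal_mul (by positivity)]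
  exact congrArg _ h5.symm

/-- Each bordering costs a factor `α^(-k₁)`, whence the exponent `k₁ k₂`. The constant is chosen
before `α`: the dependence on `α` must be explicit because the density is differentiated in `α`
later. -/
theorem hasEigDensity_succ (k₁ k₂ : ℕ)
    (h : ∃ c : ℝ, c ≠ 0 ∧ ∀ α : ℝ, (α ≠ 0 ∨ k₁ = 0) →
      (∀ l, StrictAnti l → 0 ≤ c * (α ^ (k₁ * k₂))⁻¹ * kernelDet k₁ k₂ α l) ∧
      HasEigDensity (sourceWeight k₁ α) fun l =>
        ENNReal.ofReal (c * (α ^ (k₁ * k₂))⁻¹ * kernelDet k₁ k₂ α l)) :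
    ∃ c : ℝ, c ≠ 0 ∧ ∀ α : ℝ, (α ≠ 0 ∨ k₁ = 0) →
      (∀ l, StrictAnti l → 0 ≤ c * (α ^ (k₁ * (k₂ + 1)))⁻¹ * kernelDet k₁ (k₂ + 1) α l) ∧
      HasEigDensity (sourceWeight k₁ α) fun l =>
        ENNReal.ofReal (c * (α ^ (k₁ * (k₂ + 1)))⁻¹ * kernelDet k₁ (k₂ + 1) α l) := by
  obtain ⟨c, hc, h⟩ := h
  obtain ⟨s, hs, hs'⟩ := pow_mul_lintegral_interlaced k₁ k₂
  refine ⟨s * c, mul_ne_zero hs hc, fun α hα => ?_⟩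
  obtain ⟨h1, h2⟩ := h α hα
  have h3 := hs' α hα _ h1
  have h4 : s * c * (α ^ (k₁ * (k₂ + 1)))⁻¹ = s * (c * (α ^ (k₁ * k₂))⁻¹) * (α ^ k₁)⁻¹ := by
    rw [mul_add, pow_add, mul_one, mul_inv]; ring
  rw [h4]
  refine ⟨fun l hl => (h3 l hl).1, ?_⟩
  refine (h2.of_border (measurable_sourceWeight k₁ α) ((continuous_const.mul
    (continuous_kernelDet k₁ k₂ α)).measurable.ennreal_ofReal)
    (measurable_sourceWeight (n := k₁ + k₂ + 1) k₁ α) fun d v x => ?_).congr fun l hl => (h3 l hl).2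
  unfold sourceWeight
  rw [Fin.sum_univ_castSucc]
  simp [border]

/-- The recursion started from the empty matrix with no exponential rows; it is read at `α = 0`,
which the alternative `k₁ = 0` permits. -/
theorem hasEigDensity_one (n : ℕ) : ∃ c : ℝ, c ≠ 0 ∧
    (∀ l : Fin n → ℝ, StrictAnti l → 0 ≤ c * (vandermonde l).det) ∧
    HasEigDensity (n := n) (fun _ => 1) fun l => ENNReal.ofReal (c * (vandermonde l).det) := by
  have key : ∀ k : ℕ, ∃ c : ℝ, c ≠ 0 ∧ ∀ α : ℝ, (α ≠ 0 ∨ 0 = 0) →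
      (∀ l, StrictAnti l → 0 ≤ c * (α ^ (0 * k))⁻¹ * kernelDet 0 k α l) ∧
      HasEigDensity (sourceWeight 0 α) fun l =>
        ENNReal.ofReal (c * (α ^ (0 * k))⁻¹ * kernelDet 0 k α l) := by
    intro k
    induction k with
    | zero =>
      refine ⟨1, one_ne_zero, fun α _ => ⟨fun l _ => by simp [kernelDet], ?_⟩⟩
      convert hasEigDensity_zero using 2 <;> simp [sourceWeight, kernelDet]
    | succ k ih => exact hasEigDensity_succ 0 k ih
  obtain ⟨c, hc, h⟩ := key n
  obtain ⟨h1, h2⟩ := h 0 (Or.inr rfl)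
  -- The descending powers form the Vandermonde matrix with its rows reversed.
  have hk : ∀ l, kernelDet 0 n 0 l =
      ((Equiv.Perm.sign (Fin.revPerm (n := 0 + n)) : ℤ) : ℝ) * (vandermonde l).det := by
    intro l
    rw [← det_transpose (vandermonde l), ← det_permute]
    unfold kernelDet
    congr 1
    ext i j
    simp only [rowFn, of_apply, Nat.not_lt_zero, if_false, submatrix_apply, transpose_apply,
      vandermonde_apply, id, Fin.revPerm_apply, Fin.val_rev]
    congr 1
    omega
  have : ∃ c : ℝ, c ≠ 0 ∧ (∀ l : Fin (0 + n) → ℝ, StrictAnti l → 0 ≤ c * (vandermonde l).det) ∧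
      HasEigDensity (n := 0 + n) (fun _ => 1) fun l => ENNReal.ofReal (c * (vandermonde l).det) := by
    refine ⟨c * ((Equiv.Perm.sign (Fin.revPerm (n := 0 + n)) : ℤ) : ℝ), mul_ne_zero hc (by simp), ?_, ?_⟩
    · intro l hl
      have := h1 l hl
      rw [hk] at this
      simpa [mul_assoc] using this
    · convert h2 using 2 with d l
      · simp [sourceWeight]
      · rw [hk]; simp [mul_assoc]
  rwa [Nat.zero_add] at this

/-- For `k₂ = 0` the source is scalar, so the weight `exp (α Tr M)` is a function of the eigenvalues
and can be absorbed into the test function of `hasEigDensity_one`. The borderings then raise `k₂`.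
-/
theorem exists_hasEigDensity (k₁ k₂ : ℕ) : ∃ c : ℝ, c ≠ 0 ∧ ∀ α : ℝ, (α ≠ 0 ∨ k₁ = 0) →
      (∀ l, StrictAnti l → 0 ≤ c * (α ^ (k₁ * k₂))⁻¹ * kernelDet k₁ k₂ α l) ∧
      HasEigDensity (sourceWeight k₁ α) fun l =>
        ENNReal.ofReal (c * (α ^ (k₁ * k₂))⁻¹ * kernelDet k₁ k₂ α l) := by
  induction k₂ with
  | succ k ih => exact hasEigDensity_succ k₁ k ih
  | zero =>
    obtain ⟨c, hc, h1, h2⟩ := hasEigDensity_one k₁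
    have hk : ∀ α (l : Fin k₁ → ℝ), kernelDet k₁ 0 α l =
        Real.exp (α * ∑ i, l i) * (vandermonde l).det := by
      intro α l
      rw [← det_transpose (vandermonde l), Finset.mul_sum, Real.exp_sum, ← det_mul_row]
      refine congrArg det (Matrix.ext fun i j => ?_)
      have hi : (i : ℕ) < k₁ := i.2
      simp only [of_apply, rowFn, hi, if_true, transpose_apply, vandermonde_apply]
      exact mul_comm _ _
    refine ⟨c, hc, fun α _ => ?_⟩
    have hk' : ∀ l : Fin k₁ → ℝ, c * (α ^ (k₁ * 0))⁻¹ * kernelDet k₁ 0 α l =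
        Real.exp (α * ∑ i, l i) * (c * (vandermonde l).det) := fun l => by
      rw [hk, Nat.mul_zero, pow_zero, inv_one]; ring
    refine ⟨fun l hl => (hk' l).symm ▸ mul_nonneg (Real.exp_pos _).le (h1 l hl), ?_⟩
    suffices h : HasEigDensity (n := k₁) (sourceWeight k₁ α) fun l =>
        ENNReal.ofReal (Real.exp (α * ∑ i, l i) * (c * (vandermonde l).det)) from
      h.congr fun l _ => congrArg ENNReal.ofReal (hk' l).symm
    intro g hg
    have hm : Measurable fun l : Fin k₁ → ℝ => ENNReal.ofReal (Real.exp (α * ∑ i, l i)) * g l :=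
      Measurable.mul (by fun_prop) hg
    refine Eq.trans (lintegral_congr fun d => ?_) ((h2 _ hm).trans (lintegral_congr fun l => ?_))
    · have hs : sourceWeight k₁ α d = ENNReal.ofReal (Real.exp (α * ∑ i, eig d i)) := by
        rw [← sum_diag_eq_sum_eig]
        simp [sourceWeight]
      rw [hs, one_mul]
    · beta_reduce
      rw [ENNReal.ofReal_mul (p := Real.exp (α * ∑ i, l i)) (Real.exp_pos _).le]
      ring

/-! ### Gaussian moments and the determinantal formula -/

theorem integrable_exp_mul_gaussian (a : ℝ) : Integrable fun z : ℝ => Real.exp (a * z - z ^ 2 / 2) := by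
  have h := ((integrable_exp_neg_mul_sq (b := 1 / 2) (by norm_num)).comp_sub_right a).const_mul
    (Real.exp (a ^ 2 / 2))
  refine h.congr (Filter.Eventually.of_forall fun z => ?_)
  simp only [← Real.exp_add]
  congr 1; ring

theorem integrable_pow_mul_gaussian (j : ℕ) (a : ℝ) :
    Integrable fun z : ℝ => z ^ j * Real.exp (a * z - z ^ 2 / 2) := by
  refine (((integrable_exp_mul_gaussian (a + 1)).add (integrable_exp_mul_gaussian (a - 1))).const_mul
    (j.factorial : ℝ)).mono' (by fun_prop) (Filter.Eventually.of_forall fun z => ?_)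
  rw [norm_mul, norm_pow, Real.norm_eq_abs, Real.norm_eq_abs, Real.abs_exp]
  have h1 : |z| ^ j ≤ j.factorial * Real.exp |z| := by
    have := Real.pow_div_factorial_le_exp |z| (abs_nonneg z) j
    rwa [div_le_iff₀ (by positivity), mul_comm] at this
  have h2 : Real.exp |z| ≤ Real.exp z + Real.exp (-z) := by
    rcases abs_cases z with h | h <;> rw [h.1] <;> linarith [Real.exp_pos z, Real.exp_pos (-z)]
  calc |z| ^ j * Real.exp (a * z - z ^ 2 / 2)
      ≤ (j.factorial * (Real.exp z + Real.exp (-z))) * Real.exp (a * z - z ^ 2 / 2) := by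
        gcongr
        exact h1.trans (by gcongr)
    _ = _ := by
        simp only [Pi.add_apply]
        rw [mul_assoc, add_mul, ← Real.exp_add, ← Real.exp_add]
        congr 3 <;> ring

/-- The moments `∫_S zʲ exp (α z - z² / 2) dz`. -/
def gaussMoment (α : ℝ) (S : Set ℝ) (j : ℕ) : ℝ := ∫ z in S, z ^ j * Real.exp (α * z - z ^ 2 / 2)

/-- The matrix of moments of the two weights. -/
def momentMatrix (k₁ k₂ : ℕ) (α : ℝ) (S : Set ℝ) : Matrix (Fin (k₁ + k₂)) (Fin (k₁ + k₂)) ℝ :=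
  Matrix.of fun i j => if (i : ℕ) < k₁ then gaussMoment α S (i + j)
    else gaussMoment 0 S (k₁ + k₂ - 1 - i + j)

theorem strictAnti_comp_iff_eq {n : ℕ} {l : Fin n → ℝ} {σ τ : Equiv.Perm (Fin n)}
    (hσ : StrictAnti (l ∘ σ)) (hτ : StrictAnti (l ∘ τ)) : σ = τ := by
  have hl : Function.Injective l := by
    have := hσ.injective.comp σ.symm.injective
    simpa [Function.comp_assoc] using this
  have h1 : StrictMono (OrderDual.toDual ∘ l ∘ σ) := hσ
  have h2 : StrictMono (OrderDual.toDual ∘ l ∘ τ) := hτ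
  have h3 := (StrictMono.range_inj h1 h2).1 (by
    rw [← Function.comp_assoc, ← Function.comp_assoc, σ.surjective.range_comp,
      τ.surjective.range_comp])
  refine Equiv.ext fun i => hl ?_
  exact congrFun h3 i

theorem exists_strictAnti_comp {n : ℕ} {l : Fin n → ℝ} (hl : Function.Injective l) :
    ∃ σ : Equiv.Perm (Fin n), StrictAnti (l ∘ σ) := by
  have h : Monotone ((OrderDual.toDual ∘ l) ∘ Tuple.sort (OrderDual.toDual ∘ l)) := Tuple.monotone_sort _
  have h2 : Antitone (l ∘ Tuple.sort (OrderDual.toDual ∘ l)) := h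
  exact ⟨_, h2.strictAnti_of_injective (hl.comp (Equiv.injective _))⟩

/-- The vectors with distinct entries are the disjoint union of the `n!` permuted copies of the
strictly decreasing ones. -/
theorem integral_eq_factorial_mul_setIntegral {n : ℕ} (f : (Fin n → ℝ) → ℝ) (hf : Integrable f)
    (hsymm : ∀ (σ : Equiv.Perm (Fin n)) l, f (l ∘ σ) = f l)
    (h0 : ∀ l, ¬ Function.Injective l → f l = 0) :
    ∫ l, f l = n.factorial * ∫ l in {l | StrictAnti l}, f l := by
  have hms : ∀ σ : Equiv.Perm (Fin n), MeasurableSet {l : Fin n → ℝ | StrictAnti (l ∘ σ)} := fun σ =>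
    (measurableSet_strictAnti n).preimage (measurable_pi_lambda _ fun i => measurable_pi_apply (σ i))
  have h1 : ∫ l, f l = ∫ l in ⋃ σ : Equiv.Perm (Fin n), {l | StrictAnti (l ∘ σ)}, f l := by
    rw [setIntegral_eq_integral_of_forall_compl_eq_zero]
    intro l hl
    refine h0 l fun hinj => hl ?_
    obtain ⟨σ, hσ⟩ := exists_strictAnti_comp hinj
    exact Set.mem_iUnion.2 ⟨σ, hσ⟩
  rw [h1, integral_iUnion_fintype hms ?_ fun σ => hf.integrableOn]
  · have h2 : ∀ σ : Equiv.Perm (Fin n), ∫ l in {l | StrictAnti (l ∘ σ)}, f l =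
        ∫ l in {l | StrictAnti l}, f l := by
      intro σ
      have hp := volume_measurePreserving_piCongrLeft (fun _ : Fin n => ℝ) σ.symm
      have he : ∀ l : Fin n → ℝ, MeasurableEquiv.piCongrLeft (fun _ : Fin n => ℝ) σ.symm l = l ∘ σ := by
        intro l
        ext i
        have := Equiv.piCongrLeft_apply_apply (fun _ : Fin n => ℝ) σ.symm l (σ i)
        rw [MeasurableEquiv.coe_piCongrLeft]
        simpa using this
      have h3 := hp.setIntegral_preimage_emb (MeasurableEquiv.measurableEmbedding _) f {l | StrictAnti l}
      simp only [he, hsymm] at h3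
      rw [← h3]
      congr 2
      ext l
      simp [he]
    simp only [h2, Finset.sum_const, Finset.card_univ, Fintype.card_perm, Fintype.card_fin, nsmul_eq_mul]
  · intro σ τ hst
    refine Set.disjoint_left.2 fun l h1 h2 => hst (strictAnti_comp_iff_eq h1 h2)

/-- Andréief's identity: after expansion of the Vandermonde determinant, every permutation
contributes the same determinant of one-dimensional integrals, since the two signs cancel. -/
theorem integral_vandermonde_mul_det {n : ℕ} (φ : Fin n → ℝ → ℝ) (w : ℝ → ℝ)
    (hint : ∀ i (j : ℕ), Integrable fun z => z ^ j * (φ i z * w z)) :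
    Integrable (fun l : Fin n → ℝ => (vandermonde l).det *
      ((Matrix.of fun i j => φ i (l j)).det * ∏ j, w (l j))) ∧
    ∫ l : Fin n → ℝ, (vandermonde l).det * ((Matrix.of fun i j => φ i (l j)).det * ∏ j, w (l j)) =
      n.factorial * (Matrix.of fun i (j : Fin n) => ∫ z, z ^ (j : ℕ) * (φ i z * w z)).det := by
  have h1 : ∀ l : Fin n → ℝ, (vandermonde l).det *
      ((Matrix.of fun i j => φ i (l j)).det * ∏ j, w (l j)) = ∑ σ : Equiv.Perm (Fin n),
        ((Equiv.Perm.sign σ : ℤ) : ℝ) *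
          (Matrix.of fun i j => l j ^ (σ j : ℕ) * (φ i (l j) * w (l j))).det := by
    intro l
    rw [← det_transpose (vandermonde l), det_apply', Finset.sum_mul]
    refine Finset.sum_congr rfl fun σ _ => ?_
    have h2 : (Matrix.of fun i j => l j ^ (σ j : ℕ) * (φ i (l j) * w (l j))) =
        Matrix.of fun i j => (l j ^ (σ j : ℕ) * w (l j)) * (Matrix.of fun i j => φ i (l j)) i j := by
      ext i j; simp; ring
    rw [h2, det_mul_row, Finset.prod_mul_distrib]
    simp only [transpose_apply, vandermonde_apply]
    ring
  simp only [h1]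
  have h3 := fun σ : Equiv.Perm (Fin n) => integral_pi_det
    (fun i j z => z ^ (σ j : ℕ) * (φ i z * w z)) (fun _ => volume) fun i j => hint i (σ j)
  simp only [← volume_pi] at h3
  refine ⟨integrable_finsetSum _ fun σ _ => (h3 σ).1.const_mul _, ?_⟩
  rw [integral_finsetSum _ fun σ _ => (h3 σ).1.const_mul _]
  have h4 : ∀ σ : Equiv.Perm (Fin n), (Matrix.of fun i j => ∫ z, z ^ (σ j : ℕ) * (φ i z * w z)).det =
      ((Equiv.Perm.sign σ : ℤ) : ℝ) *
        (Matrix.of fun i (j : Fin n) => ∫ z, z ^ (j : ℕ) * (φ i z * w z)).det := by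
    intro σ
    rw [← det_permute']
    rfl
  simp only [integral_const_mul, (h3 _).2, h4]
  have h5 : ∀ σ : Equiv.Perm (Fin n), ((Equiv.Perm.sign σ : ℤ) : ℝ) * ((Equiv.Perm.sign σ : ℤ) : ℝ) = 1 := by
    intro σ
    rcases Int.units_eq_one_or (Equiv.Perm.sign σ) with h | h <;> simp [h]
  simp only [← mul_assoc, h5, one_mul]
  simp [Fintype.card_perm]

theorem det_vandermonde_comp {n : ℕ} (l : Fin n → ℝ) (σ : Equiv.Perm (Fin n)) :
    (vandermonde (l ∘ σ)).det = ((Equiv.Perm.sign σ : ℤ) : ℝ) * (vandermonde l).det := by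
  rw [← det_permute]; rfl

/-- The constant in `hasEigDensity_one` already makes the Vandermonde determinant nonnegative on
decreasing vectors, so its sign serves as `ε`. -/
theorem exists_abs_det_vandermonde (n : ℕ) : ∃ ε : ℝ, |ε| = 1 ∧ ∀ l : Fin n → ℝ, StrictAnti l →
    |(vandermonde l).det| = ε * (vandermonde l).det := by
  obtain ⟨c, hc, h1, -⟩ := hasEigDensity_one n
  refine ⟨c / |c|, by rw [abs_div, abs_abs, div_self (abs_ne_zero.2 hc)], fun l hl => ?_⟩
  have := abs_of_nonneg (h1 l hl)
  rw [abs_mul] at this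
  have hc' := abs_ne_zero.2 hc
  field_simp
  linarith

/-- The Gaussian factor and the condition on the spectrum form a product over the eigenvalues; with
the density of `exists_hasEigDensity` the integrand is a Vandermonde determinant times `kernelDet`,
symmetric in the eigenvalues. The absolute values replace signs that are never computed: the
integral is nonnegative. -/
theorem exists_lintegral_weight (k₁ k₂ : ℕ) : ∃ C : ℝ, 0 < C ∧ ∀ α : ℝ, (α ≠ 0 ∨ k₁ = 0) →
    ∀ S : Set ℝ, MeasurableSet S →
    ∫⁻ c in {c : HermCoord (k₁ + k₂) | spectrum ℝ (hermMatrix c) ⊆ S},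
      ENNReal.ofReal (weight k₁ k₂ α (hermMatrix c)) =
    ENNReal.ofReal (C * (|α| ^ (k₁ * k₂))⁻¹ * |(momentMatrix k₁ k₂ α S).det|) := by
  obtain ⟨c, hc, h⟩ := exists_hasEigDensity k₁ k₂
  obtain ⟨ε, hε, hV⟩ := exists_abs_det_vandermonde (k₁ + k₂)
  refine ⟨|c|, abs_pos.2 hc, fun α hα S hS => ?_⟩
  obtain ⟨h1, h2⟩ := h α hα
  -- The indicator of `S` is put into the one-variable weight, so that the integrals become moments
  -- over `S`.
  let w : ℝ → ℝ := S.indicator fun z => Real.exp (-z ^ 2 / 2)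
  have hwm : Measurable w := Measurable.indicator (by fun_prop) hS
  have hw0 : ∀ z, 0 ≤ w z := fun z => Set.indicator_nonneg (fun _ _ => (Real.exp_pos _).le) z
  have hset : {c : HermCoord (k₁ + k₂) | spectrum ℝ (hermMatrix c) ⊆ S} = {c | ∀ i, eig c i ∈ S} := by
    ext c; rw [Set.mem_ofPred_eq, spectrum_hermMatrix, Set.range_subset_iff]; rfl
  have hsetm : MeasurableSet {c : HermCoord (k₁ + k₂) | ∀ i, eig c i ∈ S} := by
    rw [Set.ofPred_forall]
    exact MeasurableSet.iInter fun i => ((measurable_pi_apply i).comp measurable_eig) hS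
  have hweight : ∀ c : HermCoord (k₁ + k₂), ENNReal.ofReal (weight k₁ k₂ α (hermMatrix c)) =
      sourceWeight k₁ α c * ENNReal.ofReal (∏ i, Real.exp (-eig c i ^ 2 / 2)) := by
    intro d
    rw [sourceWeight, ← ENNReal.ofReal_mul (Real.exp_pos _).le, weight, ← Real.exp_sum, ← Real.exp_add]
    congr 2
    rw [trace_sub, trace_smul, trace_sq_hermMatrix, source]
    have : (diagonal (fun i : Fin (k₁ + k₂) => if (i : ℕ) < k₁ then (α : ℂ) else 0) * hermMatrix d).trace =
        ((α * ∑ i : Fin (k₁ + k₂), if (i : ℕ) < k₁ then d.1 i else 0 : ℝ) : ℂ) := by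
      rw [Matrix.trace, Finset.mul_sum]
      push_cast
      refine Finset.sum_congr rfl fun i _ => ?_
      rw [diag_apply, diagonal_mul]
      split_ifs <;> simp [hermMatrix]
    rw [this]
    simp only [Complex.sub_re, Complex.ofReal_re, smul_eq_mul]
    rw [show (1 / 2 : ℂ) = ((1 / 2 : ℝ) : ℂ) by norm_num, ← Complex.ofReal_mul, Complex.ofReal_re,
      neg_sub, sub_eq_add_neg]
    congr 1
    rw [Finset.mul_sum, ← Finset.sum_neg_distrib]
    exact Finset.sum_congr rfl fun i _ => by ring
  have hstep : ∫⁻ c in {c : HermCoord (k₁ + k₂) | spectrum ℝ (hermMatrix c) ⊆ S},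
      ENNReal.ofReal (weight k₁ k₂ α (hermMatrix c)) =
      ∫⁻ c : HermCoord (k₁ + k₂), sourceWeight k₁ α c * ENNReal.ofReal (∏ i, w (eig c i)) := by
    rw [hset, ← lintegral_indicator hsetm]
    refine lintegral_congr fun d => ?_
    by_cases hd : ∀ i, eig d i ∈ S
    · rw [Set.indicator_of_mem (by exact hd), hweight]
      congr 2
      exact Finset.prod_congr rfl fun i _ => (Set.indicator_of_mem (hd i) (fun z => Real.exp (-z ^ 2 / 2))).symm
    · rw [Set.indicator_of_notMem (by exact hd)]
      obtain ⟨i, hi⟩ := not_forall.1 hd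
      rw [Finset.prod_eq_zero (Finset.mem_univ i) (Set.indicator_of_notMem hi _)]
      simp
  have hi : ∀ i (j : ℕ), (fun z => z ^ j * (rowFn k₁ k₂ α i z * w z)) = S.indicator (fun z =>
      if (i : ℕ) < k₁ then z ^ ((i : ℕ) + j) * Real.exp (α * z - z ^ 2 / 2)
        else z ^ (k₁ + k₂ - 1 - i + j) * Real.exp (0 * z - z ^ 2 / 2)) := by
    intro i j
    ext z
    by_cases hz : z ∈ S
    · simp only [w, Set.indicator_of_mem hz, rowFn]
      split_ifs
      · rw [mul_assoc (z ^ (i : ℕ)), ← Real.exp_add, pow_add,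
          show α * z + -z ^ 2 / 2 = α * z - z ^ 2 / 2 by ring]; ring
      · rw [pow_add, show 0 * z - z ^ 2 / 2 = -z ^ 2 / 2 by ring]; ring
    · simp [w, hz]
  have hint : ∀ i (j : ℕ), Integrable fun z => z ^ j * (rowFn k₁ k₂ α i z * w z) := by
    intro i j
    rw [hi]
    refine Integrable.indicator ?_ hS
    split_ifs
    · exact integrable_pow_mul_gaussian _ _
    · exact integrable_pow_mul_gaussian _ _
  have hmom : (Matrix.of fun i (j : Fin (k₁ + k₂)) => ∫ z, z ^ (j : ℕ) * (rowFn k₁ k₂ α i z * w z)) =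
      momentMatrix k₁ k₂ α S := by
    ext i j
    simp only [of_apply, momentMatrix, gaussMoment]
    rw [hi, integral_indicator hS]
    split_ifs <;> rfl
  obtain ⟨h3, h4⟩ := integral_vandermonde_mul_det (rowFn k₁ k₂ α) w hint
  set f : (Fin (k₁ + k₂) → ℝ) → ℝ := fun l => (vandermonde l).det *
    ((Matrix.of fun i j => rowFn k₁ k₂ α i (l j)).det * ∏ j, w (l j)) with hf
  have h5 : ∫ l in {l | StrictAnti l}, f l = (momentMatrix k₁ k₂ α S).det := by
    have h6 := integral_eq_factorial_mul_setIntegral f h3 ?_ ?_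
    · rw [h4, hmom] at h6
      exact (mul_left_cancel₀ (by positivity) h6).symm
    · intro σ l
      have e1 : (Matrix.of fun i j => rowFn k₁ k₂ α i ((l ∘ σ) j)).det =
          ((Equiv.Perm.sign σ : ℤ) : ℝ) * (Matrix.of fun i j => rowFn k₁ k₂ α i (l j)).det := by
        rw [← det_permute']; rfl
      have e2 : ∏ j, w ((l ∘ σ) j) = ∏ j, w (l j) := Equiv.prod_comp σ fun j => w (l j)
      simp only [hf, det_vandermonde_comp, e1, e2]
      rcases Int.units_eq_one_or (Equiv.Perm.sign σ) with h | h <;> simp [h]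
    · intro l hl
      have : (vandermonde l).det = 0 := by
        by_contra h
        exact hl (det_vandermonde_ne_zero_iff.1 h)
      simp [hf, this]
  set C := c * (α ^ (k₁ * k₂))⁻¹ with hC
  have hnn : ∀ l : Fin (k₁ + k₂) → ℝ, StrictAnti l → 0 ≤ ε * C * f l := fun l hl => by
    have h7 : ε * C * f l = (ε * (vandermonde l).det) * (C * kernelDet k₁ k₂ α l) * ∏ j, w (l j) := by
      simp only [hf, kernelDet]; ring
    rw [h7, ← hV l hl]
    exact mul_nonneg (mul_nonneg (abs_nonneg _) (h1 l hl)) (Finset.prod_nonneg fun j _ => hw0 _)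
  have hms := measurableSet_strictAnti (k₁ + k₂)
  have hae : ∀ᵐ l ∂(volume.restrict {l : Fin (k₁ + k₂) → ℝ | StrictAnti l}), 0 ≤ ε * C * f l :=
    (ae_restrict_iff' hms).2 (Filter.Eventually.of_forall hnn)
  have hval : ∫ l in {l | StrictAnti l}, ε * C * f l = ε * C * (momentMatrix k₁ k₂ α S).det := by
    rw [integral_const_mul, h5]
  have hfin : |c| * (|α| ^ (k₁ * k₂))⁻¹ * |(momentMatrix k₁ k₂ α S).det| =
      ε * C * (momentMatrix k₁ k₂ α S).det := by
    have h8 : 0 ≤ ε * C * (momentMatrix k₁ k₂ α S).det := hval ▸ integral_nonneg_of_ae hae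
    refine Eq.trans ?_ (abs_of_nonneg h8)
    rw [abs_mul, abs_mul, hε, hC, abs_mul, abs_inv, abs_pow, one_mul]
  have hgm : Measurable fun l : Fin (k₁ + k₂) → ℝ => ENNReal.ofReal (∏ i, w (l i)) :=
    (Finset.measurable_prod _ fun i _ => hwm.comp (measurable_pi_apply i)).ennreal_ofReal
  rw [hstep, h2 _ hgm, hfin, ← hval,
    ofReal_integral_eq_lintegral_ofReal (h3.integrableOn.const_mul _) hae]
  refine setLIntegral_congr_fun hms fun l hl => ?_
  beta_reduce
  rw [← ENNReal.ofReal_mul (abs_nonneg _), ← ENNReal.ofReal_mul (mul_nonneg (abs_nonneg _) (h1 l hl)),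
    hV l hl]
  congr 1
  simp only [hf, kernelDet]
  ring

/-! ### Normalization and positivity -/

theorem continuous_weight (k₁ k₂ : ℕ) (α : ℝ) :
    Continuous fun c : HermCoord (k₁ + k₂) => weight k₁ k₂ α (hermMatrix c) := by
  have h : Continuous fun c : HermCoord (k₁ + k₂) => hermMatrix c := continuous_hermMatrix
  unfold weight
  refine Real.continuous_exp.comp (Complex.continuous_re.comp (Continuous.matrix_trace ?_)).neg
  exact ((h.matrix_mul h).const_smul (1 / 2 : ℂ)).sub (continuous_const.matrix_mul h)

theorem weight_pos (k₁ k₂ : ℕ) (α : ℝ) (M : Matrix (Fin (k₁ + k₂)) (Fin (k₁ + k₂)) ℂ) :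
    0 < weight k₁ k₂ α M := Real.exp_pos _

theorem integrable_weight_of_ne_zero (k₁ k₂ : ℕ) {α : ℝ} (hα : α ≠ 0) :
    Integrable fun c : HermCoord (k₁ + k₂) => weight k₁ k₂ α (hermMatrix c) := by
  obtain ⟨C, -, h⟩ := exists_lintegral_weight k₁ k₂
  have h1 := h α (Or.inl hα) Set.univ MeasurableSet.univ
  simp only [Set.subset_univ, Set.ofPred_true, Measure.restrict_univ] at h1
  refine ⟨(continuous_weight k₁ k₂ α).aestronglyMeasurable, ?_⟩
  rw [hasFiniteIntegral_iff_ofReal (Filter.Eventually.of_forall fun c => (weight_pos k₁ k₂ α _).le), h1]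
  exact ENNReal.ofReal_lt_top

/-- The coordinates of the source. -/
def sourceCoord (k₁ k₂ : ℕ) (α : ℝ) : HermCoord (k₁ + k₂) :=
  (fun i => if (i : ℕ) < k₁ then α else 0, 0)

/-- Completing the square: `M²/2 - AM` has the trace of `(M - A)²/2 - A²/2`, and `Tr A² = k₁ α²`. -/
theorem weight_shift (k₁ k₂ : ℕ) (α : ℝ) (c : HermCoord (k₁ + k₂)) :
    weight k₁ k₂ α (hermMatrix (c + sourceCoord k₁ k₂ α)) =
      Real.exp (k₁ * α ^ 2 / 2) * weight k₁ k₂ 0 (hermMatrix c) := by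
  have h0 : source k₁ k₂ 0 = 0 := by simp [source]
  have h1 : hermMatrix (c + sourceCoord k₁ k₂ α) =
      hermMatrix c + source k₁ k₂ α := by
    ext i j
    rcases lt_trichotomy i j with h | h | h
    · simp [hermMatrix, source, sourceCoord, h, h.ne]
    · subst h
      by_cases hi : (i : ℕ) < k₁ <;> simp [hermMatrix, source, sourceCoord, hi]
    · simp [hermMatrix, source, sourceCoord, h, h.not_gt, h.ne']
  have h2 : (source k₁ k₂ α * source k₁ k₂ α).trace = ((k₁ * α ^ 2 : ℝ) : ℂ) := by
    rw [source, diagonal_mul_diagonal, trace_diagonal, Fin.sum_univ_add]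
    simp [pow_two]
  rw [weight, weight, h1, h0, ← Real.exp_add]
  congr 1
  have h3 : ((1 / 2 : ℂ) • ((hermMatrix c + source k₁ k₂ α) * (hermMatrix c + source k₁ k₂ α)) -
      source k₁ k₂ α * (hermMatrix c + source k₁ k₂ α)).trace =
      ((1 / 2 : ℂ) • (hermMatrix c * hermMatrix c) - 0 * hermMatrix c).trace -
        ((k₁ * α ^ 2 / 2 : ℝ) : ℂ) := by
    simp only [mul_add, add_mul, trace_sub, trace_smul, trace_add, h2, smul_eq_mul, zero_mul, trace_zero,
      trace_mul_comm (hermMatrix c) (source k₁ k₂ α)]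
    push_cast
    ring
  rw [h3, Complex.sub_re, Complex.ofReal_re]
  ring

theorem integral_weight (k₁ k₂ : ℕ) (α : ℝ) :
    ∫ c : HermCoord (k₁ + k₂), weight k₁ k₂ α (hermMatrix c) =
      Real.exp (k₁ * α ^ 2 / 2) * ∫ c : HermCoord (k₁ + k₂), weight k₁ k₂ 0 (hermMatrix c) := by
  have : (volume : Measure (HermCoord (k₁ + k₂))).IsAddRightInvariant := by
    have : (volume : Measure (HermCoord (k₁ + k₂))).IsAddHaarMeasure :=
      Measure.prod.instIsAddHaarMeasure _ _
    infer_instance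
  rw [← integral_add_right_eq_self (fun c : HermCoord (k₁ + k₂) => weight k₁ k₂ α (hermMatrix c))
    (sourceCoord k₁ k₂ α), ← integral_const_mul]
  exact integral_congr_ae (Filter.Eventually.of_forall fun c => weight_shift k₁ k₂ α c)

theorem setIntegral_weight_pos (k₁ k₂ : ℕ) {α : ℝ} (hα : α ≠ 0)
    {s : Set (HermCoord (k₁ + k₂))} (hs : volume s ≠ 0) :
    0 < ∫ c in s, weight k₁ k₂ α (hermMatrix c) := by
  rw [setIntegral_pos_iff_support_of_nonneg_ae
    (Filter.Eventually.of_forall fun c => (weight_pos k₁ k₂ α _).le)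
    (integrable_weight_of_ne_zero k₁ k₂ hα).integrableOn]
  have : Function.support (fun c : HermCoord (k₁ + k₂) => weight k₁ k₂ α (hermMatrix c)) = Set.univ :=
    Set.eq_univ_of_forall fun c => (weight_pos k₁ k₂ α _).ne'
  rw [this, Set.univ_inter]
  exact pos_iff_ne_zero.2 hs

/-- Integrability is available for nonzero parameters only. Positivity at 1 passes to every
parameter through the scaling in `integral_weight`, which holds without integrability. -/
theorem integral_weight_pos (k₁ k₂ : ℕ) (α : ℝ) :
    0 < ∫ c : HermCoord (k₁ + k₂), weight k₁ k₂ α (hermMatrix c) := by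
  have h := setIntegral_weight_pos k₁ k₂ one_ne_zero (s := Set.univ)
    (isOpen_univ.measure_pos volume Set.univ_nonempty).ne'
  rw [Measure.restrict_univ, integral_weight] at h
  rw [integral_weight]
  exact mul_pos (Real.exp_pos _) (pos_of_mul_pos_right h (Real.exp_pos _).le)

/-- The spectra of the Hermitian matrices near a real multiple of the identity are near that
multiple. -/
theorem volume_spectrum_subset_ne_zero (n : ℕ) {S O : Set ℝ} (hO : IsOpen O) (hne : O.Nonempty)
    (hOS : O ⊆ S) : volume {c : HermCoord n | spectrum ℝ (hermMatrix c) ⊆ S} ≠ 0 := by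
  obtain ⟨x, hx⟩ := hne
  obtain ⟨ε, hε, hball⟩ := Metric.isOpen_iff.1 hO x hx
  have hcont : Continuous fun c : HermCoord n => hermMatrix c := continuous_hermMatrix
  let V : Set (HermCoord n) := ⋂ k : Fin n, {c | ‖hermMatrix c k k - (x : ℂ)‖ +
    ∑ j ∈ Finset.univ.erase k, ‖hermMatrix c k j‖ < ε}
  have hV : IsOpen V := by
    refine isOpen_iInter_of_finite fun k => isOpen_lt ?_ continuous_const
    exact ((hcont.matrix_elem k k).sub continuous_const).norm.add
      (continuous_finsetSum _ fun j _ => (hcont.matrix_elem k j).norm)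
  have hVne : V.Nonempty := by
    refine ⟨(fun _ => x, 0), Set.mem_iInter.2 fun k => ?_⟩
    have : ∑ j ∈ Finset.univ.erase k, ‖hermMatrix ((fun _ => x, 0) : HermCoord n) k j‖ = 0 := by
      refine Finset.sum_eq_zero fun j hj => ?_
      have := Finset.ne_of_mem_erase hj
      rcases lt_or_gt_of_ne this with h | h <;> simp [hermMatrix, h, h.not_gt]
    rw [Set.mem_ofPred_eq, this]
    simpa [hermMatrix] using hε
  refine fun h0 => (hV.measure_pos volume hVne).ne' (measure_mono_null ?_ h0)
  intro c hc μ hμ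
  refine hOS (hball ?_)
  have hμ' : ((algebraMap ℝ ℂ) μ) ∈ spectrum ℂ (hermMatrix c) :=
    (spectrum.algebraMap_mem_iff ℂ).2 hμ
  rw [← Matrix.spectrum_toLin', ← Module.End.hasEigenvalue_iff_mem_spectrum] at hμ'
  -- Gershgorin's theorem; the open set `V` consists of the matrices whose Gershgorin discs stay
  -- within distance `ε` of `x`.
  obtain ⟨k, hk⟩ := eigenvalue_mem_ball hμ'
  rw [mem_closedBall_iff_norm] at hk
  have h1 := Set.mem_iInter.1 hc k
  rw [Set.mem_ofPred_eq] at h1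
  rw [Metric.mem_ball, Real.dist_eq, ← Real.norm_eq_abs, ← Complex.norm_real]
  calc ‖((μ - x : ℝ) : ℂ)‖ = ‖((μ : ℂ) - hermMatrix c k k) + (hermMatrix c k k - x)‖ := by
        push_cast; ring_nf
    _ ≤ _ := norm_add_le _ _
    _ < ε := by
      refine lt_of_le_of_lt ?_ h1
      rw [add_comm]
      exact add_le_add le_rfl hk

theorem prob_pos (k₁ k₂ : ℕ) {α : ℝ} (hα : α ≠ 0) {S O : Set ℝ} (hO : IsOpen O) (hne : O.Nonempty)
    (hOS : O ⊆ S) : 0 < prob k₁ k₂ α S :=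
  div_pos (setIntegral_weight_pos k₁ k₂ hα (volume_spectrum_subset_ne_zero _ hO hne hOS))
    (integral_weight_pos k₁ k₂ α)

/-- One constant serves all `α` and `S`, so logarithmic derivatives of the probability are those of
the explicit factors and of the moment determinant. -/
theorem exists_prob_eq (k₁ k₂ : ℕ) : ∃ C : ℝ, ∀ α : ℝ, α ≠ 0 → ∀ S : Set ℝ, MeasurableSet S →
    prob k₁ k₂ α S = C * (|α| ^ (k₁ * k₂))⁻¹ * Real.exp (-(k₁ * α ^ 2 / 2)) *
      |(momentMatrix k₁ k₂ α S).det| := by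
  obtain ⟨C, hC, h⟩ := exists_lintegral_weight k₁ k₂
  refine ⟨C / ∫ c : HermCoord (k₁ + k₂), weight k₁ k₂ 0 (hermMatrix c), fun α hα S hS => ?_⟩
  rw [prob, integral_weight, integral_eq_lintegral_of_nonneg_ae
    (Filter.Eventually.of_forall fun c => (weight_pos k₁ k₂ α _).le)
    (continuous_weight k₁ k₂ α).aestronglyMeasurable, h α (Or.inl hα) S hS,
    ENNReal.toReal_ofReal (by positivity), Real.exp_neg]
  have := (integral_weight_pos k₁ k₂ 0).ne'
  field_simp

/-! ### The moment matrix in a differential ring -/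

/-- Moments `m t j` of two weights (`t = true, false`) in a differential ring, with the differential
relations that hold for Gaussian moments over a union of intervals, and an arrangement
`i ↦ (s i, x i)` of the rows of the moment matrix. -/
structure MomentSystem (R : Type*) [CommRing R] [Algebra ℝ R] (n : ℕ) where
  A : Derivation ℝ R R
  D : Derivation ℝ R R
  D₀ : Derivation ℝ R R
  comm : ∀ f, A (D f) = D (A f)
  α : R
  A_α : A α = 1
  D_α : D α = 0
  D₀_α : D₀ α = 0
  m : Bool → ℕ → R
  A_true : ∀ j, A (m true j) = m true (j + 1)
  A_false : ∀ j, A (m false j) = 0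
  -- The truncated index `j - 1` at `j = 0` is harmless because of the coefficient `j`.
  D_m : ∀ t j, D (m t j) = j * m t (j - 1) + (if t then α else 0) * m t j - m t (j + 1)
  D₀_m : ∀ t j, D₀ (m t j) = (j + 1) * m t j + (if t then α else 0) * m t (j + 1) - m t (j + 2)
  k : Bool → ℕ
  s : Fin n → Bool
  x : Fin n → ℕ
  -- This and the next two fields say that the rows of weight `t` are exactly the exponents below `k
  -- t`, each occurring once.
  x_lt : ∀ i, x i < k (s i)
  exists_row : ∀ t y, y < k t → ∃ i, s i = t ∧ x i = y
  row_inj : ∀ i j, s i = s j → x i = x j → i = j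
  isUnit_det : IsUnit (Matrix.of fun i (j : Fin n) => m (s i) (x i + j)).det

namespace MomentSystem

variable {R : Type*} [CommRing R] [Algebra ℝ R] {n : ℕ} (S : MomentSystem R n)

/-- The moment matrix. -/
def H : Matrix (Fin n) (Fin n) R := of fun i (j : Fin n) => S.m (S.s i) (S.x i + j)

/-- The column of the moments of index `l`. -/
def col (l : ℕ) : Fin n → R := fun i => S.m (S.s i) (S.x i + l)

/-- The row of exponent `k t + l` for the weight `t`. -/
def row (t : Bool) (l : ℕ) : Fin n → R := fun j => S.m t (S.k t + l + j)

/-- The unit vector at the row of exponent `k t - 1 - l` for the weight `t`. -/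
def unitRow (t : Bool) (l : ℕ) : Fin n → R := fun i => if S.s i = t ∧ S.x i + 1 + l = S.k t then 1 else 0

/-- The unit vector at the column of index `n - 1 - l`. -/
def unitCol (R : Type*) [CommRing R] (n l : ℕ) : Fin n → R := fun j => if (j : ℕ) + 1 + l = n then 1 else 0

/-- The bilinear form of the inverse of the moment matrix. -/
def bil (ρ c : Fin n → R) : R := ρ ⬝ᵥ (S.H⁻¹ *ᵥ c)

theorem bil_add_left (ρ ρ' c : Fin n → R) : S.bil (ρ + ρ') c = S.bil ρ c + S.bil ρ' c :=
  add_dotProduct _ _ _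

theorem bil_sub_left (ρ ρ' c : Fin n → R) : S.bil (ρ - ρ') c = S.bil ρ c - S.bil ρ' c :=
  sub_dotProduct _ _ _

theorem bil_smul_left (a : R) (ρ c : Fin n → R) : S.bil (a • ρ) c = a * S.bil ρ c :=
  smul_dotProduct _ _ _

theorem bil_add_right (ρ c c' : Fin n → R) : S.bil ρ (c + c') = S.bil ρ c + S.bil ρ c' := by
  rw [bil, mulVec_add, dotProduct_add]; rfl

theorem bil_sub_right (ρ c c' : Fin n → R) : S.bil ρ (c - c') = S.bil ρ c - S.bil ρ c' := by
  rw [bil, mulVec_sub, dotProduct_sub]; rfl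

theorem bil_smul_right (a : R) (ρ c : Fin n → R) : S.bil ρ (a • c) = a * S.bil ρ c := by
  rw [bil, mulVec_smul, dotProduct_smul]; rfl

theorem bil_zero_left (c : Fin n → R) : S.bil 0 c = 0 := zero_dotProduct _

theorem H_inv_mul : S.H⁻¹ * S.H = 1 := nonsing_inv_mul _ S.isUnit_det

theorem H_mul_inv : S.H * S.H⁻¹ = 1 := mul_nonsing_inv _ S.isUnit_det

theorem bil_H_mulVec (ρ v : Fin n → R) : S.bil ρ (S.H *ᵥ v) = ρ ⬝ᵥ v := by
  rw [bil, mulVec_mulVec, H_inv_mul, one_mulVec]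

theorem bil_vecMul_H (u c : Fin n → R) : S.bil (u ᵥ* S.H) c = u ⬝ᵥ c := by
  rw [bil, ← dotProduct_mulVec, mulVec_mulVec, H_mul_inv, one_mulVec]

theorem derivation_inv (δ : Derivation ℝ R R) :
    S.H⁻¹.map δ = -(S.H⁻¹ * S.H.map δ * S.H⁻¹) := by
  have hmul : ∀ M N : Matrix (Fin n) (Fin n) R, (M * N).map δ = M.map δ * N + M * N.map δ := by
    intro M N
    ext i j
    simp only [map_apply, mul_apply, map_sum, Derivation.leibniz, Matrix.add_apply, smul_eq_mul,
      Finset.sum_add_distrib]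
    rw [add_comm]
    congr 1
    exact Finset.sum_congr rfl fun _ _ => mul_comm _ _
  have h1 := hmul S.H⁻¹ S.H
  rw [H_inv_mul] at h1
  have h2 : (1 : Matrix (Fin n) (Fin n) R).map δ = 0 := by
    ext i j
    rw [map_apply, one_apply]
    split_ifs <;> simp
  rw [h2] at h1
  have h3 : S.H⁻¹.map δ * S.H = -(S.H⁻¹ * S.H.map δ) := eq_neg_of_add_eq_zero_left h1.symm
  calc S.H⁻¹.map δ = S.H⁻¹.map δ * S.H * S.H⁻¹ := by rw [mul_assoc, H_mul_inv, mul_one]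
    _ = _ := by rw [h3, neg_mul]

theorem derivation_dotProduct (δ : Derivation ℝ R R) (u v : Fin n → R) :
    δ (u ⬝ᵥ v) = (δ ∘ u) ⬝ᵥ v + u ⬝ᵥ (δ ∘ v) := by
  simp only [dotProduct, map_sum, Derivation.leibniz, smul_eq_mul, Finset.sum_add_distrib,
    Function.comp_apply]
  rw [add_comm]
  congr 1
  exact Finset.sum_congr rfl fun _ _ => mul_comm _ _

theorem derivation_mulVec (δ : Derivation ℝ R R) (M : Matrix (Fin n) (Fin n) R) (v : Fin n → R) :
    δ ∘ (M *ᵥ v) = M.map δ *ᵥ v + M *ᵥ (δ ∘ v) :=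
  funext fun i => derivation_dotProduct δ (M i) v

/-- Differentiating `H⁻¹` gives `-H⁻¹(δH)H⁻¹`, and the two-sided part `PH + HQ` is transferred to
the vectors. Only the defect `W` leaves a product; it will be of low rank, so that the last term
splits into products of values of `bil`. -/
theorem derivation_bil (δ : Derivation ℝ R R) {P Q W : Matrix (Fin n) (Fin n) R}
    (h : S.H.map δ = P * S.H + S.H * Q - W) (ρ c : Fin n → R) :
    δ (S.bil ρ c) = S.bil (δ ∘ ρ - ρ ᵥ* Q) c + S.bil ρ (δ ∘ c - P *ᵥ c) +
      S.bil ρ (W *ᵥ (S.H⁻¹ *ᵥ c)) := by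
  have h1 : S.H⁻¹.map δ = -(S.H⁻¹ * P) - Q * S.H⁻¹ + S.H⁻¹ * W * S.H⁻¹ := by
    rw [derivation_inv, h]
    have e1 : S.H⁻¹ * (P * S.H + S.H * Q - W) * S.H⁻¹ =
        S.H⁻¹ * P * (S.H * S.H⁻¹) + S.H⁻¹ * S.H * Q * S.H⁻¹ - S.H⁻¹ * W * S.H⁻¹ := by noncomm_ring
    rw [e1, H_mul_inv, H_inv_mul, mul_one, one_mul]
    abel
  rw [bil, derivation_dotProduct, derivation_mulVec, h1, bil_sub_left, bil_sub_right]
  simp only [bil, add_mulVec, sub_mulVec, neg_mulVec, dotProduct_add, dotProduct_sub, dotProduct_neg,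
    ← mulVec_mulVec, ← dotProduct_mulVec]
  ring

theorem vecMulVec_mulVec_inv (u v c : Fin n → R) :
    vecMulVec u v *ᵥ (S.H⁻¹ *ᵥ c) = S.bil v c • u := by
  ext i
  simp only [mulVec, vecMulVec_apply, dotProduct, Pi.smul_apply, smul_eq_mul, bil, Finset.sum_mul]
  exact Finset.sum_congr rfl fun _ _ => by ring

theorem bil_vecMulVec (ρ c u v : Fin n → R) :
    S.bil ρ (vecMulVec u v *ᵥ (S.H⁻¹ *ᵥ c)) = S.bil ρ u * S.bil v c := by
  rw [vecMulVec_mulVec_inv, bil_smul_right, mul_comm]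

/-! ### Shifts of rows and columns -/

/-- The shift of the rows belonging to the weight `t`. -/
def rowShift (t : Bool) : Matrix (Fin n) (Fin n) R :=
  of fun i j => if S.s i = t ∧ S.s j = t ∧ S.x j = S.x i + 1 then 1 else 0

/-- The backward shift of the rows, with weights. -/
def rowLower : Matrix (Fin n) (Fin n) R :=
  of fun i j => if S.s j = S.s i ∧ S.x j + 1 = S.x i then (S.x i : R) else 0

/-- The shift of the columns. -/
def colShift (R : Type*) [CommRing R] (n : ℕ) : Matrix (Fin n) (Fin n) R :=
  of fun i j => if (i : ℕ) = j + 1 then 1 else 0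

/-- The backward shift of the columns, with weights. -/
def colLower (R : Type*) [CommRing R] (n : ℕ) : Matrix (Fin n) (Fin n) R :=
  of fun i j => if (i : ℕ) + 1 = j then (j : R) else 0

theorem rowShift_mulVec (t : Bool) (F : Bool → ℕ → R) :
    S.rowShift t *ᵥ (fun i => F (S.s i) (S.x i)) =
      fun i => if S.s i = t ∧ S.x i + 1 < S.k t then F t (S.x i + 1) else 0 := by
  ext i
  simp only [mulVec, dotProduct, rowShift, of_apply, ite_mul, one_mul, zero_mul]
  split_ifs with h
  · obtain ⟨j, hj, hj'⟩ := S.exists_row t _ h.2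
    rw [Finset.sum_eq_single j, if_pos ⟨h.1, hj, hj'⟩, hj, hj']
    · intro l _ hl
      rw [if_neg]
      exact fun h' => hl (S.row_inj _ _ (h'.2.1.trans hj.symm) (h'.2.2.trans hj'.symm))
    · simp
  · refine Finset.sum_eq_zero fun j _ => if_neg fun h' => h ⟨h'.1, ?_⟩
    have := S.x_lt j
    rw [h'.2.1, h'.2.2] at this
    exact this

theorem rowLower_mulVec (F : Bool → ℕ → R) :
    S.rowLower *ᵥ (fun i => F (S.s i) (S.x i)) =
      fun i => S.x i * F (S.s i) (S.x i - 1) := by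
  ext i
  simp only [mulVec, dotProduct, rowLower, of_apply, ite_mul, zero_mul]
  rcases Nat.eq_zero_or_pos (S.x i) with h | h
  · simp [h]
  · have := S.x_lt i
    obtain ⟨j, hj, hj'⟩ := S.exists_row (S.s i) (S.x i - 1) (by omega)
    rw [Finset.sum_eq_single j, if_pos ⟨hj, by omega⟩, hj, hj']
    · intro l _ hl
      rw [if_neg]
      exact fun h' => hl (S.row_inj _ _ (h'.1.trans hj.symm) (by omega))
    · simp

theorem vecMul_colShift {K : Type*} [CommRing K] {n : ℕ} (f : ℕ → K) :
    (fun j : Fin n => f j) ᵥ* colShift K n = fun j : Fin n => f (j + 1) - f n * unitCol K n 0 j := by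
  ext j
  simp only [vecMul, dotProduct, colShift, of_apply, mul_ite, mul_one, mul_zero, unitCol, add_zero]
  by_cases h : (j : ℕ) + 1 = n
  · rw [if_pos h, h, sub_self]
    exact Finset.sum_eq_zero fun i _ => if_neg (by have := i.2; omega)
  · have := j.2
    rw [if_neg h, sub_zero, Finset.sum_eq_single ⟨j + 1, by omega⟩]
    · simp
    · intro i _ hi
      rw [if_neg]
      exact fun h' => hi (Fin.ext h')
    · simp

theorem vecMul_colLower {K : Type*} [CommRing K] {n : ℕ} (f : ℕ → K) :
    (fun j : Fin n => f j) ᵥ* colLower K n = fun j : Fin n => j * f (j - 1) := by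
  ext j
  simp only [vecMul, dotProduct, colLower, of_apply, mul_ite, mul_zero]
  rcases Nat.eq_zero_or_pos (j : ℕ) with h | h
  · simp [h]
  · have := j.2
    rw [Finset.sum_eq_single ⟨j - 1, by omega⟩]
    · rw [if_pos (by dsimp only; omega), mul_comm]
    · intro i _ hi
      rw [if_neg]
      exact fun h' => hi (Fin.ext (by dsimp only; omega))
    · simp

end MomentSystem

namespace MomentSystem

variable {R : Type*} [CommRing R] [Algebra ℝ R] {n : ℕ} (S : MomentSystem R n)

/-- The parameter of the weight `t`. -/
def par (t : Bool) : R := if t then S.α else 0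

theorem D_moment (t : Bool) (j : ℕ) :
    S.D (S.m t j) = j * S.m t (j - 1) + S.par t * S.m t j - S.m t (j + 1) := S.D_m t j

/-- Within a weight, shifting the rows raises the index of the moments, except at the last row,
where the required moment lies outside the matrix. -/
theorem rowShift_mulVec_col (t : Bool) (l : ℕ) : S.rowShift t *ᵥ S.col l =
    (fun i => if S.s i = t then S.col (l + 1) i else 0) - S.m t (S.k t + l) • S.unitRow t 0 := by
  refine (S.rowShift_mulVec t fun u y => S.m u (y + l)).trans (funext fun i => ?_)
  simp only [Pi.sub_apply, Pi.smul_apply, unitRow, col, smul_eq_mul, mul_ite, mul_one, mul_zero, add_zero]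
  by_cases h : S.s i = t
  · have := S.x_lt i
    rw [h] at this
    rcases (show S.x i + 1 < S.k t ∨ S.x i + 1 = S.k t by omega) with h' | h'
    · simp only [h, h', h'.ne, and_self, and_false, if_true, if_false, sub_zero]
      congr 1; omega
    · simp only [h, h', lt_irrefl, and_self, and_false, if_true, if_false]
      rw [← h', show S.x i + (l + 1) = S.x i + 1 + l by omega, sub_self]
  · simp [h]

theorem rowShift_mulVec_unitRow (t : Bool) (l : ℕ) :
    S.rowShift t *ᵥ S.unitRow t l = S.unitRow t (l + 1) := by
  refine (S.rowShift_mulVec t fun u y => if u = t ∧ y + 1 + l = S.k t then 1 else 0).trans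
    (funext fun i => ?_)
  simp only [unitRow, true_and]
  rw [← ite_and]
  refine if_congr ?_ rfl rfl
  constructor
  · rintro ⟨⟨h, _⟩, h2⟩; exact ⟨h, by omega⟩
  · rintro ⟨h, h2⟩; exact ⟨⟨h, by omega⟩, by omega⟩

theorem rowShift_mulVec_unitRow_of_ne {t u : Bool} (h : t ≠ u) (l : ℕ) :
    S.rowShift t *ᵥ S.unitRow u l = 0 := by
  refine (S.rowShift_mulVec t fun v y => if v = u ∧ y + 1 + l = S.k u then 1 else 0).trans
    (funext fun i => ?_)
  simp [h]

theorem rowLower_mulVec_unitRow (t : Bool) : S.rowLower *ᵥ S.unitRow t 0 = 0 := by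
  refine (S.rowLower_mulVec fun u y => if u = t ∧ y + 1 + 0 = S.k t then 1 else 0).trans
    (funext fun i => ?_)
  have := S.x_lt i
  rw [Pi.zero_apply]
  rcases Nat.eq_zero_or_pos (S.x i) with h | h
  · simp [h]
  · rw [if_neg, mul_zero]
    rintro ⟨rfl, h2⟩
    omega

theorem rowLower_mulVec_col (l : ℕ) : S.rowLower *ᵥ S.col l =
    fun i => S.x i * S.m (S.s i) (S.x i - 1 + l) :=
  S.rowLower_mulVec fun u y => S.m u (y + l)

theorem row_vecMul_colShift (t : Bool) (l : ℕ) : S.row t l ᵥ* colShift R n =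
    S.row t (l + 1) - S.m t (S.k t + l + n) • unitCol R n 0 := by
  refine (vecMul_colShift fun j => S.m t (S.k t + l + j)).trans (funext fun j => ?_)
  simp only [Pi.sub_apply, Pi.smul_apply, smul_eq_mul, row]
  congr 2; omega

theorem row_vecMul_colLower (t : Bool) (l : ℕ) : S.row t l ᵥ* colLower R n =
    fun j : Fin n => (j : R) * S.m t (S.k t + l + (j - 1)) :=
  vecMul_colLower fun j => S.m t (S.k t + l + j)

theorem unitCol_vecMul_colShift {K : Type*} [CommRing K] {n : ℕ} (l : ℕ) :
    unitCol K n l ᵥ* colShift K n = unitCol K n (l + 1) := by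
  refine (vecMul_colShift fun j => if j + 1 + l = n then (1 : K) else 0).trans (funext fun j => ?_)
  rw [if_neg (show ¬ n + 1 + l = n by omega), zero_mul, sub_zero, unitCol]
  exact if_congr (by omega) rfl rfl

theorem unitCol_vecMul_colLower {K : Type*} [CommRing K] {n : ℕ} :
    unitCol K n 0 ᵥ* colLower K n = 0 := by
  refine (vecMul_colLower fun j => if j + 1 + 0 = n then (1 : K) else 0).trans (funext fun j => ?_)
  have := j.2
  rcases Nat.eq_zero_or_pos (j : ℕ) with h | h
  · simp [h]
  · rw [if_neg (by omega), mul_zero]; rfl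

theorem derivation_unitCol (δ : Derivation ℝ R R) (l : ℕ) : δ ∘ unitCol R n l = 0 := by
  ext j
  simp only [unitCol, Function.comp_apply, Pi.zero_apply]
  split_ifs <;> simp

theorem derivation_unitRow (δ : Derivation ℝ R R) (t : Bool) (l : ℕ) : δ ∘ S.unitRow t l = 0 := by
  ext j
  simp only [unitRow, Function.comp_apply, Pi.zero_apply]
  split_ifs <;> simp

theorem H_mul_colShift_apply (i j : Fin n) : (S.H * colShift R n) i j =
    S.col (j + 1) i - S.col n i * unitCol R n 0 j :=
  congrFun (vecMul_colShift fun j => S.m (S.s i) (S.x i + j)) j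

theorem H_mul_colLower_apply (i j : Fin n) : (S.H * colLower R n) i j =
    j * S.m (S.s i) (S.x i + (j - 1)) :=
  congrFun (vecMul_colLower fun j => S.m (S.s i) (S.x i + j)) j

theorem mul_H_apply (P : Matrix (Fin n) (Fin n) R) (i j : Fin n) :
    (P * S.H) i j = (P *ᵥ S.col j) i := rfl

/-- The raised index is produced by the shift of columns; the defect is the column that enters at
the right edge. -/
theorem D_H : S.H.map S.D = (S.rowLower + diagonal fun i => S.par (S.s i)) * S.H +
    S.H * (colLower R n - colShift R n) - vecMulVec (S.col n) (unitCol R n 0) := by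
  ext i j
  simp only [add_mul, mul_sub, Matrix.add_apply, Matrix.sub_apply, H_mul_colShift_apply,
    H_mul_colLower_apply, vecMulVec_apply, diagonal_mul, map_apply]
  rw [mul_H_apply, rowLower_mulVec_col, H, of_apply, D_moment]
  simp only [col, ← add_assoc]
  rcases Nat.eq_zero_or_pos (S.x i) with hx | hx <;> rcases Nat.eq_zero_or_pos (j : ℕ) with hj | hj
  · simp [hx, hj]; ring
  · simp [hx]; ring
  · simp [hj]; ring
  · rw [show S.x i - 1 + (j : ℕ) = S.x i + j - 1 by omega,
      show S.x i + ((j : ℕ) - 1) = S.x i + j - 1 by omega]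
    push_cast; ring

/-- Only the rows with parameter `α` have their index raised, and the shift is made by rows; the
defect is the new row of that weight. -/
theorem A_H : S.H.map S.A = S.rowShift true * S.H + S.H * 0 -
    vecMulVec (-S.unitRow true 0) (S.row true 0) := by
  ext i j
  simp only [mul_zero, Matrix.add_apply, Matrix.sub_apply, vecMulVec_apply, map_apply, Matrix.zero_apply]
  rw [mul_H_apply, rowShift_mulVec_col, H, of_apply]
  simp only [Pi.sub_apply, Pi.neg_apply, Pi.smul_apply, smul_eq_mul, row, add_zero]
  have : S.A (S.m (S.s i) (S.x i + j)) = if S.s i = true then S.col (j + 1) i else 0 := by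
    rcases h : S.s i
    · simp [A_false]
    · simp [A_true, col, h, add_assoc]
  rw [this]
  ring

/-- `D` raises the index in all rows with sign minus, and `A` cancels this in the rows with
parameter `α`. So `A + D` plays for the weight `false` the role that `A` plays for `true`, with the
opposite sign. -/
theorem A_add_D_H : S.H.map (S.A + S.D) =
    (S.rowLower + (diagonal fun i => S.par (S.s i)) - S.rowShift false) * S.H +
    S.H * colLower R n - vecMulVec (S.unitRow false 0) (S.row false 0) := by
  have h1 : S.H.map (S.A + S.D) = S.H.map S.A + S.H.map S.D := by
    ext i j; simp
  rw [h1, A_H, D_H]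
  ext i j
  simp only [add_mul, sub_mul, mul_sub, mul_zero, Matrix.add_apply, Matrix.sub_apply,
    H_mul_colShift_apply, vecMulVec_apply, Matrix.zero_apply]
  rw [mul_H_apply (P := S.rowShift true), mul_H_apply (P := S.rowShift false), rowShift_mulVec_col,
    rowShift_mulVec_col]
  simp only [Pi.sub_apply, Pi.neg_apply, Pi.smul_apply, smul_eq_mul, row, add_zero]
  rcases h : S.s i <;> simp only [if_true, if_false, Bool.false_eq_true, Bool.true_eq_false] <;> ring

/-- Subtracting `α A` removes the parameter, so both weights obey the same rule and the index is
raised by 2. -/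
theorem D₀_sub_A_m (t : Bool) (j : ℕ) : (S.D₀ - S.α • S.A) (S.m t j) =
    (j + 1) * S.m t j - S.m t (j + 2) := by
  rw [Derivation.sub_apply, Derivation.smul_apply, D₀_m, smul_eq_mul]
  rcases t
  · simp [A_false]
  · simp only [A_true, if_true]
    ring

theorem D₀_sub_A_H : S.H.map (S.D₀ - S.α • S.A) = (diagonal fun i => (S.x i : R)) * S.H +
    S.H * ((diagonal fun j : Fin n => ((j : ℕ) : R) + 1) - colShift R n * colShift R n) -
      (vecMulVec (S.col n) (unitCol R n 1) + vecMulVec (S.col (n + 1)) (unitCol R n 0)) := by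
  have h1 : ∀ i j, (S.H * (colShift R n * colShift R n)) i j = S.col (j + 2) i -
      S.col (n + 1) i * unitCol R n 0 j - S.col n i * unitCol R n 1 j := by
    intro i j
    have e1 : S.H * (colShift R n * colShift R n) =
        (of fun i (j : Fin n) => S.m (S.s i) (S.x i + 1 + j)) * colShift R n -
          vecMulVec (S.col n) (unitCol R n 0) * colShift R n := by
      rw [← mul_assoc, ← sub_mul]
      congr 1
      ext i j
      rw [H_mul_colShift_apply, Matrix.sub_apply, vecMulVec_apply, of_apply, col]
      congr 2; omega
    rw [e1, Matrix.sub_apply, vecMulVec_mul, unitCol_vecMul_colShift, vecMulVec_apply]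
    congr 1
    refine (congrFun (vecMul_colShift fun j => S.m (S.s i) (S.x i + 1 + j)) j).trans ?_
    simp only [col]
    congr 2
    · omega
    · congr 1; omega
  ext i j
  simp only [mul_sub, Matrix.add_apply, Matrix.sub_apply, h1, vecMulVec_apply, diagonal_mul,
    mul_diagonal, map_apply]
  rw [H, of_apply, D₀_sub_A_m]
  simp only [col, add_assoc]
  push_cast
  ring

end MomentSystem

/-! ### Quantities with one row or column added or removed, and their derivatives -/

namespace MomentSystem

variable {R : Type*} [CommRing R] [Algebra ℝ R] {n : ℕ} (S : MomentSystem R n)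

/-- For `t = true` this is the trace of `H⁻¹ A(H)`, that is, the logarithmic `A`-derivative of `det
H`. -/
def ψ (t : Bool) : R := S.bil (S.row t 0) (S.unitRow t 0)

def θ : R := S.bil (unitCol R n 0) (S.col n)

/-- Up to sign, the minor of `H` without the last row of weight `t` and the last column, over `det
H`; it is 0 if the weight has no rows. -/
def g (t : Bool) : R := S.bil (unitCol R n 0) (S.unitRow t 0)

/-- The variant of `g` with the preceding column. -/
def gCol (t : Bool) : R := S.bil (unitCol R n 1) (S.unitRow t 0)

/-- The variant of `g` with the preceding row. -/
def gRow (t : Bool) : R := S.bil (unitCol R n 0) (S.unitRow t 1)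

/-- The Schur complement: the determinant of `H` enlarged by the next row of weight `t` and the next
column, over `det H`. -/
def h (t : Bool) : R := S.m t (S.k t + n) - S.bil (S.row t 0) (S.col n)

/-- The variant of `h` with the next column. -/
def hCol (t : Bool) : R := S.m t (S.k t + n + 1) - S.bil (S.row t 0) (S.col (n + 1))

/-- The variant of `h` with the next row. -/
def hRow (t : Bool) : R := S.m t (S.k t + n + 1) - S.bil (S.row t 1) (S.col n)

/-- The factor `k t` covers the case of no rows, where the unit vector is zero and `k t - 1` is
truncated. -/
theorem k_mul_unitRow_dotProduct (t : Bool) (F : Bool → ℕ → R) :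
    S.k t * (S.unitRow t 0 ⬝ᵥ fun i => F (S.s i) (S.x i)) = S.k t * F t (S.k t - 1) := by
  rcases Nat.eq_zero_or_pos (S.k t) with h | h
  · simp [h]
  · congr 1
    obtain ⟨i, hi, hi'⟩ := S.exists_row t (S.k t - 1) (by omega)
    rw [dotProduct, Finset.sum_eq_single i, unitRow, if_pos ⟨hi, by omega⟩, one_mul, hi, hi']
    · intro j _ hj
      rw [unitRow, if_neg, zero_mul]
      exact fun h' => hj (S.row_inj _ _ (h'.1.trans hi.symm) (by omega))
    · simp

theorem mul_dotProduct_unitCol {K : Type*} [CommRing K] {n : ℕ} (f : ℕ → K) :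
    (n : K) * ((fun j : Fin n => f j) ⬝ᵥ unitCol K n 0) = n * f (n - 1) := by
  rcases Nat.eq_zero_or_pos n with h | h
  · simp [h]
  · congr 1
    rw [dotProduct, Finset.sum_eq_single ⟨n - 1, by omega⟩, unitCol, if_pos (by dsimp only; omega), mul_one]
    · intro j _ hj
      rw [unitCol, if_neg, mul_zero]
      exact fun h' => hj (Fin.ext (by dsimp only; omega))
    · simp

theorem k_mul_unitRow_dotProduct_unitRow (t : Bool) :
    S.k t * (S.unitRow t 0 ⬝ᵥ S.unitRow t 0) = S.k t := by
  refine (S.k_mul_unitRow_dotProduct t fun u y => if u = t ∧ y + 1 + 0 = S.k t then 1 else 0).trans ?_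
  rcases Nat.eq_zero_or_pos (S.k t) with h | h
  · simp [h]
  · rw [if_pos ⟨rfl, by omega⟩, mul_one]

theorem k_mul_unitRow_dotProduct_col (t : Bool) (l : ℕ) :
    S.k t * (S.unitRow t 0 ⬝ᵥ S.col l) = S.k t * S.m t (S.k t - 1 + l) :=
  S.k_mul_unitRow_dotProduct t fun u y => S.m u (y + l)

theorem mul_row_dotProduct_unitCol (t : Bool) (l : ℕ) :
    (n : R) * (S.row t l ⬝ᵥ unitCol R n 0) = n * S.m t (S.k t + l + (n - 1)) :=
  mul_dotProduct_unitCol fun j => S.m t (S.k t + l + j)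

theorem mul_H_mulVec_unitCol (i : Fin n) :
    (n : R) * (S.H *ᵥ unitCol R n 0) i = n * S.m (S.s i) (S.x i + (n - 1)) :=
  mul_dotProduct_unitCol fun j => S.m (S.s i) (S.x i + j)

theorem k_mul_unitRow_vecMul_H (t : Bool) (j : Fin n) :
    S.k t * (S.unitRow t 0 ᵥ* S.H) j = S.k t * S.m t (S.k t - 1 + j) :=
  S.k_mul_unitRow_dotProduct_col t j

/-! ### The derivation `D` -/

theorem D_bil (ρ c : Fin n → R) : S.D (S.bil ρ c) =
    S.bil (S.D ∘ ρ - ρ ᵥ* (colLower R n - colShift R n)) c +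
    S.bil ρ (S.D ∘ c - (S.rowLower + diagonal fun i => S.par (S.s i)) *ᵥ c) +
      S.bil ρ (S.col n) * S.bil (unitCol R n 0) c := by
  rw [S.derivation_bil S.D S.D_H, bil_vecMulVec]

theorem D_row (t : Bool) : S.D ∘ S.row t 0 - S.row t 0 ᵥ* (colLower R n - colShift R n) =
    (S.k t : R) • (S.unitRow t 0 ᵥ* S.H) + S.par t • S.row t 0 -
      S.m t (S.k t + n) • unitCol R n 0 := by
  rw [vecMul_sub, row_vecMul_colShift, row_vecMul_colLower]
  ext j
  simp only [Pi.sub_apply, Pi.add_apply, Pi.smul_apply, smul_eq_mul, Function.comp_apply,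
    k_mul_unitRow_vecMul_H, row, D_moment, add_zero]
  rcases Nat.eq_zero_or_pos (S.k t) with hk | hk <;> rcases Nat.eq_zero_or_pos (j : ℕ) with hj | hj
  · simp [hk, hj]
  · simp [hk]; ring_nf
  · simp [hj]
  · rw [show S.k t - 1 + (j : ℕ) = S.k t + j - 1 by omega,
      show S.k t + ((j : ℕ) - 1) = S.k t + j - 1 by omega, show S.k t + 1 + (j : ℕ) = S.k t + j + 1 by omega]
    push_cast; ring

theorem D_unitCol : S.D ∘ unitCol R n 0 - unitCol R n 0 ᵥ* (colLower R n - colShift R n) =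
    unitCol R n 1 := by
  rw [derivation_unitCol, vecMul_sub, unitCol_vecMul_colShift, unitCol_vecMul_colLower]
  simp

theorem diagonal_mulVec_unitRow (t : Bool) (F : Fin n → R) (a : R)
    (hF : ∀ i, S.s i = t → S.x i + 1 = S.k t → F i = a) :
    diagonal F *ᵥ S.unitRow t 0 = a • S.unitRow t 0 := by
  ext i
  rw [mulVec_diagonal, Pi.smul_apply, smul_eq_mul, unitRow]
  split_ifs with h
  · rw [hF i h.1 h.2]
  · simp

theorem D_unitRow (t : Bool) :
    S.D ∘ S.unitRow t 0 - (S.rowLower + diagonal fun i => S.par (S.s i)) *ᵥ S.unitRow t 0 =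
      (-S.par t) • S.unitRow t 0 := by
  rw [derivation_unitRow, add_mulVec, rowLower_mulVec_unitRow,
    diagonal_mulVec_unitRow _ _ _ (S.par t) fun i hi _ => by rw [hi]]
  simp

theorem D_col : S.D ∘ S.col n - (S.rowLower + diagonal fun i => S.par (S.s i)) *ᵥ S.col n =
      (n : R) • (S.H *ᵥ unitCol R n 0) - S.col (n + 1) := by
  rw [add_mulVec, rowLower_mulVec_col]
  ext i
  have hn := i.pos
  simp only [Pi.sub_apply, Pi.add_apply, Pi.smul_apply, smul_eq_mul, Function.comp_apply,
    mul_H_mulVec_unitCol, col, D_moment, mulVec_diagonal]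
  rw [show S.x i + (n - 1) = S.x i + n - 1 by omega]
  rcases Nat.eq_zero_or_pos (S.x i) with hx | hx
  · simp [hx]; ring
  · rw [show S.x i - 1 + n = S.x i + n - 1 by omega]
    push_cast; ring_nf

/-- This is the source of `F^± = -g h`: applying `D` to a first logarithmic derivative of `det H`
yields a product of an enlarged and a reduced determinant. -/
theorem D_ψ (t : Bool) : S.D (S.ψ t) = S.k t - S.h t * S.g t := by
  rw [ψ, D_bil, D_row, D_unitRow, bil_sub_left, bil_add_left, bil_smul_left, bil_smul_left,
    bil_smul_left, bil_vecMul_H, bil_smul_right, k_mul_unitRow_dotProduct_unitRow, h, g]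
  ring

theorem D_g (t : Bool) : S.D (S.g t) = -(S.par t * S.g t) + S.gCol t + S.θ * S.g t := by
  rw [g, D_bil, D_unitCol, D_unitRow, bil_smul_right, gCol, θ]
  ring

theorem D_h (t : Bool) : S.D (S.h t) = S.par t * S.h t - S.hCol t + S.h t * S.θ := by
  have e : S.k t * S.m t (S.k t - 1 + n) + n * S.m t (S.k t + 0 + (n - 1)) =
      (S.k t + n : ℕ) * S.m t (S.k t + n - 1) := by
    rcases Nat.eq_zero_or_pos (S.k t) with hk | hk <;> rcases Nat.eq_zero_or_pos n with hj | hj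
    · simp [hk, hj]
    · simp [hk]
    · simp [hj]
    · rw [show S.k t - 1 + n = S.k t + n - 1 by omega, show S.k t + 0 + (n - 1) = S.k t + n - 1 by omega]
      push_cast; ring
  rw [h, map_sub, D_bil, D_row, D_col, bil_sub_left, bil_add_left, bil_smul_left, bil_smul_left,
    bil_smul_left, bil_vecMul_H, bil_sub_right, bil_smul_right, bil_H_mulVec, D_moment, hCol, θ,
    k_mul_unitRow_dotProduct_col, mul_row_dotProduct_unitCol, ← e]
  ring

/-! ### The derivation `A` -/

theorem A_bil (ρ c : Fin n → R) : S.A (S.bil ρ c) =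
    S.bil (S.A ∘ ρ) c + S.bil ρ (S.A ∘ c - S.rowShift true *ᵥ c) -
      S.bil ρ (S.unitRow true 0) * S.bil (S.row true 0) c := by
  rw [S.derivation_bil S.A S.A_H, bil_vecMulVec, vecMul_zero, sub_zero, ← neg_one_smul R (S.unitRow true 0),
    bil_smul_right]
  ring

theorem A_row : S.A ∘ S.row true 0 = S.row true 1 := by
  ext j
  simp only [Function.comp_apply, row, A_true, add_zero]
  congr 1; omega

theorem A_col (l : ℕ) : S.A ∘ S.col l - S.rowShift true *ᵥ S.col l =
    S.m true (S.k true + l) • S.unitRow true 0 := by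
  rw [rowShift_mulVec_col]
  ext i
  simp only [Pi.sub_apply, Pi.smul_apply, Function.comp_apply, col]
  rcases hs : S.s i
  · simp [A_false]
  · simp [A_true, add_assoc]

theorem A_g : S.A (S.g true) = -S.gRow true - S.g true * S.ψ true := by
  rw [g, A_bil, derivation_unitCol, derivation_unitRow, rowShift_mulVec_unitRow, bil_zero_left,
    zero_sub, ← neg_one_smul R (S.unitRow true (0 + 1)), bil_smul_right, gRow, ψ]
  ring

theorem A_h : S.A (S.h true) = S.hRow true - S.h true * S.ψ true := by
  rw [h, map_sub, A_bil, A_row, A_col, bil_smul_right, A_true, hRow, ψ]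
  ring

/-! ### The derivation `A + D` -/

theorem A_add_D_bil (ρ c : Fin n → R) : (S.A + S.D) (S.bil ρ c) =
    S.bil ((S.A + S.D) ∘ ρ - ρ ᵥ* colLower R n) c + S.bil ρ ((S.A + S.D) ∘ c -
      (S.rowLower + (diagonal fun i => S.par (S.s i)) - S.rowShift false) *ᵥ c) +
      S.bil ρ (S.unitRow false 0) * S.bil (S.row false 0) c := by
  rw [S.derivation_bil (S.A + S.D) S.A_add_D_H, bil_vecMulVec]

theorem A_row_false (l : ℕ) : S.A ∘ S.row false l = 0 :=
  funext fun _ => S.A_false _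

theorem A_add_D_row : (S.A + S.D) ∘ S.row false 0 - S.row false 0 ᵥ* colLower R n =
    (S.k false : R) • (S.unitRow false 0 ᵥ* S.H) - S.row false 1 := by
  have h1 : (S.A + S.D) ∘ S.row false 0 = S.A ∘ S.row false 0 + S.D ∘ S.row false 0 := rfl
  have h2 := S.D_row false
  rw [vecMul_sub, row_vecMul_colShift, sub_sub_eq_add_sub, sub_eq_iff_eq_add] at h2
  have h3 : S.par false = 0 := rfl
  rw [h1, A_row_false, zero_add, ← sub_eq_zero, ← sub_eq_zero.2 h2, h3]
  ext j
  simp only [Pi.sub_apply, Pi.add_apply, Pi.smul_apply, smul_eq_mul, add_zero]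
  ring

theorem A_add_D_col : (S.A + S.D) ∘ S.col n -
    (S.rowLower + (diagonal fun i => S.par (S.s i)) - S.rowShift false) *ᵥ S.col n =
      (n : R) • (S.H *ᵥ unitCol R n 0) - S.m false (S.k false + n) • S.unitRow false 0 := by
  have h1 : (S.A + S.D) ∘ S.col n = S.A ∘ S.col n + S.D ∘ S.col n := rfl
  have h2 := S.D_col
  have h3 := S.A_col n
  rw [sub_eq_iff_eq_add] at h2 h3
  rw [h1, h2, h3, sub_mulVec, rowShift_mulVec_col, rowShift_mulVec_col]
  ext i
  simp only [Pi.sub_apply, Pi.add_apply, Pi.smul_apply, smul_eq_mul]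
  rcases hs : S.s i <;> simp <;> ring

theorem A_add_D_g : (S.A + S.D) (S.g false) = S.gRow false + S.g false * S.ψ false := by
  have h1 : (S.A + S.D) ∘ S.unitRow false 0 = 0 := S.derivation_unitRow (S.A + S.D) _ _
  have h2 : (S.A + S.D) ∘ unitCol R n 0 = 0 := derivation_unitCol (S.A + S.D) _
  have h3 : S.par false = 0 := rfl
  rw [g, A_add_D_bil, h1, h2, unitCol_vecMul_colLower, sub_mulVec, add_mulVec, rowLower_mulVec_unitRow,
    rowShift_mulVec_unitRow, diagonal_mulVec_unitRow _ _ _ (S.par false) fun i hi _ => by rw [hi]]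
  simp [h3, bil_zero_left, gRow, ψ]

theorem A_add_D_h : (S.A + S.D) (S.h false) = -S.hRow false + S.h false * S.ψ false := by
  have e : S.k false * S.m false (S.k false - 1 + n) + n * S.m false (S.k false + 0 + (n - 1)) =
      (S.k false + n : ℕ) * S.m false (S.k false + n - 1) := by
    rcases Nat.eq_zero_or_pos (S.k false) with hk | hk <;> rcases Nat.eq_zero_or_pos n with hj | hj
    · simp [hk, hj]
    · simp [hk]
    · simp [hj]
    · rw [show S.k false - 1 + n = S.k false + n - 1 by omega,
        show S.k false + 0 + (n - 1) = S.k false + n - 1 by omega]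
      push_cast; ring
  have h3 : (S.A + S.D) (S.m false (S.k false + n)) =
      (S.k false + n : ℕ) * S.m false (S.k false + n - 1) - S.m false (S.k false + n + 1) := by
    rw [Derivation.add_apply, A_false, D_m]; simp
  rw [h, map_sub, A_add_D_bil, A_add_D_row, A_add_D_col, h3, bil_sub_left, bil_smul_left, bil_vecMul_H,
    bil_sub_right, bil_smul_right, bil_smul_right, bil_H_mulVec, hRow, ψ,
    k_mul_unitRow_dotProduct_col, mul_row_dotProduct_unitCol, ← e]
  ring

/-! ### The derivation `D₀ - α A` -/

theorem D₀_sub_A_bil (ρ c : Fin n → R) : (S.D₀ - S.α • S.A) (S.bil ρ c) =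
    S.bil ((S.D₀ - S.α • S.A) ∘ ρ - ρ ᵥ* ((diagonal fun j : Fin n => ((j : ℕ) : R) + 1) -
      colShift R n * colShift R n)) c +
    S.bil ρ ((S.D₀ - S.α • S.A) ∘ c - (diagonal fun i => (S.x i : R)) *ᵥ c) +
      (S.bil ρ (S.col n) * S.bil (unitCol R n 1) c +
        S.bil ρ (S.col (n + 1)) * S.bil (unitCol R n 0) c) := by
  rw [S.derivation_bil _ S.D₀_sub_A_H, add_mulVec, bil_add_right, bil_vecMulVec, bil_vecMulVec]

theorem D₀_sub_A_row (t : Bool) : (S.D₀ - S.α • S.A) ∘ S.row t 0 -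
    S.row t 0 ᵥ* ((diagonal fun j : Fin n => ((j : ℕ) : R) + 1) - colShift R n * colShift R n) =
      (S.k t : R) • S.row t 0 - S.m t (S.k t + n) • unitCol R n 1 -
        S.m t (S.k t + n + 1) • unitCol R n 0 := by
  rw [vecMul_sub, ← vecMul_vecMul, row_vecMul_colShift, sub_vecMul, smul_vecMul, row_vecMul_colShift,
    unitCol_vecMul_colShift]
  ext j
  simp only [Pi.sub_apply, Pi.smul_apply, smul_eq_mul, Function.comp_apply, row, D₀_sub_A_m,
    vecMul_diagonal]
  rw [show S.k t + 0 + (j : ℕ) + 2 = S.k t + (0 + 1 + 1) + j by omega,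
    show S.k t + (0 + 1) + n = S.k t + n + 1 by omega]
  simp only [add_zero]
  push_cast
  ring

/-- The index rises by 2, so the defect has rank two, and each half combines one of `g`, `h` with
the variant of the other for the neighbouring column. -/
theorem D₀_sub_A_ψ (t : Bool) : (S.D₀ - S.α • S.A) (S.ψ t) =
    S.ψ t - (S.h t * S.gCol t + S.hCol t * S.g t) := by
  have h1 : (S.D₀ - S.α • S.A) ∘ S.unitRow t 0 - (diagonal fun i => (S.x i : R)) *ᵥ S.unitRow t 0 =
      (1 - (S.k t : R)) • S.unitRow t 0 := by
    have h2 : (S.D₀ - S.α • S.A) ∘ S.unitRow t 0 = 0 := S.derivation_unitRow _ _ _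
    rw [h2, diagonal_mulVec_unitRow _ _ _ (S.k t - 1 : R) fun i _ hi => by rw [← hi]; simp]
    rw [zero_sub, ← neg_smul, neg_sub]
  rw [ψ, D₀_sub_A_bil, D₀_sub_A_row, h1, bil_smul_right, bil_sub_left, bil_sub_left, bil_smul_left,
    bil_smul_left, bil_smul_left, h, hCol, g, gCol]
  ring

end MomentSystem

namespace MomentSystem

variable {R : Type*} [CommRing R] [Algebra ℝ R] {n : ℕ} (S : MomentSystem R n)

/-! ### The sums over the two weights -/

/-- The moment matrix with the index of the moments raised by `l`. -/
def shiftH (l : ℕ) : Matrix (Fin n) (Fin n) R := of fun i (j : Fin n) => S.m (S.s i) (S.x i + l + j)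

theorem shiftH_zero : S.shiftH 0 = S.H := rfl

/-- This and the next lemma raise the index by columns and by rows. Comparing the two results gives
the relations between the two weights. -/
theorem shiftH_succ_eq_mul_colShift (l : ℕ) : S.shiftH (l + 1) =
    S.shiftH l * colShift R n + vecMulVec (S.col (n + l)) (unitCol R n 0) := by
  ext i j
  have h1 : (S.shiftH l * colShift R n) i j = S.m (S.s i) (S.x i + l + (j + 1)) -
      S.m (S.s i) (S.x i + l + n) * unitCol R n 0 j :=
    congrFun (vecMul_colShift fun j => S.m (S.s i) (S.x i + l + j)) j
  rw [Matrix.add_apply, h1, vecMulVec_apply, shiftH, of_apply, col,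
    show S.x i + (n + l) = S.x i + l + n by omega, show S.x i + (l + 1) + (j : ℕ) = S.x i + l + (j + 1) by omega]
  ring

theorem shiftH_succ_eq_rowShift_mul (l : ℕ) : S.shiftH (l + 1) =
    (S.rowShift true + S.rowShift false) * S.shiftH l +
      (vecMulVec (S.unitRow true 0) (S.row true l) + vecMulVec (S.unitRow false 0) (S.row false l)) := by
  ext i j
  have h1 : (fun i => S.shiftH l i j) = S.col (l + j) :=
    funext fun i => congrArg (S.m _) (add_assoc _ _ _)
  have h2 : ∀ t, (S.rowShift t * S.shiftH l) i j = (S.rowShift t *ᵥ S.col (l + j)) i := by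
    intro t
    rw [← h1]; rfl
  simp only [add_mul, Matrix.add_apply, h2, rowShift_mulVec_col, vecMulVec_apply, Pi.sub_apply,
    Pi.smul_apply, smul_eq_mul, row]
  have h3 : S.shiftH (l + 1) i j = S.col (l + j + 1) i := by
    rw [shiftH, of_apply, col]; congr 1; omega
  rw [h3]
  simp only [← add_assoc]
  rcases hs : S.s i <;> simp <;> ring

theorem bil_shiftH_one_mulVec (ρ c : Fin n → R) : S.bil ρ (S.shiftH 1 *ᵥ (S.H⁻¹ *ᵥ c)) =
    S.bil (ρ ᵥ* colShift R n) c + S.bil ρ (S.col n) * S.bil (unitCol R n 0) c := by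
  rw [S.shiftH_succ_eq_mul_colShift 0, shiftH_zero, add_mulVec, bil_add_right, bil_vecMulVec, add_zero,
    ← mulVec_mulVec, bil_H_mulVec, dotProduct_mulVec]
  rfl

theorem bil_shiftH_two_mulVec (ρ c : Fin n → R) : S.bil ρ (S.shiftH 2 *ᵥ (S.H⁻¹ *ᵥ c)) =
    S.bil (ρ ᵥ* colShift R n ᵥ* colShift R n) c + S.bil ρ (S.col n) * S.bil (unitCol R n 1) c +
      S.bil ρ (S.col (n + 1)) * S.bil (unitCol R n 0) c := by
  rw [S.shiftH_succ_eq_mul_colShift 1, S.shiftH_succ_eq_mul_colShift 0, shiftH_zero, add_mulVec,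
    bil_add_right, bil_vecMulVec, add_mul, vecMulVec_mul, unitCol_vecMul_colShift, add_mulVec,
    bil_add_right, bil_vecMulVec, add_zero, mul_assoc, ← mulVec_mulVec, bil_H_mulVec, dotProduct_mulVec,
    ← vecMul_vecMul]
  rfl

theorem rowShift_mulVec_unitRow_add (t : Bool) :
    (S.rowShift true + S.rowShift false) *ᵥ S.unitRow t 0 = S.unitRow t 1 := by
  rw [add_mulVec]
  rcases t
  · rw [S.rowShift_mulVec_unitRow_of_ne (Bool.false_ne_true.symm), rowShift_mulVec_unitRow, zero_add]
  · rw [S.rowShift_mulVec_unitRow_of_ne (Bool.false_ne_true), rowShift_mulVec_unitRow, add_zero]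

theorem rowShift_mulVec_col_add (l : ℕ) : (S.rowShift true + S.rowShift false) *ᵥ S.col l =
    S.col (l + 1) - (S.m true (S.k true + l) • S.unitRow true 0 +
      S.m false (S.k false + l) • S.unitRow false 0) := by
  rw [add_mulVec, rowShift_mulVec_col, rowShift_mulVec_col]
  ext i
  simp only [Pi.sub_apply, Pi.add_apply, Pi.smul_apply, smul_eq_mul]
  rcases hs : S.s i <;> simp <;> ring

theorem shiftH_succ_mulVec (l : ℕ) (c : Fin n → R) : S.shiftH (l + 1) *ᵥ (S.H⁻¹ *ᵥ c) =
    (S.rowShift true + S.rowShift false) *ᵥ (S.shiftH l *ᵥ (S.H⁻¹ *ᵥ c)) +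
      (S.bil (S.row true l) c • S.unitRow true 0 + S.bil (S.row false l) c • S.unitRow false 0) := by
  rw [shiftH_succ_eq_rowShift_mul, add_mulVec, add_mulVec (vecMulVec _ _), vecMulVec_mulVec_inv,
    vecMulVec_mulVec_inv, ← mulVec_mulVec]

theorem H_mulVec_inv_mulVec (c : Fin n → R) : S.H *ᵥ (S.H⁻¹ *ᵥ c) = c := by
  rw [mulVec_mulVec, H_mul_inv, one_mulVec]

/-- Row `i` of `shiftH 1` is the next row of the same weight. If that is a row of `H`, it applies to
`H⁻¹ col n` without error; at the last row of each weight the error is `h`. -/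
theorem sum_h_smul_unitRow : S.h true • S.unitRow true 0 + S.h false • S.unitRow false 0 =
    S.col (n + 1) - S.shiftH 1 *ᵥ (S.H⁻¹ *ᵥ S.col n) := by
  rw [shiftH_succ_mulVec, shiftH_zero, H_mulVec_inv_mulVec, rowShift_mulVec_col_add]
  simp only [h, sub_smul]
  abel

theorem sum_hCol_smul_unitRow : S.hCol true • S.unitRow true 0 + S.hCol false • S.unitRow false 0 =
    S.col (n + 2) - S.shiftH 1 *ᵥ (S.H⁻¹ *ᵥ S.col (n + 1)) := by
  rw [shiftH_succ_mulVec, shiftH_zero, H_mulVec_inv_mulVec, rowShift_mulVec_col_add]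
  simp only [hCol, sub_smul, ← add_assoc]
  abel

/-- With index raised by 2 the last two rows of each weight are affected; the error `h` made at the
first shift is carried one row back by the second. -/
theorem sum_hRow_smul_unitRow : S.hRow true • S.unitRow true 0 + S.hRow false • S.unitRow false 0 +
    (S.h true • S.unitRow true 1 + S.h false • S.unitRow false 1) =
    S.col (n + 2) - S.shiftH 2 *ᵥ (S.H⁻¹ *ᵥ S.col n) := by
  have h1 : S.h true • S.unitRow true 1 + S.h false • S.unitRow false 1 =
      (S.rowShift true + S.rowShift false) *ᵥ
        (S.h true • S.unitRow true 0 + S.h false • S.unitRow false 0) := by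
    rw [mulVec_add, mulVec_smul, mulVec_smul, rowShift_mulVec_unitRow_add, rowShift_mulVec_unitRow_add]
  rw [h1, sum_h_smul_unitRow, mulVec_sub, rowShift_mulVec_col_add, S.shiftH_succ_mulVec 1]
  simp only [hRow, sub_smul, ← add_assoc]
  abel

def Y (t : Bool) : R := S.g t * S.hCol t + S.h t * S.gCol t

def Z (t : Bool) : R := S.g t * S.hRow t + S.h t * S.gRow t

/-- The three preceding identities paired with the unit vectors at the last two columns, the shifted
matrices now being evaluated by columns; all terms other than the `g`, `h` products cancel. -/
theorem sum_Z_eq_sum_Y : S.Z true + S.Z false = S.Y true + S.Y false := by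
  have e1 := congrArg (S.bil (unitCol R n 1)) S.sum_h_smul_unitRow
  have e2 := congrArg (S.bil (unitCol R n 0)) S.sum_hCol_smul_unitRow
  have e3 := congrArg (S.bil (unitCol R n 0)) S.sum_hRow_smul_unitRow
  simp only [bil_add_right, bil_sub_right, bil_smul_right, bil_shiftH_one_mulVec,
    bil_shiftH_two_mulVec, unitCol_vecMul_colShift] at e1 e2 e3
  simp only [Y, Z, g, gCol, gRow]
  linear_combination e3 - e2 - e1

/-! ### Traces -/

theorem trace_inv_mul_vecMulVec (u v : Fin n → R) : (S.H⁻¹ * vecMulVec u v).trace = S.bil v u := by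
  rw [trace_mul_comm, vecMulVec_mul, trace_vecMulVec, dotProduct_comm, ← dotProduct_mulVec]
  rfl

theorem trace_inv_mul_mul_H (P : Matrix (Fin n) (Fin n) R) : (S.H⁻¹ * (P * S.H)).trace = P.trace := by
  rw [← mul_assoc, trace_mul_comm, ← mul_assoc, H_mul_inv, one_mul]

theorem trace_inv_mul_H_mul (P : Matrix (Fin n) (Fin n) R) : (S.H⁻¹ * (S.H * P)).trace = P.trace := by
  rw [← mul_assoc, H_inv_mul, one_mul]

theorem trace_rowShift (t : Bool) : (S.rowShift t).trace = 0 :=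
  Finset.sum_eq_zero fun i _ => if_neg (by omega)

theorem trace_colShift {K : Type*} [CommRing K] {n : ℕ} : (colShift K n).trace = 0 :=
  Finset.sum_eq_zero fun i _ => if_neg (by omega)

theorem trace_colLower {K : Type*} [CommRing K] {n : ℕ} : (colLower K n).trace = 0 :=
  Finset.sum_eq_zero fun i _ => if_neg (by omega)

theorem trace_rowLower : (S.rowLower).trace = 0 :=
  Finset.sum_eq_zero fun i _ => if_neg (by omega)

theorem trace_inv_mul_A_H : (S.H⁻¹ * S.H.map S.A).trace = S.ψ true := by
  rw [A_H, mul_sub, mul_add, trace_sub, trace_add, trace_inv_mul_mul_H, trace_inv_mul_H_mul,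
    trace_inv_mul_vecMulVec, trace_rowShift, trace_zero, ← neg_one_smul R, bil_smul_right, ψ]
  ring

theorem trace_inv_mul_D_H : (S.H⁻¹ * S.H.map S.D).trace = ∑ i, S.par (S.s i) - S.θ := by
  rw [D_H, mul_sub, mul_add, trace_sub, trace_add, trace_inv_mul_mul_H, trace_inv_mul_H_mul,
    trace_inv_mul_vecMulVec, trace_add, trace_sub, trace_rowLower, trace_colLower, trace_colShift,
    trace_diagonal, θ]
  ring

/-- Both sides are the trace of `H⁻¹ (shiftH 1)`, computed by columns and by rows. -/
theorem θ_eq : S.θ = S.ψ true + S.ψ false := by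
  have h1 := congrArg (fun M => (S.H⁻¹ * M).trace) (S.shiftH_succ_eq_mul_colShift 0)
  have h2 := congrArg (fun M => (S.H⁻¹ * M).trace) (S.shiftH_succ_eq_rowShift_mul 0)
  simp only [shiftH_zero, mul_add, trace_add, trace_inv_mul_mul_H, trace_inv_mul_H_mul,
    trace_inv_mul_vecMulVec, trace_rowShift, trace_colShift, zero_add, add_zero] at h1 h2
  exact h1.symm.trans h2

end MomentSystem

/-! ### Wronskian identities and the equation -/

namespace MomentSystem

variable {R : Type*} [CommRing R] [Algebra ℝ R] {n : ℕ} (S : MomentSystem R n)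

/-- The Wronskian of two elements with respect to a derivation. -/
def wr (δ : Derivation ℝ R R) (f g : R) : R := δ f * g - f * δ g

theorem Z_true_eq : S.Z true = S.g true * S.A (S.h true) - S.h true * S.A (S.g true) := by
  rw [A_g, A_h, Z]; ring

theorem Z_false_eq : S.Z false =
    -(S.g false * (S.A + S.D) (S.h false) - S.h false * (S.A + S.D) (S.g false)) := by
  rw [A_add_D_g, A_add_D_h, Z]; ring

theorem Y_eq (t : Bool) : S.Y t =
    2 * S.par t * S.g t * S.h t - S.g t * S.D (S.h t) + S.h t * S.D (S.g t) := by
  rw [D_g, D_h, Y]; ring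

/-- Formally, with `u = log (h / g)`, `Z / gh = Au` and `Y / gh = 2α - Du`, hence `D(Z / gh) = 2 -
A(Y / gh)` because `A` and `D` commute. The polynomial form needs no invertibility of `g` and `h`.
-/
theorem D_Z_true : wr S.D (S.Z true) (S.g true * S.h true) =
    2 * (S.g true * S.h true) ^ 2 - wr S.A (S.Y true) (S.g true * S.h true) := by
  have h1 : S.par true = S.α := rfl
  have h2 : S.A 2 = 0 := S.A.map_natCast 2
  rw [Z_true_eq, Y_eq, h1]
  simp only [wr, map_sub, map_add, Derivation.leibniz, smul_eq_mul, comm, A_α, h2]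
  ring

/-- As for `true`, but with `Z / gh = -(A + D)u` and `Y / gh = -Du`, so that `D(Z / gh) = (A + D)(Y
/ gh)`. -/
theorem D_Z_false : wr S.D (S.Z false) (S.g false * S.h false) =
    wr S.A (S.Y false) (S.g false * S.h false) + wr S.D (S.Y false) (S.g false * S.h false) := by
  have h1 : S.par false = 0 := rfl
  rw [Z_false_eq, Y_eq, h1]
  simp only [wr, map_sub, map_add, map_neg, Derivation.leibniz, Derivation.add_apply, smul_eq_mul, comm,
    mul_zero, zero_mul, map_zero]
  ring

/-- The main identities: both `G`'s are Wronskians with one and the same function. -/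
theorem exists_wr_eq {β LA LD k₁ k₂ : R} (hβ : S.α * β = 1) (hk₁ : k₁ = S.k true) (hk₂ : k₂ = S.k false)
    (hLA : LA = S.ψ true - k₁ * k₂ * β - k₁ * S.α) (hLD : LD = k₁ * S.α - S.θ)
    {Fp Fm H1p H1m H2p H2m Gp Gm : R}
    (hFp : Fp = S.D LA - k₁) (hFm : Fm = -S.D (LD + LA) - k₂)
    (hH1p : H1p = 4 * LA + 4 * S.α * k₁ + 4 * k₁ * k₂ * β)
    (hH1m : H1m = -2 * (S.D₀ LA - S.α * S.A LA + LA) - 4 * k₁ * k₂ * β)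
    (hH2p : H2p = 2 * (S.D₀ LA - S.α * S.A LA - LA - 2 * S.α * S.D LA))
    (hH2m : H2m = -2 * (S.D₀ (LD + LA) - S.α * S.A (LD + LA) - (LD + LA)))
    (hGp : 2 * Gp = wr S.D H1p Fp - wr S.A H2p Fp) (hGm : 2 * Gm = wr S.D H1m Fm + wr S.A H2m Fm) :
    ∃ Ξ : R, wr S.D Ξ Fp = Gp ∧ wr S.D Ξ Fm = -Gm := by
  have hβ_of : ∀ δ : Derivation ℝ R R, δ β = -(β ^ 2 * δ S.α) := by
    intro δ
    have h1 := congrArg δ hβ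
    rw [Derivation.leibniz, Derivation.map_one_eq_zero, smul_eq_mul, smul_eq_mul] at h1
    linear_combination (-δ β) * hβ + β * h1
  have hAβ : S.A β = -β ^ 2 := by rw [hβ_of, A_α, mul_one]
  have hDβ : S.D β = 0 := by rw [hβ_of, D_α, mul_zero, neg_zero]
  have hD₀β : S.D₀ β = 0 := by rw [hβ_of, D₀_α, mul_zero, neg_zero]
  have hk₁' : ∀ δ : Derivation ℝ R R, δ k₁ = 0 := fun δ => hk₁ ▸ δ.map_natCast _
  have hk₂' : ∀ δ : Derivation ℝ R R, δ k₂ = 0 := fun δ => hk₂ ▸ δ.map_natCast _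
  -- Since `θ` is the sum of the two `ψ`, adding the derivative `D` to `A` exchanges the roles of
  -- the weights.
  have hsum : LD + LA = -S.ψ false - k₁ * k₂ * β := by rw [hLA, hLD, θ_eq]; ring
  have hψt := S.D₀_sub_A_ψ true
  have hψf := S.D₀_sub_A_ψ false
  rw [Derivation.sub_apply, Derivation.smul_apply, smul_eq_mul] at hψt hψf
  have hYt : S.h true * S.gCol true + S.hCol true * S.g true = S.Y true := by rw [Y]; ring
  have hYf : S.h false * S.gCol false + S.hCol false * S.g false = S.Y false := by rw [Y]; ring
  rw [hYt] at hψt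
  rw [hYf] at hψf
  have e1 : Fp = -(S.g true * S.h true) := by
    rw [hFp, hLA]
    simp only [map_sub, Derivation.leibniz, smul_eq_mul, D_ψ, hk₁', hk₂', hDβ, D_α, ← hk₁]
    ring
  have e2 : Fm = -(S.g false * S.h false) := by
    rw [hFm, hsum]
    simp only [map_sub, map_neg, Derivation.leibniz, smul_eq_mul, D_ψ, hk₁', hk₂', hDβ, ← hk₂]
    ring
  have e3 : H1p = 4 * S.ψ true := by rw [hH1p, hLA]; ring
  have e4 : H2p = 2 * (-S.Y true + 2 * S.α * (S.g true * S.h true)) := by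
    rw [hH2p, hLA]
    simp only [map_sub, Derivation.leibniz, smul_eq_mul, D_ψ, hk₁', hk₂', hDβ, D_α, hAβ, A_α, hD₀β,
      D₀_α, ← hk₁]
    linear_combination 2 * hψt - 2 * k₁ * k₂ * β * hβ
  have e5 : H1m = 2 * S.Y true - 4 * S.ψ true := by
    rw [hH1m, hLA]
    simp only [map_sub, Derivation.leibniz, smul_eq_mul, hk₁', hk₂', hAβ, A_α, hD₀β, D₀_α]
    linear_combination -2 * hψt + 2 * k₁ * k₂ * β * hβ
  have e6 : H2m = -2 * S.Y false := by
    rw [hH2m, hsum]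
    simp only [map_sub, map_neg, Derivation.leibniz, smul_eq_mul, hk₁', hk₂', hAβ, hD₀β]
    linear_combination 2 * hψf + 2 * k₁ * k₂ * β * hβ
  -- The ring is a real algebra, so 2 can be cancelled although there may be zero divisors.
  have two_inj : ∀ a b : R, 2 * a = 2 * b → a = b := by
    intro a b hab
    have h1 := congrArg (fun c => ((1 / 2 : ℝ)) • c) hab
    simpa [two_mul, ← two_smul ℝ, smul_smul] using h1
  have n2 : ∀ δ : Derivation ℝ R R, δ 2 = 0 := fun δ => δ.map_natCast 2
  have n4 : ∀ δ : Derivation ℝ R R, δ 4 = 0 := fun δ => δ.map_natCast 4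
  have hZt := S.D_Z_true
  have hZf := S.D_Z_false
  have hZ : S.Z true = S.Y true + S.Y false - S.Z false := by linear_combination S.sum_Z_eq_sum_Y
  have hDZ : S.D (S.Z true) = S.D (S.Y true) + S.D (S.Y false) - S.D (S.Z false) := by
    rw [hZ, map_sub, map_add]
  -- In `G⁺` the term with `H1⁺ = 4ψ` is already a `D`-Wronskian, and `D_Z_true` converts the
  -- `A`-Wronskian of `H2⁺` into one with `-Z true`. For `G⁻` the sum relation replaces `Z true` by
  -- `Y true + Y false - Z false`, and `D_Z_false` applies.
  refine ⟨2 * S.ψ true - S.Z true, two_inj _ _ ?_, two_inj _ _ ?_⟩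
  · rw [hGp, e1, e3, e4]
    simp only [wr, map_sub, map_add, map_neg, Derivation.leibniz, smul_eq_mul, A_α, n2, n4] at hZt ⊢
    linear_combination 2 * hZt
  · rw [mul_neg, hGm, e2, e5, e6]
    simp only [wr, map_sub, map_neg, Derivation.leibniz, smul_eq_mul, n2, n4] at hZf ⊢
    rw [hDZ, hZ]
    linear_combination (-2) * hZf

/-- Substitution gives `F⁺G⁻ + F⁻G⁺ = Ξ (F⁺ DF⁻ - F⁻ DF⁺)` and `F⁺ DG⁻ + F⁻ DG⁺ = Ξ (F⁺ D²F⁻ - F⁻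
D²F⁺)`, so both products in the equation are equal. -/
theorem pde_of_wr {D : Derivation ℝ R R} {Ξ Fp Fm Gp Gm : R} (hp : wr D Ξ Fp = Gp)
    (hm : wr D Ξ Fm = -Gm) :
    (Fp * D Gm + Fm * D Gp) * (Fp * D Fm - Fm * D Fp)
      - (Fp * Gm + Fm * Gp) * (Fp * D (D Fm) - Fm * D (D Fp)) = 0 := by
  have h1 : Gm = -wr D Ξ Fm := by rw [hm, neg_neg]
  rw [h1, ← hp]
  simp only [wr, map_sub, map_neg, Derivation.leibniz, smul_eq_mul]
  ring

end MomentSystem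

/-! ### Smoothness of the Gaussian moments -/

/-- For parameters within 1 of `a₀`, the exponential is at most one of its two extreme values
according to the sign of `z`; this is the dominating function for differentiation under the
integral. -/
theorem norm_pow_mul_gaussian_le (j : ℕ) {a a₀ : ℝ} (h : |a - a₀| ≤ 1) (z : ℝ) :
    ‖z ^ j * Real.exp (a * z - z ^ 2 / 2)‖ ≤
      ‖z ^ j * Real.exp ((a₀ + 1) * z - z ^ 2 / 2)‖ + ‖z ^ j * Real.exp ((a₀ - 1) * z - z ^ 2 / 2)‖ := by
  simp only [norm_mul, Real.norm_eq_abs, Real.abs_exp]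
  rw [← mul_add]
  gcongr
  obtain ⟨h1, h2⟩ := abs_le.1 h
  rcases le_total 0 z with hz | hz
  · refine le_add_of_le_of_nonneg (Real.exp_le_exp.2 ?_) (Real.exp_pos _).le
    nlinarith
  · refine le_add_of_nonneg_of_le (Real.exp_pos _).le (Real.exp_le_exp.2 ?_)
    nlinarith

theorem integrable_gaussian_bound (j : ℕ) (a₀ : ℝ) : Integrable fun z : ℝ =>
    ‖z ^ j * Real.exp ((a₀ + 1) * z - z ^ 2 / 2)‖ + ‖z ^ j * Real.exp ((a₀ - 1) * z - z ^ 2 / 2)‖ :=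
  (integrable_pow_mul_gaussian j _).norm.add (integrable_pow_mul_gaussian j _).norm

theorem hasDerivAt_gaussMoment (S : Set ℝ) (j : ℕ) (a : ℝ) :
    HasDerivAt (fun a => gaussMoment a S j) (gaussMoment a S (j + 1)) a := by
  refine (hasDerivAt_integral_of_dominated_loc_of_deriv_le (Metric.ball_mem_nhds a one_pos)
    (F := fun a z => z ^ j * Real.exp (a * z - z ^ 2 / 2))
    (F' := fun a z => z ^ (j + 1) * Real.exp (a * z - z ^ 2 / 2))
    (Filter.Eventually.of_forall fun x => (integrable_pow_mul_gaussian j x).1.restrict)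
    (integrable_pow_mul_gaussian j a).integrableOn
    (integrable_pow_mul_gaussian (j + 1) a).1.restrict
    (Filter.Eventually.of_forall fun z b hb => norm_pow_mul_gaussian_le (j + 1) (a₀ := a) ?_ z)
    (integrable_gaussian_bound (j + 1) a).integrableOn
    (Filter.Eventually.of_forall fun z b _ => ?_)).2
  · rw [Metric.mem_ball, Real.dist_eq] at hb
    exact hb.le
  · have h := (((hasDerivAt_id b).mul_const z).sub_const (z ^ 2 / 2)).exp.const_mul (z ^ j)
    convert! h using 1
    simp only [id]
    ring

theorem contDiff_gaussMoment (S : Set ℝ) (j : ℕ) : ContDiff ℝ (⊤ : ℕ∞) fun a => gaussMoment a S j := by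
  refine contDiff_infty.2 fun n => ?_
  induction n generalizing j with
  | zero =>
    exact contDiff_zero.2 (continuous_iff_continuousAt.2 fun a => (hasDerivAt_gaussMoment S j a).continuousAt)
  | succ n ih =>
    rw [Nat.cast_succ]
    refine contDiff_succ_iff_deriv.2 ⟨fun a => (hasDerivAt_gaussMoment S j a).differentiableAt, by simp, ?_⟩
    rw [funext fun a => (hasDerivAt_gaussMoment S j a).deriv]
    exact ih (j + 1)

/-- Dominated convergence: the indicator of the half-line is continuous in the endpoint at every `z`
other than the endpoint itself. -/
theorem continuous_gaussMoment_Iic (j : ℕ) :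
    Continuous fun p : ℝ × ℝ => gaussMoment p.1 (Set.Iic p.2) j := by
  refine continuous_iff_continuousAt.2 fun p => ?_
  have h : (fun p : ℝ × ℝ => gaussMoment p.1 (Set.Iic p.2) j) = fun p => ∫ z,
      (Set.Iic p.2).indicator (fun z => z ^ j * Real.exp (p.1 * z - z ^ 2 / 2)) z :=
    funext fun p => (integral_indicator measurableSet_Iic).symm
  rw [h]
  refine continuousAt_of_dominated (bound := fun z =>
    ‖z ^ j * Real.exp ((p.1 + 1) * z - z ^ 2 / 2)‖ + ‖z ^ j * Real.exp ((p.1 - 1) * z - z ^ 2 / 2)‖)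
    (Filter.Eventually.of_forall fun q =>
      (integrable_pow_mul_gaussian j q.1).1.indicator measurableSet_Iic) ?_
    (integrable_gaussian_bound j p.1) ?_
  · have h1 : ∀ᶠ q : ℝ × ℝ in nhds p, |q.1 - p.1| < 1 :=
      (isOpen_lt (f := fun q : ℝ × ℝ => |q.1 - p.1|) (by fun_prop) continuous_const).mem_nhds (by simp)
    filter_upwards [h1] with q hq
    refine Filter.Eventually.of_forall fun z => ?_
    exact (norm_indicator_le_norm_self _ _).trans (norm_pow_mul_gaussian_le j hq.le z)
  · have h1 : ∀ᵐ z : ℝ, z ≠ p.2 := by simp [ae_iff]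
    filter_upwards [h1] with z hz
    have hc : ContinuousAt (fun q : ℝ × ℝ => z ^ j * Real.exp (q.1 * z - z ^ 2 / 2)) p := by fun_prop
    rcases lt_or_gt_of_ne hz with h2 | h2
    · refine hc.congr ?_
      filter_upwards [(isOpen_lt (f := fun _ : ℝ × ℝ => z) continuous_const continuous_snd).mem_nhds h2]
        with q hq
      exact (Set.indicator_of_mem (Set.mem_Iic.2 (le_of_lt hq))
        fun z => z ^ j * Real.exp (q.1 * z - z ^ 2 / 2)).symm
    · refine continuousAt_const.congr (f := fun _ => (0 : ℝ)) ?_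
      filter_upwards [(isOpen_lt (g := fun _ : ℝ × ℝ => z) continuous_snd continuous_const).mem_nhds h2]
        with q hq
      exact (Set.indicator_of_notMem (fun h => absurd (Set.mem_Iic.1 h) (not_le.2 hq)) _).symm

theorem hasDerivAt_gaussMoment_Iic (a y : ℝ) (j : ℕ) :
    HasDerivAt (fun y => gaussMoment a (Set.Iic y) j) (y ^ j * Real.exp (a * y - y ^ 2 / 2)) y := by
  have hi := integrable_pow_mul_gaussian j a
  have h : (fun x => gaussMoment a (Set.Iic x) j) = fun x =>
      gaussMoment a (Set.Iic y) j + ∫ z in y..x, z ^ j * Real.exp (a * z - z ^ 2 / 2) :=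
    funext fun x => by
      rw [← intervalIntegral.integral_Iic_sub_Iic hi.integrableOn hi.integrableOn]
      simp [gaussMoment]
  rw [h]
  exact (intervalIntegral.integral_hasDerivAt_right hi.intervalIntegrable
    (Continuous.stronglyMeasurableAtFilter (by fun_prop) _ _) (by fun_prop)).const_add _

theorem hasFDerivAt_gaussMoment_Iic (j : ℕ) (p : ℝ × ℝ) :
    HasFDerivAt (fun p : ℝ × ℝ => gaussMoment p.1 (Set.Iic p.2) j)
      (gaussMoment p.1 (Set.Iic p.2) (j + 1) • ContinuousLinearMap.fst ℝ ℝ ℝ +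
        (p.2 ^ j * Real.exp (p.1 * p.2 - p.2 ^ 2 / 2)) • ContinuousLinearMap.snd ℝ ℝ ℝ) p := by
  have h := hasStrictFDerivAt_uncurry_coprod (𝕜 := ℝ) (u := p)
    (f := fun a y => gaussMoment a (Set.Iic y) j)
    (f₁ := fun a y => ContinuousLinearMap.toSpanSingleton ℝ (gaussMoment a (Set.Iic y) (j + 1)))
    (f₂ := fun a y => ContinuousLinearMap.toSpanSingleton ℝ (y ^ j * Real.exp (a * y - y ^ 2 / 2)))
    (Filter.Eventually.of_forall fun q => (hasDerivAt_gaussMoment _ j q.1).hasFDerivAt)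
    (Filter.Eventually.of_forall fun q => (hasDerivAt_gaussMoment_Iic q.1 q.2 j).hasFDerivAt)
    ?_ ?_
  · refine h.hasFDerivAt.congr_fderiv (ContinuousLinearMap.ext fun v => ?_)
    simp [mul_comm, Function.HasUncurry.uncurry]
  · exact ((ContinuousLinearMap.toSpanSingletonCLE (𝕜 := ℝ) (E := ℝ)).continuous.comp
      (continuous_gaussMoment_Iic (j + 1))).continuousAt
  · refine ((ContinuousLinearMap.toSpanSingletonCLE (𝕜 := ℝ) (E := ℝ)).continuous.comp
      (g := ContinuousLinearMap.toSpanSingletonCLE (𝕜 := ℝ) (E := ℝ))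
      (f := fun q : ℝ × ℝ => q.2 ^ j * Real.exp (q.1 * q.2 - q.2 ^ 2 / 2)) (by fun_prop)).continuousAt

/-- The gradient of the moment of index `j` consists of the moment of index `j + 1` and an
elementary smooth function, so the order of differentiability is raised by induction for all `j`
together. -/
theorem contDiff_gaussMoment_Iic (j : ℕ) :
    ContDiff ℝ (⊤ : ℕ∞) fun p : ℝ × ℝ => gaussMoment p.1 (Set.Iic p.2) j := by
  refine contDiff_infty.2 fun n => ?_
  induction n generalizing j with
  | zero => exact contDiff_zero.2 (continuous_gaussMoment_Iic j)
  | succ n ih =>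
    refine contDiff_succ_iff_hasFDerivAt.2 ⟨_, ?_, hasFDerivAt_gaussMoment_Iic j⟩
    have h : ContDiff ℝ n fun p : ℝ × ℝ => p.2 ^ j * Real.exp (p.1 * p.2 - p.2 ^ 2 / 2) := by fun_prop
    exact ((ih (j + 1)).smul contDiff_const).add (h.smul contDiff_const)

/-! ### Integration by parts -/

theorem gaussMoment_add (S : Set ℝ) (a : ℝ) (j : ℕ) :
    j * gaussMoment a S (j - 1) + a * gaussMoment a S j - gaussMoment a S (j + 1) =
      ∫ z in S, (j * z ^ (j - 1) + (a - z) * z ^ j) * Real.exp (a * z - z ^ 2 / 2) := by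
  have hi : ∀ j, IntegrableOn (fun z : ℝ => z ^ j * Real.exp (a * z - z ^ 2 / 2)) S := fun j =>
    (integrable_pow_mul_gaussian j a).integrableOn
  simp only [gaussMoment]
  rw [← integral_const_mul, ← integral_const_mul,
    ← integral_add ((hi _).const_mul _) ((hi _).const_mul _),
    ← integral_sub (f := fun z => j * (z ^ (j - 1) * Real.exp (a * z - z ^ 2 / 2)) +
      a * (z ^ j * Real.exp (a * z - z ^ 2 / 2))) (((hi _).const_mul _).add ((hi _).const_mul _)) (hi _)]
  refine integral_congr_ae (Filter.Eventually.of_forall fun z => ?_)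
  simp only
  ring

theorem hasDerivAt_pow_mul_gaussian (a z : ℝ) (j : ℕ) :
    HasDerivAt (fun z => z ^ j * Real.exp (a * z - z ^ 2 / 2))
      ((j * z ^ (j - 1) + (a - z) * z ^ j) * Real.exp (a * z - z ^ 2 / 2)) z := by
  have h := (hasDerivAt_pow j z).mul
    (((hasDerivAt_id z).const_mul a).sub ((hasDerivAt_pow 2 z).div_const 2)).exp
  convert! h using 1
  simp only [Pi.sub_apply, id, Nat.cast_ofNat, Nat.add_one_sub_one, pow_one]
  ring

theorem integrable_deriv_pow_mul_gaussian (a : ℝ) (j : ℕ) : Integrable fun z : ℝ =>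
    (j * z ^ (j - 1) + (a - z) * z ^ j) * Real.exp (a * z - z ^ 2 / 2) := by
  have h := (((integrable_pow_mul_gaussian (j - 1) a).const_mul (j : ℝ)).add
    ((integrable_pow_mul_gaussian j a).const_mul a)).sub (integrable_pow_mul_gaussian (j + 1) a)
  refine h.congr (Filter.Eventually.of_forall fun z => ?_)
  simp only [Pi.add_apply, Pi.sub_apply]
  ring

/-- The moments over a half-line `(-∞, e]`, with `e` possibly infinite, satisfy the relation that
comes from integration by parts. -/
theorem gaussMoment_halfLine (a : ℝ) (j : ℕ) (e : EReal) :
    j * gaussMoment a {x | (x : EReal) ≤ e} (j - 1) + a * gaussMoment a {x | (x : EReal) ≤ e} j -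
      gaussMoment a {x | (x : EReal) ≤ e} (j + 1) =
    if e = ⊥ ∨ e = ⊤ then 0 else e.toReal ^ j * Real.exp (a * e.toReal - e.toReal ^ 2 / 2) := by
  have hd := fun z => hasDerivAt_pow_mul_gaussian a z j
  have hi := integrable_deriv_pow_mul_gaussian a j
  have hi' := integrable_pow_mul_gaussian j a
  have hbot := tendsto_zero_of_hasDerivAt_of_integrableOn_Iic (a := 0) (fun z _ => hd z)
    hi.integrableOn hi'.integrableOn
  have htop := tendsto_zero_of_hasDerivAt_of_integrableOn_Ioi (a := 0) (fun z _ => hd z)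
    hi.integrableOn hi'.integrableOn
  rw [gaussMoment_add]
  induction e with
  | bot =>
    simp
  | top =>
    have : {x : ℝ | (x : EReal) ≤ ⊤} = Set.univ := by ext x; simp
    rw [this, Measure.restrict_univ, integral_of_hasDerivAt_of_tendsto hd hi hbot htop]
    simp
  | coe y =>
    have : {x : ℝ | (x : EReal) ≤ y} = Set.Iic y := by ext x; simp
    rw [this, integral_Iic_of_hasDerivAt_of_tendsto (hd y).continuousAt.continuousWithinAt
      (fun z _ => hd z) hi.integrableOn hbot]
    simp

/-! ### Unions of intervals -/

theorem measurableSet_intervals {r : ℕ} (b : Fin (2 * r) → EReal) : MeasurableSet (intervals b) := by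
  have : intervals b = ⋃ j : Fin r, {x : ℝ | b ⟨2 * (j : ℕ), by omega⟩ ≤ (x : EReal) ∧
      (x : EReal) ≤ b ⟨2 * (j : ℕ) + 1, by omega⟩} := by
    ext x; simp [intervals]
  rw [this]
  refine MeasurableSet.iUnion fun j => MeasurableSet.inter ?_ ?_
  · exact measurableSet_le measurable_const measurable_coe_real_ereal
  · exact measurableSet_le measurable_coe_real_ereal measurable_const

theorem exists_isOpen_subset_intervals {r : ℕ} (hr : 0 < r) {b : Fin (2 * r) → EReal}
    (hb : StrictMono b) : ∃ O : Set ℝ, IsOpen O ∧ O.Nonempty ∧ O ⊆ intervals b := by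
  have h : b ⟨2 * 0, by omega⟩ < b ⟨2 * 0 + 1, by omega⟩ := hb (by simp)
  refine ⟨Real.toEReal ⁻¹' Set.Ioo (b ⟨2 * 0, by omega⟩) (b ⟨2 * 0 + 1, by omega⟩),
    isOpen_Ioo.preimage continuous_coe_real_ereal, ?_, fun x hx => ⟨⟨0, hr⟩, hx.1.le, hx.2.le⟩⟩
  obtain ⟨q, hq⟩ := EReal.exists_rat_btwn_of_lt h
  exact ⟨q, hq⟩

/-- Up to the endpoints, a null set, the union of intervals is a disjoint union of differences of
half-lines. Infinite endpoints need no separate treatment: the half-line is then empty or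
everything. -/
theorem gaussMoment_intervals {r : ℕ} {b : Fin (2 * r) → EReal} (hb : StrictMono b) (a : ℝ) (j : ℕ) :
    gaussMoment a (intervals b) j =
      ∑ i : Fin r, (gaussMoment a {x | (x : EReal) ≤ b ⟨2 * (i : ℕ) + 1, by omega⟩} j -
        gaussMoment a {x | (x : EReal) ≤ b ⟨2 * (i : ℕ), by omega⟩} j) := by
  have hle : ∀ e : EReal, MeasurableSet {x : ℝ | (x : EReal) ≤ e} := fun e =>
    measurableSet_le measurable_coe_real_ereal measurable_const
  let I : Fin r → Set ℝ := fun i => {x : ℝ | (x : EReal) ≤ b ⟨2 * (i : ℕ) + 1, by omega⟩} \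
    {x : ℝ | (x : EReal) ≤ b ⟨2 * (i : ℕ), by omega⟩}
  have hint := fun S : Set ℝ => (integrable_pow_mul_gaussian j a).integrableOn (s := S)
  have hI : intervals b =ᵐ[volume] ⋃ i, I i := by
    have hnull : volume (⋃ i : Fin (2 * r), {x : ℝ | (x : EReal) = b i}) = 0 := by
      refine measure_iUnion_null fun i => Set.Subsingleton.measure_zero ?_ _
      intro x hx y hy
      exact EReal.coe_injective (hx.trans hy.symm)
    refine Filter.eventuallyEq_set.2 ?_
    filter_upwards [measure_eq_zero_iff_ae_notMem.1 hnull] with x hx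
    have hx' : ∀ i, (x : EReal) ≠ b i := fun i h => hx (Set.mem_iUnion.2 ⟨i, h⟩)
    simp only [intervals, Set.mem_ofPred_eq, Set.mem_iUnion, I, Set.mem_sdiff, not_le]
    refine exists_congr fun i => ?_
    constructor
    · rintro ⟨h1, h2⟩
      exact ⟨h2, lt_of_le_of_ne h1 (hx' _).symm⟩
    · rintro ⟨h1, h2⟩
      exact ⟨h2.le, h1⟩
  have hdisj : Pairwise (Function.onFun Disjoint I) := by
    have key : ∀ i i' : Fin r, i < i' → Disjoint (I i) (I i') := by
      intro i i' hii
      refine Set.disjoint_left.2 fun x h1 h2 => h2.2 (le_trans h1.1 (hb.monotone ?_))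
      rw [Fin.lt_def] at hii
      simp only [Fin.mk_le_mk]
      omega
    intro i i' hii
    rcases lt_or_gt_of_ne hii with h | h
    · exact key _ _ h
    · exact (key _ _ h).symm
  rw [gaussMoment, setIntegral_congr_set hI, integral_iUnion_fintype (fun i => (hle _).diff (hle _)) hdisj
    fun i => hint _]
  refine Finset.sum_congr rfl fun i _ => ?_
  refine setIntegral_sdiff (hle _) (hint _) fun x hx => le_trans hx (hb.monotone ?_)
  simp

/-! ### Moments over half-lines as functions of the endpoints -/

/-- The moments over `(-∞, bᵢ]` as functions of `α` and of the finite endpoints. -/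
def endMoment {r : ℕ} (b : Fin (2 * r) → EReal) (t : Bool) (i : Fin (2 * r)) (j : ℕ) :
    ℝ × (Fin (2 * r) → ℝ) → ℝ :=
  fun p => gaussMoment (if t then p.1 else 0) {x | (x : EReal) ≤ moveEnds b p.2 i} j

/-- The parameter of the weight `t`, as a linear function. -/
def parCLM (r : ℕ) (t : Bool) : ℝ × (Fin (2 * r) → ℝ) →L[ℝ] ℝ :=
  if t then ContinuousLinearMap.fst ℝ ℝ (Fin (2 * r) → ℝ) else 0

theorem parCLM_apply {r : ℕ} (t : Bool) (p : ℝ × (Fin (2 * r) → ℝ)) :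
    parCLM r t p = if t then p.1 else 0 := by
  rcases t <;> simp [parCLM]

theorem endMoment_of_infinite {r : ℕ} {b : Fin (2 * r) → EReal} (t : Bool) {i : Fin (2 * r)} (j : ℕ)
    (hi : b i = ⊥ ∨ b i = ⊤) : endMoment b t i j =
      (fun a => gaussMoment a {x | (x : EReal) ≤ b i} j) ∘ parCLM r t := by
  ext p
  rw [endMoment, moveEnds, if_pos hi, Function.comp_apply, parCLM_apply]

theorem endMoment_of_finite {r : ℕ} {b : Fin (2 * r) → EReal} (t : Bool) {i : Fin (2 * r)} (j : ℕ)
    (hi : ¬ (b i = ⊥ ∨ b i = ⊤)) : endMoment b t i j =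
      (fun q : ℝ × ℝ => gaussMoment q.1 (Set.Iic q.2) j) ∘ ((parCLM r t).prod
        ((ContinuousLinearMap.proj i).comp (ContinuousLinearMap.snd ℝ ℝ (Fin (2 * r) → ℝ)))) := by
  ext p
  have : ∀ y : ℝ, {x : ℝ | (x : EReal) ≤ y} = Set.Iic y := fun y => by ext x; simp
  rw [endMoment, moveEnds, if_neg hi, this]
  simp [parCLM_apply]

theorem contDiff_endMoment {r : ℕ} (b : Fin (2 * r) → EReal) (t : Bool) (i : Fin (2 * r)) (j : ℕ) :
    ContDiff ℝ (⊤ : ℕ∞) (endMoment b t i j) := by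
  by_cases hi : b i = ⊥ ∨ b i = ⊤
  · rw [endMoment_of_infinite t j hi]
    exact (contDiff_gaussMoment _ j).comp (ContinuousLinearMap.contDiff _)
  · rw [endMoment_of_finite t j hi]
    exact (contDiff_gaussMoment_Iic j).comp (ContinuousLinearMap.contDiff _)

theorem fderiv_endMoment {r : ℕ} (b : Fin (2 * r) → EReal) (t : Bool) (i : Fin (2 * r)) (j : ℕ)
    (p v : ℝ × (Fin (2 * r) → ℝ)) : fderiv ℝ (endMoment b t i j) p v =
      (if t then v.1 else 0) * endMoment b t i (j + 1) p +
        if b i = ⊥ ∨ b i = ⊤ then 0 else v.2 i * (p.2 i ^ j *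
          Real.exp ((if t then p.1 else 0) * p.2 i - p.2 i ^ 2 / 2)) := by
  by_cases hi : b i = ⊥ ∨ b i = ⊤
  · rw [endMoment_of_infinite t j hi, endMoment_of_infinite t (j + 1) hi, if_pos hi,
      ((hasDerivAt_gaussMoment _ j _).hasFDerivAt.comp p (parCLM r t).hasFDerivAt).fderiv]
    simp [parCLM_apply]
  · rw [endMoment_of_finite t j hi, endMoment_of_finite t (j + 1) hi, if_neg hi,
      ((hasFDerivAt_gaussMoment_Iic j _).comp p (ContinuousLinearMap.hasFDerivAt _)).fderiv]
    simp [parCLM_apply]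
    ring_nf

/-- The boundary density at an endpoint, which is what differentiation in that endpoint produces, is
expressed through moments alone. -/
theorem endMoment_relation {r : ℕ} (b : Fin (2 * r) → EReal) (t : Bool) (i : Fin (2 * r)) (j : ℕ)
    (p : ℝ × (Fin (2 * r) → ℝ)) :
    (if b i = ⊥ ∨ b i = ⊤ then 0 else p.2 i ^ j *
      Real.exp ((if t then p.1 else 0) * p.2 i - p.2 i ^ 2 / 2)) =
    j * endMoment b t i (j - 1) p + (if t then p.1 else 0) * endMoment b t i j p -
      endMoment b t i (j + 1) p := by
  rw [endMoment, endMoment, endMoment, gaussMoment_halfLine]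
  by_cases hi : b i = ⊥ ∨ b i = ⊤
  · simp [moveEnds, hi]
  · simp [moveEnds, hi]

/-! ### The differential ring of smooth functions on an open set -/

section SmoothFns

/-- The extension by zero of a function on a subset. -/
def extZero {V : Type*} {U : Set V} (f : U → ℝ) : V → ℝ := Function.extend Subtype.val f 0

theorem extZero_apply {V : Type*} {U : Set V} (f : U → ℝ) {p : V} (hp : p ∈ U) : extZero f p = f ⟨p, hp⟩ :=
  Subtype.val_injective.extend_apply f 0 ⟨p, hp⟩

theorem extZero_eqOn {V : Type*} {U : Set V} {f : U → ℝ} {F : V → ℝ} (h : ∀ p (hp : p ∈ U), F p = f ⟨p, hp⟩) :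
    Set.EqOn (extZero f) F U := fun p hp => by rw [extZero_apply f hp, h]

variable {V : Type*} [NormedAddCommGroup V] [NormedSpace ℝ V]

/-- The algebra of smooth functions on the set `U`. -/
def smoothFns (U : Set V) : Subalgebra ℝ (U → ℝ) where
  carrier := {f | ContDiffOn ℝ (⊤ : ℕ∞) (extZero f) U}
  mul_mem' {f g} hf hg := (hf.mul hg).congr (extZero_eqOn fun p hp => by
    rw [Pi.mul_apply, extZero_apply f hp, extZero_apply g hp])
  add_mem' {f g} hf hg := (hf.add hg).congr (extZero_eqOn fun p hp => by
    rw [Pi.add_apply, extZero_apply f hp, extZero_apply g hp])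
  algebraMap_mem' c := (contDiffOn_const (c := c)).congr (extZero_eqOn fun p hp => rfl)

theorem mem_smoothFns {U : Set V} {f : U → ℝ} {F : V → ℝ} (hF : ContDiffOn ℝ (⊤ : ℕ∞) F U)
    (h : ∀ p (hp : p ∈ U), F p = f ⟨p, hp⟩) : f ∈ smoothFns U :=
  hF.congr (extZero_eqOn h)

/-- The restriction of a function that is smooth on `U`. -/
def smoothFns.mk {U : Set V} (F : V → ℝ) (hF : ContDiffOn ℝ (⊤ : ℕ∞) F U) : smoothFns U :=
  ⟨fun p => F p, mem_smoothFns hF fun _ _ => rfl⟩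

theorem smoothFns.fderiv_eq {U : Set V} (hU : IsOpen U) {f : U → ℝ} {F : V → ℝ}
    (h : ∀ p (hp : p ∈ U), F p = f ⟨p, hp⟩) (p : U) : fderiv ℝ (extZero f) p = fderiv ℝ F p :=
  ((extZero_eqOn h).eventuallyEq_of_mem (hU.mem_nhds p.2)).fderiv_eq

theorem smoothFns.differentiableAt {U : Set V} (hU : IsOpen U) (f : smoothFns U) (p : U) :
    DifferentiableAt ℝ (extZero f.1) p :=
  (f.2.contDiffAt (hU.mem_nhds p.2)).differentiableAt (by simp)

/-- The derivation of the smooth functions along a smooth vector field. -/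
def fieldDeriv {U : Set V} (hU : IsOpen U) (v : V → V) (hv : ContDiff ℝ (⊤ : ℕ∞) v) :
    Derivation ℝ (smoothFns U) (smoothFns U) :=
  Derivation.mk'
    { toFun := fun f => smoothFns.mk (fun p => fderiv ℝ (extZero f.1) p (v p))
        ((f.2.fderiv_of_isOpen hU (by simp)).clm_apply hv.contDiffOn)
      map_add' := fun f g => by
        refine Subtype.ext (funext fun p => ?_)
        have h : fderiv ℝ (extZero (f + g).1) p = fderiv ℝ (extZero f.1) p + fderiv ℝ (extZero g.1) p := by
          rw [← fderiv_add (smoothFns.differentiableAt hU f p) (smoothFns.differentiableAt hU g p)]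
          exact smoothFns.fderiv_eq hU (fun q hq => by
            rw [Pi.add_apply, extZero_apply f.1 hq, extZero_apply g.1 hq]; rfl) p
        exact congrArg (fun L : V →L[ℝ] ℝ => L (v p)) h
      map_smul' := fun c f => by
        refine Subtype.ext (funext fun p => ?_)
        have h : fderiv ℝ (extZero (c • f).1) p = c • fderiv ℝ (extZero f.1) p := by
          rw [← fderiv_const_smul (smoothFns.differentiableAt hU f p)]
          exact smoothFns.fderiv_eq hU (fun q hq => by
            rw [Pi.smul_apply, extZero_apply f.1 hq]; rfl) p
        exact congrArg (fun L : V →L[ℝ] ℝ => L (v p)) h }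
    fun f g => by
      refine Subtype.ext (funext fun p => ?_)
      have h : fderiv ℝ (extZero (f * g).1) p =
          extZero f.1 p • fderiv ℝ (extZero g.1) p + extZero g.1 p • fderiv ℝ (extZero f.1) p := by
        rw [← fderiv_mul (smoothFns.differentiableAt hU f p) (smoothFns.differentiableAt hU g p)]
        exact smoothFns.fderiv_eq hU (fun q hq => by
          rw [Pi.mul_apply, extZero_apply f.1 hq, extZero_apply g.1 hq]; rfl) p
      rw [extZero_apply f.1 p.2, extZero_apply g.1 p.2] at h
      exact congrArg (fun L : V →L[ℝ] ℝ => L (v p)) h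

theorem fieldDeriv_apply {U : Set V} (hU : IsOpen U) {v : V → V} (hv : ContDiff ℝ (⊤ : ℕ∞) v)
    (f : smoothFns U) {F : V → ℝ} (h : ∀ p (hp : p ∈ U), F p = f.1 ⟨p, hp⟩) (p : U) :
    (fieldDeriv hU v hv f).1 p = fderiv ℝ F p (v p) :=
  congrArg (fun L : V →L[ℝ] ℝ => L (v p)) (smoothFns.fderiv_eq hU h p)

theorem fieldDeriv_mk {U : Set V} (hU : IsOpen U) {v : V → V} (hv : ContDiff ℝ (⊤ : ℕ∞) v)
    {F : V → ℝ} (hF : ContDiffOn ℝ (⊤ : ℕ∞) F U) (p : U) :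
    (fieldDeriv hU v hv (smoothFns.mk F hF)).1 p = fderiv ℝ F p (v p) :=
  fieldDeriv_apply hU hv _ (fun _ _ => rfl) p

/-- Symmetry of the second derivative; the vector fields are constant, so no first-order term
appears. -/
theorem fieldDeriv_comm {U : Set V} (hU : IsOpen U) (v w : V) (f : smoothFns U) :
    fieldDeriv hU (fun _ => v) contDiff_const (fieldDeriv hU (fun _ => w) contDiff_const f) =
      fieldDeriv hU (fun _ => w) contDiff_const (fieldDeriv hU (fun _ => v) contDiff_const f) := by
  refine Subtype.ext (funext fun p => ?_)
  have hf : ContDiffAt ℝ (⊤ : ℕ∞) (extZero f.1) p := f.2.contDiffAt (hU.mem_nhds p.2)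
  have hd : DifferentiableAt ℝ (fderiv ℝ (extZero f.1)) p :=
    ((contDiffAt_infty.1 hf 2).fderiv_right (m := 1) (by norm_num)).differentiableAt (by simp)
  have key : ∀ v w : V, (fieldDeriv hU (fun _ => v) contDiff_const
      (fieldDeriv hU (fun _ => w) contDiff_const f)).1 p =
      fderiv ℝ (fderiv ℝ (extZero f.1)) p v w := by
    intro v w
    rw [fieldDeriv_apply hU contDiff_const _ (F := fun q => fderiv ℝ (extZero f.1) q w) fun q hq => rfl,
      fderiv_clm_apply hd (differentiableAt_const w)]
    simp
  rw [key, key]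
  exact (contDiffAt_infty.1 hf 2).isSymmSndFDerivAt (by simp) v w

theorem smoothFns.isUnit {U : Set V} (f : smoothFns U) (h : ∀ p, f.1 p ≠ 0) : IsUnit f := by
  have hinv : (fun p => (f.1 p)⁻¹) ∈ smoothFns U :=
    mem_smoothFns (F := fun p => (extZero f.1 p)⁻¹)
      (f.2.inv fun p hp => by rw [extZero_apply f.1 hp]; exact h _)
      fun p hp => by rw [extZero_apply f.1 hp]
  refine IsUnit.of_mul_eq_one (⟨_, hinv⟩ : smoothFns U) (Subtype.ext (funext fun p => ?_))
  exact mul_inv_cancel₀ (h p)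

/-- The logarithm of the absolute value of a smooth function without zeros. -/
def smoothFns.log {U : Set V} (f : smoothFns U) (h : ∀ p, f.1 p ≠ 0) : smoothFns U :=
  ⟨fun p => Real.log (f.1 p), mem_smoothFns (F := fun p => Real.log (extZero f.1 p))
    (ContDiffOn.log f.2 fun p hp => by rw [extZero_apply f.1 hp]; exact h _)
    fun p hp => by rw [extZero_apply f.1 hp]⟩

theorem mul_fieldDeriv_log {U : Set V} (hU : IsOpen U) {v : V → V} (hv : ContDiff ℝ (⊤ : ℕ∞) v)
    (f : smoothFns U) (h : ∀ p, f.1 p ≠ 0) :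
    f * fieldDeriv hU v hv (smoothFns.log f h) = fieldDeriv hU v hv f := by
  refine Subtype.ext (funext fun p => ?_)
  have hp : extZero f.1 p ≠ 0 := by rw [extZero_apply f.1 p.2]; exact h _
  have h1 : (fieldDeriv hU v hv (smoothFns.log f h)).1 p =
      fderiv ℝ (fun p => Real.log (extZero f.1 p)) p (v p) :=
    fieldDeriv_apply hU hv _ (fun q hq => by rw [extZero_apply f.1 hq]; rfl) p
  rw [((smoothFns.differentiableAt hU f p).hasFDerivAt.log hp).fderiv] at h1
  change f.1 p * (fieldDeriv hU v hv (smoothFns.log f h)).1 p = fderiv ℝ (extZero f.1) p (v p)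
  rw [h1, extZero_apply f.1 p.2, _root_.smul_apply, smul_eq_mul, ← mul_assoc, mul_inv_cancel₀ (h p),
    one_mul]

end SmoothFns

theorem derivation_prod {R ι : Type*} [CommRing R] [Algebra ℝ R] [DecidableEq ι]
    (δ : Derivation ℝ R R) (s : Finset ι) (f : ι → R) :
    δ (∏ i ∈ s, f i) = ∑ i ∈ s, (∏ j ∈ s.erase i, f j) * δ (f i) := by
  induction s using Finset.induction_on with
  | empty => simp
  | insert a s ha ih =>
    rw [Finset.prod_insert ha, Derivation.leibniz, ih, Finset.sum_insert ha, Finset.erase_insert ha,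
      smul_eq_mul, smul_eq_mul, Finset.mul_sum, add_comm]
    congr 1
    refine Finset.sum_congr rfl fun i hi => ?_
    have hne : a ≠ i := fun h => ha (h ▸ hi)
    rw [Finset.erase_insert_of_ne hne, Finset.prod_insert fun h => ha (Finset.mem_of_mem_erase h),
      mul_assoc]

/-- Jacobi's formula. -/
theorem derivation_det {R ι : Type*} [CommRing R] [Algebra ℝ R] [Fintype ι] [DecidableEq ι]
    (δ : Derivation ℝ R R) (M : Matrix ι ι R) : δ M.det = (M.adjugate * M.map δ).trace := by
  -- By Cramer's rule the trace is the sum of the determinants in which one column is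
  -- differentiated.
  have h1 : (M.adjugate * M.map δ).trace = ∑ i, (M.updateCol i fun k => δ (M k i)).det := by
    refine Finset.sum_congr rfl fun i _ => ?_
    rw [← cramer_apply, cramer_eq_adjugate_mulVec]
    rfl
  rw [h1, det_apply, map_sum]
  simp only [det_apply]
  rw [Finset.sum_comm]
  refine Finset.sum_congr rfl fun σ _ => ?_
  rw [← Finset.smul_sum, Units.smul_def, Units.smul_def, map_zsmul, derivation_prod]
  congr 1
  refine Finset.sum_congr rfl fun i _ => ?_
  rw [← Finset.mul_prod_erase _ _ (Finset.mem_univ i), updateCol_self, mul_comm]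
  congr 1
  refine Finset.prod_congr rfl fun j hj => ?_
  rw [updateCol_ne (Finset.ne_of_mem_erase hj)]

/-! ### Moments as smooth functions of the parameter and the finite endpoints -/

section Domain

variable {r : ℕ} (b : Fin (2 * r) → EReal)

/-- The parameters `(α, x)` for which `α ≠ 0` and the finite endpoints are in increasing order. -/
def domain : Set (ℝ × (Fin (2 * r) → ℝ)) :=
  {p | p.1 ≠ 0 ∧ ∀ i j, i < j → ¬(b i = ⊥ ∨ b i = ⊤) → ¬(b j = ⊥ ∨ b j = ⊤) → p.2 i < p.2 j}

theorem isOpen_domain : IsOpen (domain b) := by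
  have h : domain b = {p | p.1 ≠ 0} ∩ ⋂ q : {q : Fin (2 * r) × Fin (2 * r) // q.1 < q.2 ∧
      ¬(b q.1 = ⊥ ∨ b q.1 = ⊤) ∧ ¬(b q.2 = ⊥ ∨ b q.2 = ⊤)}, {p | p.2 q.1.1 < p.2 q.1.2} := by
    ext p
    simp only [domain, Set.mem_ofPred_eq, Set.mem_inter_iff, Set.mem_iInter, Subtype.forall, Prod.forall]
    exact and_congr_right fun _ => ⟨fun h i j hij => h i j hij.1 hij.2.1 hij.2.2,
      fun h i j h1 h2 h3 => h i j ⟨h1, h2, h3⟩⟩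
  rw [h]
  refine (isOpen_ne_fun continuous_fst continuous_const).inter (isOpen_iInter_of_finite fun q => ?_)
  exact isOpen_lt (by fun_prop) (by fun_prop)

variable {b}

theorem strictMono_moveEnds (hb : StrictMono b) {p : ℝ × (Fin (2 * r) → ℝ)} (hp : p ∈ domain b) :
    StrictMono (moveEnds b p.2) := by
  intro i j hij
  have hbij := hb hij
  simp only [moveEnds]
  split_ifs with h1 h2 h2
  · exact hbij
  · rcases h1 with h1 | h1
    · rw [h1]; exact EReal.bot_lt_coe _
    · rw [h1] at hbij; exact absurd hbij not_top_lt
  · rcases h2 with h2 | h2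
    · rw [h2] at hbij; exact absurd hbij not_lt_bot
    · rw [h2]; exact EReal.coe_lt_top _
  · exact EReal.coe_lt_coe_iff.2 (hp.2 i j hij h1 h2)

theorem moveEnds_toReal (b : Fin (2 * r) → EReal) : moveEnds b (fun i => (b i).toReal) = b := by
  ext i
  simp only [moveEnds]
  split_ifs with h
  · rfl
  · exact EReal.coe_toReal (fun h' => h (Or.inr h')) fun h' => h (Or.inl h')

theorem mem_domain_toReal (hb : StrictMono b) {α : ℝ} (hα : α ≠ 0) :
    (α, fun i => (b i).toReal) ∈ domain b := by
  refine ⟨hα, fun i j hij hi hj => ?_⟩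
  have h := hb hij
  rw [← EReal.coe_toReal (fun h' => hi (Or.inr h')) fun h' => hi (Or.inl h'),
    ← EReal.coe_toReal (fun h' => hj (Or.inr h')) fun h' => hj (Or.inl h')] at h
  exact EReal.coe_lt_coe_iff.1 h

variable (b)

/-- The functions smooth in `α` and the finite endpoints. -/
abbrev SmoothParam : Type := smoothFns (domain b)

/-- `∂ / ∂α`, as a derivation. -/
def derivA : Derivation ℝ (SmoothParam b) (SmoothParam b) :=
  fieldDeriv (isOpen_domain b) (fun _ => (1, 0)) contDiff_const

/-- The sum of `∂ / ∂bᵢ` over the finite endpoints, as a derivation. -/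
def derivD : Derivation ℝ (SmoothParam b) (SmoothParam b) :=
  fieldDeriv (isOpen_domain b) (fun _ => (0, fun i => if b i = ⊥ ∨ b i = ⊤ then 0 else 1)) contDiff_const

theorem contDiff_eulerField : ContDiff ℝ (⊤ : ℕ∞) fun p : ℝ × (Fin (2 * r) → ℝ) =>
    ((0 : ℝ), fun i => if b i = ⊥ ∨ b i = ⊤ then 0 else p.2 i) := by
  refine contDiff_const.prodMk (contDiff_pi.2 fun i => ?_)
  split_ifs <;> fun_prop

/-- The sum of `bᵢ ∂ / ∂bᵢ` over the finite endpoints, as a derivation. -/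
def derivE : Derivation ℝ (SmoothParam b) (SmoothParam b) :=
  fieldDeriv (isOpen_domain b) _ (contDiff_eulerField b)

/-- The parameter `α`. -/
def paramα : SmoothParam b := smoothFns.mk Prod.fst contDiff_fst.contDiffOn

/-- The moments over half-lines. -/
def halfMoment (t : Bool) (i : Fin (2 * r)) (j : ℕ) : SmoothParam b :=
  smoothFns.mk (endMoment b t i j) (contDiff_endMoment b t i j).contDiffOn

/-- The moments over the union of the intervals. -/
def moment (t : Bool) (j : ℕ) : SmoothParam b :=
  ∑ i : Fin r, (halfMoment b t ⟨2 * (i : ℕ) + 1, by omega⟩ j - halfMoment b t ⟨2 * (i : ℕ), by omega⟩ j)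

theorem derivA_α : derivA b (paramα b) = 1 := by
  refine Subtype.ext (funext fun p => ?_)
  rw [derivA, paramα, fieldDeriv_mk, fderiv_fst]
  rfl

theorem derivD_α : derivD b (paramα b) = 0 := by
  refine Subtype.ext (funext fun p => ?_)
  rw [derivD, paramα, fieldDeriv_mk, fderiv_fst]
  rfl

theorem derivE_α : derivE b (paramα b) = 0 := by
  refine Subtype.ext (funext fun p => ?_)
  rw [derivE, paramα, fieldDeriv_mk, fderiv_fst]
  rfl

theorem derivA_halfMoment (t : Bool) (i : Fin (2 * r)) (j : ℕ) :
    derivA b (halfMoment b t i j) = if t then halfMoment b t i (j + 1) else 0 := by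
  refine Subtype.ext (funext fun p => ?_)
  rw [derivA, halfMoment, fieldDeriv_mk, fderiv_endMoment]
  rcases t <;> simp [halfMoment, smoothFns.mk]

theorem derivD_halfMoment (t : Bool) (i : Fin (2 * r)) (j : ℕ) :
    derivD b (halfMoment b t i j) = j * halfMoment b t i (j - 1) +
      (if t then paramα b else 0) * halfMoment b t i j - halfMoment b t i (j + 1) := by
  refine Subtype.ext (funext fun p => ?_)
  have h := endMoment_relation b t i j p
  rw [derivD, halfMoment, fieldDeriv_mk, fderiv_endMoment]
  refine Eq.trans ?_ (h.trans ?_)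
  · by_cases hi : b i = ⊥ ∨ b i = ⊤ <;> simp [hi]
  · rcases t <;> simp [halfMoment, smoothFns.mk, paramα]

theorem derivE_halfMoment (t : Bool) (i : Fin (2 * r)) (j : ℕ) :
    derivE b (halfMoment b t i j) = (j + 1) * halfMoment b t i j +
      (if t then paramα b else 0) * halfMoment b t i (j + 1) - halfMoment b t i (j + 2) := by
  refine Subtype.ext (funext fun p => ?_)
  have h := endMoment_relation b t i (j + 1) p
  rw [derivE, halfMoment, fieldDeriv_mk, fderiv_endMoment]
  refine Eq.trans ?_ (h.trans ?_)
  · by_cases hi : b i = ⊥ ∨ b i = ⊤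
    · simp [hi]
    · simp [hi]; ring
  · rcases t <;> simp [halfMoment, smoothFns.mk, paramα]

theorem derivA_moment (t : Bool) (j : ℕ) :
    derivA b (moment b t j) = if t then moment b t (j + 1) else 0 := by
  simp only [moment, map_sum, map_sub, derivA_halfMoment]
  rcases t <;> simp

theorem derivD_moment (t : Bool) (j : ℕ) : derivD b (moment b t j) = j * moment b t (j - 1) +
    (if t then paramα b else 0) * moment b t j - moment b t (j + 1) := by
  simp only [moment, map_sum, map_sub, derivD_halfMoment, Finset.mul_sum, ← Finset.sum_add_distrib,
    ← Finset.sum_sub_distrib]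
  exact Finset.sum_congr rfl fun i _ => by ring

theorem derivE_moment (t : Bool) (j : ℕ) : derivE b (moment b t j) = (j + 1) * moment b t j +
    (if t then paramα b else 0) * moment b t (j + 1) - moment b t (j + 2) := by
  simp only [moment, map_sum, map_sub, derivE_halfMoment, Finset.mul_sum, ← Finset.sum_add_distrib,
    ← Finset.sum_sub_distrib]
  exact Finset.sum_congr rfl fun i _ => by ring

/-- The evaluation at a point. -/
def evalAt (p : domain b) : SmoothParam b →+* ℝ :=
  (Pi.evalRingHom (fun _ : domain b => ℝ) p).comp (smoothFns (domain b)).val.toRingHom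

theorem evalAt_moment (hb : StrictMono b) (p : domain b) (t : Bool) (j : ℕ) :
    evalAt b p (moment b t j) =
      gaussMoment (if t then p.1.1 else 0) (intervals (moveEnds b p.1.2)) j := by
  rw [gaussMoment_intervals (strictMono_moveEnds hb p.2), moment, map_sum]
  rfl

/-- The arrangement of the rows of the moment matrix: the weights. -/
def rowWeight (k₁ k₂ : ℕ) (i : Fin (k₁ + k₂)) : Bool := decide ((i : ℕ) < k₁)

/-- The arrangement of the rows of the moment matrix: the exponents. -/
def rowExponent (k₁ k₂ : ℕ) (i : Fin (k₁ + k₂)) : ℕ := if (i : ℕ) < k₁ then i else k₁ + k₂ - 1 - i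

/-- The moment matrix over the smooth functions. -/
def smoothMomentMatrix (k₁ k₂ : ℕ) : Matrix (Fin (k₁ + k₂)) (Fin (k₁ + k₂)) (SmoothParam b) :=
  of fun i j => moment b (rowWeight k₁ k₂ i) (rowExponent k₁ k₂ i + j)

variable {b}

theorem evalAt_det (hb : StrictMono b) (k₁ k₂ : ℕ) (p : domain b) :
    evalAt b p (smoothMomentMatrix b k₁ k₂).det =
      (momentMatrix k₁ k₂ p.1.1 (intervals (moveEnds b p.1.2))).det := by
  rw [RingHom.map_det]
  congr 1
  ext i j
  rw [RingHom.mapMatrix_apply, map_apply, smoothMomentMatrix, of_apply, evalAt_moment b hb, momentMatrix,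
    of_apply]
  by_cases h : (i : ℕ) < k₁ <;> simp [rowWeight, rowExponent, h]

theorem prob_intervals_pos (hr : 0 < r) (hb : StrictMono b) (k₁ k₂ : ℕ) {α : ℝ} (hα : α ≠ 0) :
    0 < prob k₁ k₂ α (intervals b) := by
  obtain ⟨O, hO, hne, hsub⟩ := exists_isOpen_subset_intervals hr hb
  exact prob_pos k₁ k₂ hα hO hne hsub

/-- The probability is a multiple of the absolute value of this determinant and is positive, as the
set contains a nonempty open interval. This makes the determinant a unit in the ring of smooth
functions. -/
theorem det_smoothMomentMatrix_ne_zero (hr : 0 < r) (hb : StrictMono b) (k₁ k₂ : ℕ) (p : domain b) :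
    (smoothMomentMatrix b k₁ k₂).det.1 p ≠ 0 := by
  change evalAt b p (smoothMomentMatrix b k₁ k₂).det ≠ 0
  rw [evalAt_det hb]
  intro h0
  obtain ⟨C, hC⟩ := exists_prob_eq k₁ k₂
  have h1 := prob_intervals_pos hr (strictMono_moveEnds hb p.2) k₁ k₂ p.2.1
  rw [hC _ p.2.1 _ (measurableSet_intervals _), h0] at h1
  simp at h1

/-- The moments over the union of the intervals form a moment system. -/
def momentSystem (hr : 0 < r) (hb : StrictMono b) (k₁ k₂ : ℕ) :
    MomentSystem (SmoothParam b) (k₁ + k₂) where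
  A := derivA b
  D := derivD b
  D₀ := derivE b
  comm f := fieldDeriv_comm (isOpen_domain b) _ _ f
  α := paramα b
  A_α := derivA_α b
  D_α := derivD_α b
  D₀_α := derivE_α b
  m := moment b
  A_true j := derivA_moment b true j
  A_false j := derivA_moment b false j
  D_m := derivD_moment b
  D₀_m := derivE_moment b
  k t := if t then k₁ else k₂
  s := rowWeight k₁ k₂
  x := rowExponent k₁ k₂
  x_lt i := by
    have := i.2
    by_cases h : (i : ℕ) < k₁ <;> (simp [rowWeight, rowExponent, h]; try omega)
  exists_row t y hy := by
    rcases t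
    · simp only [Bool.false_eq_true, if_false] at hy
      refine ⟨⟨k₁ + k₂ - 1 - y, by omega⟩, ?_⟩
      have : ¬ (k₁ + k₂ - 1 - y < k₁) := by omega
      simp [rowWeight, rowExponent, this]
      omega
    · simp only [if_true] at hy
      exact ⟨⟨y, by omega⟩, by simp [rowWeight, rowExponent, hy]⟩
  row_inj i j h1 h2 := by
    have hi := i.2
    have hj := j.2
    refine Fin.ext ?_
    by_cases h : (i : ℕ) < k₁ <;> by_cases h' : (j : ℕ) < k₁ <;>
      (simp [rowWeight, rowExponent, h, h'] at h1 h2; try omega)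
  isUnit_det := smoothFns.isUnit _ (det_smoothMomentMatrix_ne_zero hr hb k₁ k₂)

end Domain

/-! ### The logarithm of the probability -/

section LogProb

variable {r : ℕ} {b : Fin (2 * r) → EReal}

theorem derivation_log_det (hr : 0 < r) (hb : StrictMono b) (k₁ k₂ : ℕ)
    {v : ℝ × (Fin (2 * r) → ℝ) → ℝ × (Fin (2 * r) → ℝ)} (hv : ContDiff ℝ (⊤ : ℕ∞) v) :
    fieldDeriv (isOpen_domain b) v hv
      (smoothFns.log _ (det_smoothMomentMatrix_ne_zero hr hb k₁ k₂)) =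
    ((momentSystem hr hb k₁ k₂).H⁻¹ *
      (momentSystem hr hb k₁ k₂).H.map (fieldDeriv (isOpen_domain b) v hv)).trace := by
  have hu := (momentSystem hr hb k₁ k₂).isUnit_det
  refine hu.mul_left_cancel (Eq.trans (mul_fieldDeriv_log (isOpen_domain b) hv _
    (det_smoothMomentMatrix_ne_zero hr hb k₁ k₂)) ?_)
  have hu' : IsUnit (momentSystem hr hb k₁ k₂).H.det := hu
  have h1 : (momentSystem hr hb k₁ k₂).H.adjugate =
      (momentSystem hr hb k₁ k₂).H.det • (momentSystem hr hb k₁ k₂).H⁻¹ := by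
    rw [inv_def, smul_smul, Ring.mul_inverse_cancel _ hu', one_smul]
  have h2 := derivation_det (fieldDeriv (isOpen_domain b) v hv) (momentSystem hr hb k₁ k₂).H
  rw [h1, smul_mul, trace_smul] at h2
  exact h2

theorem sum_par (hr : 0 < r) (hb : StrictMono b) (k₁ k₂ : ℕ) :
    ∑ i, (momentSystem hr hb k₁ k₂).par ((momentSystem hr hb k₁ k₂).s i) = k₁ * paramα b := by
  have h : ∀ i : Fin (k₁ + k₂), (momentSystem hr hb k₁ k₂).par ((momentSystem hr hb k₁ k₂).s i) =
      if (i : ℕ) < k₁ then paramα b else 0 := fun i => by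
    change (if decide ((i : ℕ) < k₁) = true then paramα b else 0) = _
    simp
  rw [Finset.sum_congr rfl fun i _ => h i, Fin.sum_univ_add]
  simp

/-- The logarithm of the probability as a smooth function, and its first derivatives. -/
theorem exists_logParam (hr : 0 < r) (hb : StrictMono b) (k₁ k₂ : ℕ) : ∃ ℓ β : SmoothParam b,
    (∀ p, logProb k₁ k₂ r p.1.1 (moveEnds b p.1.2) = ℓ.1 p) ∧
    (∀ p, β.1 p = (p.1.1)⁻¹) ∧ paramα b * β = 1 ∧
    derivA b ℓ = (momentSystem hr hb k₁ k₂).ψ true - k₁ * k₂ * β - k₁ * paramα b ∧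
    derivD b ℓ = k₁ * paramα b - (momentSystem hr hb k₁ k₂).θ := by
  have hα : ∀ p, (paramα b).1 p ≠ 0 := fun p => p.2.1
  obtain ⟨β, hβ⟩ := (smoothFns.isUnit (paramα b) hα).exists_right_inv
  have hβ' : ∀ p, β.1 p = (p.1.1)⁻¹ := fun p =>
    eq_inv_of_mul_eq_one_right (congrFun (congrArg Subtype.val hβ) p)
  obtain ⟨C, hC⟩ := exists_prob_eq k₁ k₂
  let lα := smoothFns.log (paramα b) hα
  let lτ := smoothFns.log _ (det_smoothMomentMatrix_ne_zero hr hb k₁ k₂)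
  -- The logarithm of the product formula. `Real.log` ignores signs, so neither the sign of `α` nor
  -- that of the determinant matters, and for `C` it is enough that it is nonzero.
  let ℓ : SmoothParam b := algebraMap ℝ _ (Real.log C) - (k₁ * k₂ : ℝ) • lα -
    (k₁ / 2 : ℝ) • paramα b ^ 2 + lτ
  have hA : derivA b lα = β := by
    have h := mul_fieldDeriv_log (isOpen_domain b) (v := fun _ => (1, 0)) contDiff_const (paramα b) hα
    change paramα b * derivA b lα = derivA b (paramα b) at h
    rw [derivA_α] at h
    linear_combination β * h - (derivA b lα) * hβ
  have hD : derivD b lα = 0 := by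
    have h := mul_fieldDeriv_log (isOpen_domain b)
      (v := fun _ => (0, fun i => if b i = ⊥ ∨ b i = ⊤ then 0 else 1)) contDiff_const (paramα b) hα
    change paramα b * derivD b lα = derivD b (paramα b) at h
    rw [derivD_α] at h
    linear_combination β * h - (derivD b lα) * hβ
  have hhalf : ∀ c : SmoothParam b, (k₁ / 2 : ℝ) • (2 * c) = k₁ * c := fun c =>
    Subtype.ext (funext fun p => by
      change (k₁ / 2 : ℝ) * (2 * c.1 p) = k₁ * c.1 p
      ring)
  have hkk : ∀ c : SmoothParam b, (k₁ * k₂ : ℝ) • c = k₁ * k₂ * c := fun c => by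
    rw [← Nat.cast_mul, Nat.cast_smul_eq_nsmul, nsmul_eq_mul, Nat.cast_mul]
  refine ⟨ℓ, β, fun p => ?_, hβ', hβ, ?_, ?_⟩
  · have hpos := prob_intervals_pos hr (strictMono_moveEnds hb p.2) k₁ k₂ p.2.1
    have hdet := det_smoothMomentMatrix_ne_zero hr hb k₁ k₂ p
    have hτ := evalAt_det hb k₁ k₂ p
    change (smoothMomentMatrix b k₁ k₂).det.1 p = _ at hτ
    rw [logProb]
    rw [hC _ p.2.1 _ (measurableSet_intervals _), ← hτ] at hpos ⊢
    have hC0 : C ≠ 0 := by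
      rintro rfl
      simp at hpos
    have hα0 : |p.1.1| ≠ 0 := abs_ne_zero.2 p.2.1
    rw [Real.log_mul (mul_ne_zero (mul_ne_zero hC0 (inv_ne_zero (pow_ne_zero _ hα0))) (Real.exp_ne_zero _))
      (abs_ne_zero.2 hdet), Real.log_mul (mul_ne_zero hC0 (inv_ne_zero (pow_ne_zero _ hα0)))
      (Real.exp_ne_zero _), Real.log_mul hC0 (inv_ne_zero (pow_ne_zero _ hα0)), Real.log_inv,
      Real.log_pow, Real.log_abs, Real.log_abs, Real.log_exp]
    change _ = Real.log C - (k₁ * k₂ : ℝ) * Real.log p.1.1 - (k₁ / 2 : ℝ) * p.1.1 ^ 2 + _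
    push_cast
    change _ = _ + Real.log ((smoothMomentMatrix b k₁ k₂).det.1 p)
    ring
  · have h := derivation_log_det hr hb k₁ k₂ (v := fun _ => (1, 0)) contDiff_const
    have h' : derivA b lτ = (momentSystem hr hb k₁ k₂).ψ true :=
      h.trans (momentSystem hr hb k₁ k₂).trace_inv_mul_A_H
    simp only [ℓ, map_add, map_sub, Derivation.map_smul, Derivation.map_algebraMap, h', hA,
      Derivation.leibniz_pow, derivA_α]
    have e : (k₁ / 2 : ℝ) • (2 • paramα b ^ (2 - 1) • (1 : SmoothParam b)) = k₁ * paramα b := by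
      rw [← hhalf]
      simp [two_mul, two_smul]
    rw [e, hkk]
    ring
  · have h := derivation_log_det hr hb k₁ k₂
      (v := fun _ => (0, fun i => if b i = ⊥ ∨ b i = ⊤ then 0 else 1)) contDiff_const
    have h' : derivD b lτ = k₁ * paramα b - (momentSystem hr hb k₁ k₂).θ := by
      rw [← sum_par hr hb]
      exact h.trans (momentSystem hr hb k₁ k₂).trace_inv_mul_D_H
    simp only [ℓ, map_add, map_sub, Derivation.map_smul, Derivation.map_algebraMap, h', hD,
      Derivation.leibniz_pow, derivD_α, smul_zero]
    ring

end LogProb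

/-! ### The operators of the statement as derivations -/

section Represents

variable {r : ℕ} {b : Fin (2 * r) → EReal}

/-- The function `Φ` of `α` and the endpoints is given on the domain by the smooth function `φ`. -/
def Represents (Φ : Fn r) (φ : SmoothParam b) : Prop :=
  ∀ p : domain b, Φ p.1.1 (moveEnds b p.1.2) = φ.1 p

theorem Represents.hasFDerivAt {Φ : Fn r} {φ : SmoothParam b} (h : Represents Φ φ) (p : domain b) :
    HasFDerivAt (fun q : ℝ × (Fin (2 * r) → ℝ) => Φ q.1 (moveEnds b q.2))
      (fderiv ℝ (extZero φ.1) p) p.1 := by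
  refine (smoothFns.differentiableAt (isOpen_domain b) φ p).hasFDerivAt.congr_of_eventuallyEq ?_
  filter_upwards [(isOpen_domain b).mem_nhds p.2] with q hq
  rw [extZero_apply φ.1 hq]
  exact h ⟨q, hq⟩

theorem Represents.dAlpha {Φ : Fn r} {φ : SmoothParam b} (h : Represents Φ φ) :
    Represents (dAlpha Φ) (derivA b φ) := fun p => by
  have h1 : HasDerivAt (fun a : ℝ => ((a, p.1.2) : ℝ × (Fin (2 * r) → ℝ))) (1, 0) p.1.1 :=
    (hasDerivAt_id _).prodMk (hasDerivAt_const _ _)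
  exact (HasFDerivAt.comp_hasDerivAt p.1.1 (h.hasFDerivAt p) h1).deriv

/-- Updating a finite extended-real endpoint is the same as moving the corresponding real
coordinate, so the one-variable derivative is a directional derivative of the representative. -/
theorem Represents.dEnd {Φ : Fn r} {φ : SmoothParam b} (h : Represents Φ φ) (p : domain b)
    {i : Fin (2 * r)} (hi : ¬(b i = ⊥ ∨ b i = ⊤)) : dEnd i Φ p.1.1 (moveEnds b p.1.2) =
      fderiv ℝ (extZero φ.1) p (0, Pi.single i 1) := by
  have e1 : (moveEnds b p.1.2 i).toReal = p.1.2 i := by simp [moveEnds, hi]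
  have e2 : ∀ y : ℝ, Function.update (moveEnds b p.1.2) i (y : EReal) =
      moveEnds b (Function.update p.1.2 i y) := fun y => by
    ext l
    by_cases hl : l = i
    · subst hl
      simp [moveEnds, hi]
    · simp [moveEnds, hl]
  have h1 : HasDerivAt (fun y : ℝ => ((p.1.1, Function.update p.1.2 i y) : ℝ × (Fin (2 * r) → ℝ)))
      (0, Pi.single i 1) (p.1.2 i) :=
    (hasDerivAt_const _ _).prodMk (hasDerivAt_update _ _ _)
  have h2 : HasFDerivAt (fun q : ℝ × (Fin (2 * r) → ℝ) => Φ q.1 (moveEnds b q.2))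
      (fderiv ℝ (extZero φ.1) p) (p.1.1, Function.update p.1.2 i (p.1.2 i)) := by
    rw [Function.update_eq_self]
    exact h.hasFDerivAt p
  rw [ExternalSource.dEnd, e1]
  simp only [e2]
  exact (HasFDerivAt.comp_hasDerivAt (p.1.2 i) h2 h1).deriv

/-- `moveEnds` keeps the infinite endpoints infinite and the finite ones finite, so the sum over
finite endpoints runs over the same indices at every point of the domain. -/
theorem Represents.bdry_eq {Φ : Fn r} {φ : SmoothParam b} (h : Represents Φ φ) (k : ℤ) (p : domain b) :
    bdry k Φ p.1.1 (moveEnds b p.1.2) = fderiv ℝ (extZero φ.1) p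
      (0, fun i => if b i = ⊥ ∨ b i = ⊤ then 0 else p.1.2 i ^ (k + 1)) := by
  have h1 : ((0 : ℝ), fun i => if b i = ⊥ ∨ b i = ⊤ then 0 else p.1.2 i ^ (k + 1)) =
      ∑ i with ¬(b i = ⊥ ∨ b i = ⊤), p.1.2 i ^ (k + 1) • ((0 : ℝ), (Pi.single i 1 : Fin (2 * r) → ℝ)) := by
    refine Prod.ext ?_ (funext fun l => ?_)
    · simp [Prod.fst_sum]
    · rw [Finset.sum_filter, Prod.snd_sum, Finset.sum_apply, Finset.sum_eq_single l]
      · by_cases hl : b l = ⊥ ∨ b l = ⊤ <;> simp [hl]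
      · intro i _ hi
        by_cases hl : b i = ⊥ ∨ b i = ⊤ <;> simp [hl, hi.symm]
      · simp
  rw [h1, map_sum, bdry]
  refine Finset.sum_congr ?_ fun i hi => ?_
  · refine Finset.filter_congr fun i _ => ?_
    by_cases hi : b i = ⊥ ∨ b i = ⊤
    · rw [moveEnds, if_pos hi, not_or]
    · rw [moveEnds, if_neg hi]
      simp [hi]
  · have hi' : ¬(b i = ⊥ ∨ b i = ⊤) := (Finset.mem_filter.1 hi).2
    rw [h.dEnd p hi', map_smul, smul_eq_mul]
    simp [moveEnds, hi']

theorem Represents.bdry_neg_one {Φ : Fn r} {φ : SmoothParam b} (h : Represents Φ φ) :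
    Represents (bdry (-1) Φ) (derivD b φ) := fun p => by
  rw [h.bdry_eq]
  simp only [neg_add_cancel, zpow_zero]
  rfl

theorem Represents.bdry_zero {Φ : Fn r} {φ : SmoothParam b} (h : Represents Φ φ) :
    Represents (bdry 0 Φ) (derivE b φ) := fun p => by
  rw [h.bdry_eq]
  simp only [zero_add, zpow_one]
  rfl

theorem Represents.add {Φ Ψ : Fn r} {φ ψ : SmoothParam b} (h : Represents Φ φ) (h' : Represents Ψ ψ) :
    Represents (Φ + Ψ) (φ + ψ) := fun p => congrArg₂ (· + ·) (h p) (h' p)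

end Represents

/-! ### The equation for the functions of the statement -/

/-- The determinantal form of the equation. -/
theorem det_equation {R : Type*} [CommRing R] (gp f1 f gm e1 e gp' f2 gm' e2 : R) :
    Matrix.det !![gp, f1, -f, 0; -gm, e1, -e, 0; gp', f2, 0, -f; -gm', e2, 0, -e] =
    -((f * gm' + e * gp') * (f * e1 - e * f1) - (f * gm + e * gp) * (f * e2 - e * f2)) := by
  rw [Matrix.det_succ_row_zero]
  simp [Fin.sum_univ_succ, Matrix.det_fin_three, Fin.succAbove, Matrix.submatrix]
  ring

section Equation

variable {r : ℕ} {b : Fin (2 * r) → EReal}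

theorem Represents.eval {Φ : Fn r} {φ : SmoothParam b} (h : Represents Φ φ) (p : domain b) :
    Φ p.1.1 (moveEnds b p.1.2) = evalAt b p φ := h p

theorem Represents.of_eval {Φ : Fn r} {φ : SmoothParam b}
    (h : ∀ p : domain b, Φ p.1.1 (moveEnds b p.1.2) = evalAt b p φ) : Represents Φ φ := h

theorem Represents.contDiffAt {Φ : Fn r} {φ : SmoothParam b} (h : Represents Φ φ) (p : domain b) :
    ContDiffAt ℝ (⊤ : ℕ∞) (fun q : ℝ × (Fin (2 * r) → ℝ) => Φ q.1 (moveEnds b q.2)) p := by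
  refine (φ.2.contDiffAt ((isOpen_domain b).mem_nhds p.2)).congr_of_eventuallyEq ?_
  filter_upwards [(isOpen_domain b).mem_nhds p.2] with q hq
  rw [extZero_apply φ.1 hq]
  exact h ⟨q, hq⟩

theorem Represents.wronskian {δ : Fn r → Fn r} {d : Derivation ℝ (SmoothParam b) (SmoothParam b)}
    (hδ : ∀ {Φ : Fn r} {φ : SmoothParam b}, Represents Φ φ → Represents (δ Φ) (d φ))
    {Φ Ψ : Fn r} {φ ψ : SmoothParam b} (h : Represents Φ φ) (h' : Represents Ψ ψ) :
    Represents (wronskian δ Φ Ψ) (MomentSystem.wr d φ ψ) :=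
  .of_eval fun p => by
  change δ Φ _ _ * Ψ _ _ - Φ _ _ * δ Ψ _ _ = evalAt b p _
  rw [(hδ h).eval, (hδ h').eval, h.eval, h'.eval, MomentSystem.wr, map_sub, map_mul, map_mul]

variable {L : Fn r} {ℓ β : SmoothParam b}

theorem Represents.Fplus (hL : Represents L ℓ) (k₁ : ℕ) :
    Represents (Fplus k₁ L) (derivD b (derivA b ℓ) - (k₁ : SmoothParam b)) :=
  .of_eval fun p => by
  change bdry (-1) (ExternalSource.dAlpha L) _ _ - _ = evalAt b p _
  rw [hL.dAlpha.bdry_neg_one.eval, map_sub, map_natCast]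

theorem Represents.Fminus (hL : Represents L ℓ) (k₂ : ℕ) :
    Represents (Fminus k₂ L) (-derivD b (derivD b ℓ + derivA b ℓ) - (k₂ : SmoothParam b)) :=
  .of_eval fun p => by
  change -bdry (-1) (bdry (-1) L + ExternalSource.dAlpha L) _ _ - _ = evalAt b p _
  rw [(hL.bdry_neg_one.add hL.dAlpha).bdry_neg_one.eval, map_sub, map_neg, map_natCast]

theorem Represents.H1plus (hL : Represents L ℓ) (hβ : ∀ p, β.1 p = (p.1.1)⁻¹) (k₁ k₂ : ℕ) :
    Represents (H1plus k₁ k₂ L) (4 * derivA b ℓ + 4 * paramα b * (k₁ : SmoothParam b) +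
      4 * (k₁ : SmoothParam b) * (k₂ : SmoothParam b) * β) :=
  .of_eval fun p => by
  have hβ' : (p.1.1)⁻¹ = evalAt b p β := (hβ p).symm
  have hα : p.1.1 = evalAt b p (paramα b) := rfl
  change 4 * ExternalSource.dAlpha L _ _ + 4 * p.1.1 * k₁ + 4 * k₁ * k₂ / p.1.1 = evalAt b p _
  rw [hL.dAlpha.eval, div_eq_mul_inv, hβ', hα]
  simp only [map_add, map_mul, map_ofNat, map_natCast]

theorem Represents.H1minus (hL : Represents L ℓ) (hβ : ∀ p, β.1 p = (p.1.1)⁻¹) (k₁ k₂ : ℕ) :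
    Represents (H1minus k₁ k₂ L) (-2 * (derivE b (derivA b ℓ) - paramα b * derivA b (derivA b ℓ) +
      derivA b ℓ) - 4 * (k₁ : SmoothParam b) * (k₂ : SmoothParam b) * β) :=
  .of_eval fun p => by
  have hβ' : (p.1.1)⁻¹ = evalAt b p β := (hβ p).symm
  have hα : p.1.1 = evalAt b p (paramα b) := rfl
  change -2 * (bdry 0 (ExternalSource.dAlpha L) _ _ - p.1.1 * ExternalSource.dAlpha
    (ExternalSource.dAlpha L) _ _ + ExternalSource.dAlpha L _ _) - 4 * k₁ * k₂ / p.1.1 = evalAt b p _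
  rw [hL.dAlpha.eval, hL.dAlpha.dAlpha.eval, hL.dAlpha.bdry_zero.eval, div_eq_mul_inv, hβ', hα]
  simp only [map_add, map_sub, map_neg, map_mul, map_ofNat, map_natCast]

theorem Represents.H2plus (hL : Represents L ℓ) :
    Represents (H2plus L) (2 * (derivE b (derivA b ℓ) - paramα b * derivA b (derivA b ℓ) -
      derivA b ℓ - 2 * paramα b * derivD b (derivA b ℓ))) :=
  .of_eval fun p => by
  have hα : p.1.1 = evalAt b p (paramα b) := rfl
  change 2 * (bdry 0 (ExternalSource.dAlpha L) _ _ - p.1.1 * ExternalSource.dAlpha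
    (ExternalSource.dAlpha L) _ _ - ExternalSource.dAlpha L _ _ -
    2 * p.1.1 * bdry (-1) (ExternalSource.dAlpha L) _ _) = evalAt b p _
  rw [hL.dAlpha.eval, hL.dAlpha.dAlpha.eval, hL.dAlpha.bdry_zero.eval, hL.dAlpha.bdry_neg_one.eval, hα]
  simp only [map_sub, map_mul, map_ofNat]

theorem Represents.H2minus (hL : Represents L ℓ) :
    Represents (H2minus L) (-2 * (derivE b (derivD b ℓ + derivA b ℓ) -
      paramα b * derivA b (derivD b ℓ + derivA b ℓ) - (derivD b ℓ + derivA b ℓ))) :=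
  .of_eval fun p => by
  have hα : p.1.1 = evalAt b p (paramα b) := rfl
  have h := hL.bdry_neg_one.add hL.dAlpha
  change -2 * (bdry 0 (bdry (-1) L + ExternalSource.dAlpha L) _ _ - p.1.1 * ExternalSource.dAlpha
    (bdry (-1) L + ExternalSource.dAlpha L) _ _ - (bdry (-1) L + ExternalSource.dAlpha L) _ _) =
    evalAt b p _
  rw [h.bdry_zero.eval, h.dAlpha.eval, h.eval, hα]
  simp only [map_sub, map_neg, map_mul, map_ofNat]

theorem Represents.half {Φ : Fn r} {φ : SmoothParam b} (h : Represents Φ φ) :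
    Represents (fun α b => Φ α b / 2) ((1 / 2 : ℝ) • φ) := fun p => by
  change Φ _ _ / 2 = (1 / 2 : ℝ) * φ.1 p
  rw [h p]
  ring

theorem two_mul_half_smul (x : SmoothParam b) : 2 * ((1 / 2 : ℝ) • x) = x :=
  Subtype.ext (funext fun p => by
    change 2 * ((1 / 2 : ℝ) * x.1 p) = x.1 p
    ring)

/-- The functions `F` and `G` of the equation and their `𝓑₋₁`-derivatives are represented by smooth
functions that satisfy the equation. -/
theorem exists_represents_equation (hr : 0 < r) (hb : StrictMono b) (k₁ k₂ : ℕ) :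
    ∃ ℓ Fp Fm Gp Gm : SmoothParam b, Represents (logProb k₁ k₂ r) ℓ ∧
      Represents (ExternalSource.Fplus k₁ (logProb k₁ k₂ r)) Fp ∧
      Represents (ExternalSource.Fminus k₂ (logProb k₁ k₂ r)) Fm ∧
      Represents (Gplus k₁ k₂ (logProb k₁ k₂ r)) Gp ∧ Represents (Gminus k₁ k₂ (logProb k₁ k₂ r)) Gm ∧
      (Fp * derivD b Gm + Fm * derivD b Gp) * (Fp * derivD b Fm - Fm * derivD b Fp)
        - (Fp * Gm + Fm * Gp) * (Fp * derivD b (derivD b Fm) - Fm * derivD b (derivD b Fp)) = 0 := by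
  obtain ⟨ℓ, β, hL, hβ, hαβ, hA, hD⟩ := exists_logParam hr hb k₁ k₂
  have hL : Represents (logProb k₁ k₂ r) ℓ := hL
  have hFp := hL.Fplus k₁
  have hFm := hL.Fminus k₂
  have hH1p := hL.H1plus hβ k₁ k₂
  have hH1m := hL.H1minus hβ k₁ k₂
  have hadd : ∀ {Φ Ψ : Fn r} {φ ψ : SmoothParam b}, Represents Φ φ → Represents Ψ ψ →
      Represents (fun α b => Φ α b + Ψ α b) (φ + ψ) := fun h h' => h.add h'
  have hsub : ∀ {Φ Ψ : Fn r} {φ ψ : SmoothParam b}, Represents Φ φ → Represents Ψ ψ →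
      Represents (fun α b => Φ α b - Ψ α b) (φ - ψ) := fun h h' p => congrArg₂ (· - ·) (h p) (h' p)
  have hGp := (hsub (Represents.wronskian (d := derivD b) Represents.bdry_neg_one hH1p hFp)
    (Represents.wronskian (d := derivA b) Represents.dAlpha hL.H2plus hFp)).half
  have hGm := (hadd (Represents.wronskian (d := derivD b) Represents.bdry_neg_one hH1m hFm)
    (Represents.wronskian (d := derivA b) Represents.dAlpha hL.H2minus hFm)).half
  -- The representatives found above are literally the expressions in the abstract identity, so its
  -- defining equations hold by reflexivity.
  obtain ⟨Ξ, h1, h2⟩ := (momentSystem hr hb k₁ k₂).exists_wr_eq (k₁ := k₁) (k₂ := k₂) hαβ rfl rfl hA hD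
    rfl rfl rfl rfl rfl rfl (two_mul_half_smul _) (two_mul_half_smul _)
  exact ⟨ℓ, _, _, _, _, hL, hFp, hFm, hGp, hGm, MomentSystem.pde_of_wr h1 h2⟩

end Equation

end ExternalSource

end

open ExternalSource in
theorem theorem5p1 (k₁ k₂ r : ℕ) (hr : 0 < r) (α : ℝ) (hα : α ≠ 0)
    (b : Fin (2 * r) → EReal) (hb : StrictMono b)
    -- notation for the functions and the operator in the equation
    (L Fp Fm Gp Gm : Fn r) (B : Fn r → Fn r) (hL : L = logProb k₁ k₂ r)
    (hFp : Fp = Fplus k₁ L) (hFm : Fm = Fminus k₂ L)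
    (hGp : Gp = Gplus k₁ k₂ L) (hGm : Gm = Gminus k₁ k₂ L) (hB : B = bdry (-1)) :
    -- the probability is positive, and its logarithm is smooth in `α` and the finite endpoints
    0 < prob k₁ k₂ α (intervals b) ∧
    ContDiffAt ℝ ∞ (fun p : ℝ × (Fin (2 * r) → ℝ) => L p.1 (moveEnds b p.2))
      (α, fun i => (b i).toReal) ∧
    -- the partial differential equation
    (Fp α b * B Gm α b + Fm α b * B Gp α b) * (Fp α b * B Fm α b - Fm α b * B Fp α b)
      - (Fp α b * Gm α b + Fm α b * Gp α b) * (Fp α b * B (B Fm) α b - Fm α b * B (B Fp) α b) = 0 ∧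
    -- its determinantal form
    Matrix.det !![Gp α b, B Fp α b, -Fp α b, 0;
                  -Gm α b, B Fm α b, -Fm α b, 0;
                  B Gp α b, B (B Fp) α b, 0, -Fp α b;
                  -B Gm α b, B (B Fm) α b, 0, -Fm α b] = 0 := by
  subst hL hFp hFm hGp hGm hB
  obtain ⟨ℓ, Fp, Fm, Gp, Gm, hL, hFp, hFm, hGp, hGm, heq⟩ := exists_represents_equation hr hb k₁ k₂
  -- At an infinite endpoint the coordinate has the default value 0, which `moveEnds` ignores.
  let p : domain b := ⟨(α, fun i => (b i).toReal), mem_domain_toReal hb hα⟩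
  have at_point : ∀ {Φ : Fn r} {φ : SmoothParam b}, Represents Φ φ → Φ α b = evalAt b p φ := fun h => by
    have h' := h.eval p
    rwa [moveEnds_toReal] at h'
  have hpde := congrArg (evalAt b p) heq
  simp only [map_add, map_sub, map_mul, map_zero] at hpde
  rw [← at_point hFp, ← at_point hFm, ← at_point hGp, ← at_point hGm, ← at_point hFp.bdry_neg_one,
    ← at_point hFm.bdry_neg_one, ← at_point hGp.bdry_neg_one, ← at_point hGm.bdry_neg_one,
    ← at_point hFp.bdry_neg_one.bdry_neg_one, ← at_point hFm.bdry_neg_one.bdry_neg_one] at hpde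
  refine ⟨prob_intervals_pos hr hb k₁ k₂ hα, hL.contDiffAt p, hpde, ?_⟩
  rw [det_equation, hpde, neg_zero]
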